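/- **Logic.** A vocabulary $\mathcal V$ is a finite set of system parameters, index variables, data variables and array variables; the size $|a|$ of each array $a$ is identified with a parameter. Index terms are $I::=I+n\mid i\mid n\mid |a|$ and data terms are $E::=E+n\mid v\mid n\mid a[I]$ with $n\in\mathbb Z$; atoms are $I\bowtie I$ (index expressions) and $E\bowtie E$ (data expressions) with $\bowtie\in\{=,\neq,\le,<,\ge,>\}$; array formulae are built from atoms by $\neg,\vee,\wedge$ and $\exists i,\forall i$ over index variables. Parameters and (free or quantified) index variables range over $\mathbb N$, data variables over $\mathbb Z$, arrays over maps $\mathbb Z\to\mathbb Z$, and terms are evaluated in $\mathbb Z$. A formula is *singly indexed* (SIA) if each of its data expressions contains at most one quantified index variable. It is *abstractable* if it is $\exists\bar i.\,\phi$ with $\phi$ SIA. An *array system* is $\mathfrak T=(\mathcal V,\phi_I,\phi_T)$ with $\phi_I$ a closed formula over $\mathcal V$ and $\phi_T$ one over $\mathcal V\uplus\mathcal V'$; it is abstractable if $\phi_I,\phi_T$ are. States are interpretations of $\mathcal V$; there is a step from $s$ to $t$ if $s\cdot t'\models\phi_T$ and $s,t$ agree on all parameters. A path is a finite or infinite sequence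 of steps from a state satisfying $\phi_I$. Temporal array properties add $\mathbf G,\mathbf F$ to the syntax (with LTL semantics on paths); such a property holds for $\mathfrak T$ if no path satisfies its negation. It is abstractable if it is built from SIA formulae by $\vee,\wedge,\exists i,\mathbf G,\mathbf F$. A safety array property is $\varphi=\forall\bar i.(\psi_1\Rightarrow\mathbf G\psi_2)$ with array formulae $\psi_1,\psi_2$ over $\mathcal V\uplus\{\bar i\}$; "$\neg\varphi$ is abstractable" refers to the negation normal form of $\neg\varphi$. **Abstraction.** Let $\mathcal V^\star=\mathcal V\uplus\{\bar c\}$ with fresh parameters $\bar c$, $\psi_j^\star=\psi_j[\bar c/\bar i]$, $\phi_I^\star=\phi_I\wedge\psi_1^\star$, $\phi_B=\neg\psi_2^\star$. Let $P=(P_1,\dots,P_m)$ be indexed predicates over $\mathcal V^\star$, i.e. atoms over $\mathcal V^\star\uplus\{\mathtt i\}$ in which the index variable $\mathtt i$ occurs; $P*P'$ is $P$ followed by its primed copy (with $\mathtt i$ unprimed). Let $r$ be the number of parameters and index variables of $\mathcal V^\star$ and $\Sigma_m=\{0,1\}^m$. Abstract states are pairs $(t,w)\in\mathbb N^r\times\Sigma_m^*$.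 A word $w$ over $\Sigma_m$ describes an interpretation $\sigma$ if for all $1\le i\le|w|$ and $k$, the $k$-th bit of $w[i]$ is $1$ iff $\sigma\models P_k[i/\mathtt i]$. For a set $S$ of states, $\alpha^P(S)$ is the set of $(s_{int},w)$ such that $s\in S$, $|w|$ is the maximal parameter value of $s$ ($0$ if there are no parameters), and $w$ describes $s$; $s_{int}$ is the restriction of $s$ to parameters and index variables. $\alpha^{P*P'}$ is defined likewise for sets of pairs of states, seen as interpretations of $\mathcal V^\star\uplus\mathcal V^{\star\prime}$. For a formula $\phi$ with prenex form $\delta x_1\cdots\delta x_n.\bigvee_j(g_j\wedge h_j)$, where $g_j$ is a conjunction of index expressions and $h_j$ one of data expressions, $\phi^P$ is obtained as follows. Replace $h_j$ by the conjunction of all clauses (finite disjunctions, possibly empty) $C$ of literals $P_k[t/\mathtt i],\neg P_k[t/\mathtt i]$ such that $h_j\Rightarrow C$ is valid, where $t$ ranges over the index terms of $h_j$, those of $P$ without $\mathtt i$, and $u[t'/\mathtt i]$ for $u$ an index term of $P$ and $t'$ one of $h_j$. Then replace each literal $P_k[t/\mathtt i]$ (resp. $\neg P_k[t/\mathtt i]$)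 by "if $1\le t\le|w|$ then the $k$-th bit of $w[t]$ is $1$ (resp. $0$)". Quantifiers range over $\mathbb N$. For transition formulae $P*P'$ and the convolution $w=u\odot v$ are used. Let $I$ and $B$ be the sets of abstract states $(t,w)$ with $|w|$ the maximal parameter value of $t$ that satisfy $(\phi_I^\star)^P$ and $\phi_B^P$, respectively; let $T$ be the set of pairs $((s,u),(t,v))$ of abstract states such that $|u|$, $|v|$ are the maximal parameter values of $s$, $t$, the parameters of $s$ and $t$ agree, and $(s\cdot t,u\odot v)$ satisfies $\phi_T^{P*P'}$. The language of a set of (pairs of) abstract states consists of the convolutions of its elements, with numbers in unary and $0$-padding. **Theorem.** There is a computable function that maps $\mathfrak T$, a safety array property $\varphi$ and a list $P$ of indexed predicates over $\mathcal V^\star$ to three finite automata $\mathcal I,\mathcal T,\mathcal B$ such that, whenever $\mathfrak T$ and $\neg\varphi$ are abstractable: 1. $\mathcal I,\mathcal T,\mathcal B$ recognize the languages of $I,T,B$, respectively; 2. $I,T,B$ are regular abstractions: $\alpha^P(\phi_I^\star)\subseteq I$, $\alpha^P(\phi_B)\subseteq B$, and for every $((s,t),w)$ in the $\alpha^{P*P'}$-abstraction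 of the set of steps (satisfying $\phi_T$, with the parameters of $\mathcal V^\star$ unchanged) there are $u,v$ with $w=u\odot v$ and $((s,u),(t,v))\in T$; 3. if $T^*(I)\cap B=\emptyset$, where $T^*$ is the reflexive-transitive closure of $T$, then $\varphi$ holds for $\mathfrak T$. -/

import Mathlib

namespace ArrayAbs

/-! ## Indexed array logic

Index variables (state variables, system parameters and quantified variables) range over `ℕ`;
index terms and data terms take values in `ℤ`, and arrays are total maps `ℤ → ℤ`.
The variables of a vocabulary are named by natural numbers, one name space per sort. A Boolean flag
tells whether an occurrence is primed. Quantified index variables are de Bruijn indices. -/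

/-- A finite vocabulary: `par` system parameters, `idx` index variables, `dat` data variables and
`size.length` array variables; the size of the array `a` is identified with the system
parameter `size[a]`. -/
structure Vocab where
  par : ℕ
  idx : ℕ
  dat : ℕ
  size : List ℕ

/-- Every array size is a parameter of the vocabulary. -/
def Vocab.WF (V : Vocab) : Prop := ∀ p ∈ V.size, p < V.par

/-- Occurrences of index variables: (primed?) parameters, (primed?) index variables, and
variables bound by quantifiers (or dangling ones, standing for the free variables of a context). -/
inductive IVar where
  | par (primed : Bool) (x : ℕ)
  | idx (primed : Bool) (x : ℕ)
  | bnd (k : ℕ)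

/-- Index terms `I ::= I + n | i | n | |a|`. -/
inductive ITerm where
  | var (x : IVar)
  | const (n : ℤ)
  | size (primed : Bool) (a : ℕ)
  | plus (I : ITerm) (n : ℤ)

/-- Data terms `E ::= E + n | v | n | a[I]`. -/
inductive DTerm where
  | var (primed : Bool) (v : ℕ)
  | const (n : ℤ)
  | get (primed : Bool) (a : ℕ) (I : ITerm)
  | plus (E : DTerm) (n : ℤ)

/-- The comparison symbols `=, ≠, ≤, <, ≥, >`. -/
inductive Cmp where
  | eq | ne | le | lt | ge | gt

/-- Atoms `I ⋈ I` (index expressions) and `E ⋈ E` (data expressions). -/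
inductive Atom where
  | idx (c : Cmp) (I J : ITerm)
  | dat (c : Cmp) (E F : DTerm)

/-- Indexed array formulae; quantification is over index variables only. -/
inductive Formula where
  | atom (A : Atom)
  | not (φ : Formula)
  | or (φ ψ : Formula)
  | and (φ ψ : Formula)
  | ex (φ : Formula)
  | all (φ : Formula)

/-! ### Semantics -/

/-- Values of the parameters and of the index variables. -/
structure Nums where
  par : ℕ → ℕ
  idx : ℕ → ℕ

/-- A state, i.e. an interpretation of the variables. Values at names that do not belong to the
vocabulary at hand are never inspected by formulae over that vocabulary. -/
structure State extends Nums where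
  dat : ℕ → ℤ
  arr : ℕ → ℤ → ℤ

/-- The interpretation `s · t'` of `V ⊎ V'`: `s` for unprimed and `t` for primed variables. -/
def join {α : Type} (s t : α) : Bool → α := fun primed => if primed then t else s

/-- Extend the environment of the bound variables by a value for the innermost one. -/
def push (n : ℕ) (e : ℕ → ℕ) : ℕ → ℕ
  | 0 => n
  | k + 1 => e k

def IVar.eval (ν : Bool → Nums) (e : ℕ → ℕ) : IVar → ℕ
  | .par b x => (ν b).par x
  | .idx b x => (ν b).idx x
  | .bnd k => e k

def ITerm.eval (V : Vocab) (ν : Bool → Nums) (e : ℕ → ℕ) : ITerm → ℤ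
  | .var x => (x.eval ν e : ℤ)
  | .const n => n
  | .size b a => ((ν b).par (V.size.getD a 0) : ℤ)
  | .plus I n => I.eval V ν e + n

def DTerm.eval (V : Vocab) (σ : Bool → State) (e : ℕ → ℕ) : DTerm → ℤ
  | .var b v => (σ b).dat v
  | .const n => n
  | .get b a I => (σ b).arr a (I.eval V (fun b => (σ b).toNums) e)
  | .plus E n => E.eval V σ e + n

def Cmp.eval : Cmp → ℤ → ℤ → Prop
  | .eq, x, y => x = y
  | .ne, x, y => x ≠ y
  | .le, x, y => x ≤ y
  | .lt, x, y => x < y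
  | .ge, x, y => x ≥ y
  | .gt, x, y => x > y

def Atom.eval (V : Vocab) (σ : Bool → State) (e : ℕ → ℕ) : Atom → Prop
  | .idx c I J => c.eval (I.eval V (fun b => (σ b).toNums) e) (J.eval V (fun b => (σ b).toNums) e)
  | .dat c E F => c.eval (E.eval V σ e) (F.eval V σ e)

def Formula.eval (V : Vocab) (σ : Bool → State) : Formula → (ℕ → ℕ) → Prop
  | .atom A, e => A.eval V σ e
  | .not φ, e => ¬ φ.eval V σ e
  | .or φ ψ, e => φ.eval V σ e ∨ ψ.eval V σ e
  | .and φ ψ, e => φ.eval V σ e ∧ ψ.eval V σ e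
  | .ex φ, e => ∃ n, φ.eval V σ (push n e)
  | .all φ, e => ∀ n, φ.eval V σ (push n e)

/-- Satisfaction of a closed state formula, and of a closed transition formula over `V ⊎ V'`. -/
def Formula.Sat (V : Vocab) (φ : Formula) (s : State) : Prop :=
  φ.eval V (fun _ => s) (fun _ => 0)

def Formula.SatTrans (V : Vocab) (φ : Formula) (s t : State) : Prop :=
  φ.eval V (join s t) (fun _ => 0)

/-! ### Expressions over a vocabulary

`Over V p n`: all variables belong to `V` (or to `V ⊎ V'` when `p = true`), and there are at
most the `n` dangling bound variables `0, …, n - 1`. -/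

def IVar.Over (V : Vocab) (p : Bool) (n : ℕ) : IVar → Prop
  | .par b x => (b = true → p = true) ∧ x < V.par
  | .idx b x => (b = true → p = true) ∧ x < V.idx
  | .bnd k => k < n

def ITerm.Over (V : Vocab) (p : Bool) (n : ℕ) : ITerm → Prop
  | .var x => x.Over V p n
  | .const _ => True
  | .size b a => (b = true → p = true) ∧ a < V.size.length
  | .plus I _ => I.Over V p n

def DTerm.Over (V : Vocab) (p : Bool) (n : ℕ) : DTerm → Prop
  | .var b v => (b = true → p = true) ∧ v < V.dat
  | .const _ => True
  | .get b a I => (b = true → p = true) ∧ a < V.size.length ∧ I.Over V p n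
  | .plus E _ => E.Over V p n

def Atom.Over (V : Vocab) (p : Bool) (n : ℕ) : Atom → Prop
  | .idx _ I J => I.Over V p n ∧ J.Over V p n
  | .dat _ E F => E.Over V p n ∧ F.Over V p n

def Formula.Over (V : Vocab) (p : Bool) : ℕ → Formula → Prop
  | n, .atom A => A.Over V p n
  | n, .not φ => φ.Over V p n
  | n, .or φ ψ => φ.Over V p n ∧ ψ.Over V p n
  | n, .and φ ψ => φ.Over V p n ∧ ψ.Over V p n
  | n, .ex φ => φ.Over V p (n + 1)
  | n, .all φ => φ.Over V p (n + 1)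

/-! ### Occurrences, substitution, priming, negation -/

/-- The bound variable `k` occurs. -/
def ITerm.Has (k : ℕ) : ITerm → Prop
  | .var x => x = .bnd k
  | .const _ => False
  | .size _ _ => False
  | .plus I _ => I.Has k

def DTerm.Has (k : ℕ) : DTerm → Prop
  | .var _ _ => False
  | .const _ => False
  | .get _ _ I => I.Has k
  | .plus E _ => E.Has k

def Atom.Has (k : ℕ) : Atom → Prop
  | .idx _ I J => I.Has k ∨ J.Has k
  | .dat _ E F => E.Has k ∨ F.Has k

/-- Replace every bound variable `k` by the term `f k`. -/
def ITerm.subst (f : ℕ → ITerm) : ITerm → ITerm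
  | .var (.bnd k) => f k
  | .var x => .var x
  | .const n => .const n
  | .size b a => .size b a
  | .plus I n => .plus (I.subst f) n

def DTerm.subst (f : ℕ → ITerm) : DTerm → DTerm
  | .var b v => .var b v
  | .const n => .const n
  | .get b a I => .get b a (I.subst f)
  | .plus E n => .plus (E.subst f) n

def Atom.subst (f : ℕ → ITerm) : Atom → Atom
  | .idx c I J => .idx c (I.subst f) (J.subst f)
  | .dat c E F => .dat c (E.subst f) (F.subst f)

/-- The substitution `f` moved under one quantifier. -/
def under (f : ℕ → ITerm) : ℕ → ITerm
  | 0 => .var (.bnd 0)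
  | k + 1 => (f k).subst fun j => .var (.bnd (j + 1))

def Formula.subst : (ℕ → ITerm) → Formula → Formula
  | f, .atom A => .atom (A.subst f)
  | f, .not φ => .not (φ.subst f)
  | f, .or φ ψ => .or (φ.subst f) (ψ.subst f)
  | f, .and φ ψ => .and (φ.subst f) (ψ.subst f)
  | f, .ex φ => .ex (φ.subst (under f))
  | f, .all φ => .all (φ.subst (under f))

/-- `I[t / 0]` and `A[t / 0]`: the innermost bound variable is replaced by `t`. -/
def instMap (t : ITerm) : ℕ → ITerm
  | 0 => t
  | k + 1 => .var (.bnd k)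

def ITerm.inst (t I : ITerm) : ITerm := I.subst (instMap t)

def Atom.inst (t : ITerm) (A : Atom) : Atom := A.subst (instMap t)

/-- Replace every variable `v` by `v'`. -/
def ITerm.prime : ITerm → ITerm
  | .var (.par _ x) => .var (.par true x)
  | .var (.idx _ x) => .var (.idx true x)
  | .var (.bnd k) => .var (.bnd k)
  | .const n => .const n
  | .size _ a => .size true a
  | .plus I n => .plus I.prime n

def DTerm.prime : DTerm → DTerm
  | .var _ v => .var true v
  | .const n => .const n
  | .get _ a I => .get true a I.prime
  | .plus E n => .plus E.prime n

def Atom.prime : Atom → Atom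
  | .idx c I J => .idx c I.prime J.prime
  | .dat c E F => .dat c E.prime F.prime

def Cmp.neg : Cmp → Cmp
  | .eq => .ne
  | .ne => .eq
  | .le => .gt
  | .lt => .ge
  | .ge => .lt
  | .gt => .le

def Atom.neg : Atom → Atom
  | .idx c I J => .idx c.neg I J
  | .dat c E F => .dat c.neg E F

/-- Negation normal form of `φ` (for `false`) and of `¬ φ` (for `true`). -/
def Formula.nnf : Bool → Formula → Formula
  | b, .atom A => .atom (if b then A.neg else A)
  | b, .not φ => φ.nnf (!b)
  | b, .or φ ψ => if b then .and (φ.nnf b) (ψ.nnf b) else .or (φ.nnf b) (ψ.nnf b)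
  | b, .and φ ψ => if b then .or (φ.nnf b) (ψ.nnf b) else .and (φ.nnf b) (ψ.nnf b)
  | b, .ex φ => if b then .all (φ.nnf b) else .ex (φ.nnf b)
  | b, .all φ => if b then .ex (φ.nnf b) else .all (φ.nnf b)

/-! ## Array systems and temporal array properties -/

/-- An array system `(V, φ_I, φ_T)`. -/
structure ArraySystem where
  V : Vocab
  init : Formula
  trans : Formula

/-- `φ_I` is a closed formula over `V`, and `φ_T` a closed formula over `V ⊎ V'`. -/
def ArraySystem.WF (S : ArraySystem) : Prop :=
  S.V.WF ∧ S.init.Over S.V false 0 ∧ S.trans.Over S.V true 0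

/-- Concrete transitions: `s · t' ⊨ φ_T`, and the system parameters are immutable. -/
def Step (V : Vocab) (φT : Formula) (s t : State) : Prop :=
  φT.SatTrans V s t ∧ ∀ x < V.par, s.par x = t.par x

/-- The finite (`L < ⊤`) or infinite (`L = ⊤`) sequence of the states `s i` with `i ≤ L`
is a path. -/
def ArraySystem.IsPath (S : ArraySystem) (L : ℕ∞) (s : ℕ → State) : Prop :=
  S.init.Sat S.V (s 0) ∧ ∀ i : ℕ, ((i + 1 : ℕ) : ℕ∞) ≤ L → Step S.V S.trans (s i) (s (i + 1))

/-- Temporal array properties; `glob` and `ev` are the connectives `G` and `F`. -/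
inductive TFormula where
  | st (ψ : Formula)
  | not (φ : TFormula)
  | or (φ ψ : TFormula)
  | and (φ ψ : TFormula)
  | ex (φ : TFormula)
  | all (φ : TFormula)
  | glob (φ : TFormula)
  | ev (φ : TFormula)

/-- Satisfaction at position `i` of the sequence of the states `s j` with `j ≤ L`. -/
def TFormula.eval (V : Vocab) (L : ℕ∞) (s : ℕ → State) : TFormula → ℕ → (ℕ → ℕ) → Prop
  | .st ψ, i, e => ψ.eval V (fun _ => s i) e
  | .not φ, i, e => ¬ φ.eval V L s i e
  | .or φ ψ, i, e => φ.eval V L s i e ∨ ψ.eval V L s i e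
  | .and φ ψ, i, e => φ.eval V L s i e ∧ ψ.eval V L s i e
  | .ex φ, i, e => ∃ n, φ.eval V L s i (push n e)
  | .all φ, i, e => ∀ n, φ.eval V L s i (push n e)
  | .glob φ, i, e => ∀ j, i ≤ j → (j : ℕ∞) ≤ L → φ.eval V L s j e
  | .ev φ, i, e => ∃ j, i ≤ j ∧ (j : ℕ∞) ≤ L ∧ φ.eval V L s j e

/-- A (closed) temporal array property holds for a system if no path satisfies its negation. -/
def ArraySystem.Holds (S : ArraySystem) (φ : TFormula) : Prop :=
  ¬ ∃ (L : ℕ∞) (s : ℕ → State), S.IsPath L s ∧ (TFormula.not φ).eval S.V L s 0 (fun _ => 0)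

/-- Negation normal form of `φ` (for `false`) and of `¬ φ` (for `true`). -/
def TFormula.nnf : Bool → TFormula → TFormula
  | b, .st ψ => .st (ψ.nnf b)
  | b, .not φ => φ.nnf (!b)
  | b, .or φ ψ => if b then .and (φ.nnf b) (ψ.nnf b) else .or (φ.nnf b) (ψ.nnf b)
  | b, .and φ ψ => if b then .or (φ.nnf b) (ψ.nnf b) else .and (φ.nnf b) (ψ.nnf b)
  | b, .ex φ => if b then .all (φ.nnf b) else .ex (φ.nnf b)
  | b, .all φ => if b then .ex (φ.nnf b) else .all (φ.nnf b)
  | b, .glob φ => if b then .ev (φ.nnf b) else .glob (φ.nnf b)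
  | b, .ev φ => if b then .glob (φ.nnf b) else .ev (φ.nnf b)

/-- A block of `k` universal quantifiers. -/
def TFormula.alls : ℕ → TFormula → TFormula
  | 0, φ => φ
  | k + 1, φ => .all (TFormula.alls k φ)

/-- A safety array property `∀ i_1 … i_k. (ψ₁ ⇒ G ψ₂)`; in `ψ₁` and `ψ₂` the variables
`i_1, …, i_k` are the dangling bound variables `k - 1, …, 0`. -/
structure SafetyProperty where
  k : ℕ
  pre : Formula
  post : Formula

def SafetyProperty.WF (V : Vocab) (φ : SafetyProperty) : Prop :=
  φ.pre.Over V false φ.k ∧ φ.post.Over V false φ.k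

def SafetyProperty.toTemporal (φ : SafetyProperty) : TFormula :=
  .alls φ.k (.or (.not (.st φ.pre)) (.glob (.st φ.post)))

/-! ### Singly indexed and abstractable formulae -/

/-- Under `d` quantifiers of the formula, every data expression contains at most one variable
bound by these quantifiers. -/
def Formula.SIAux : ℕ → Formula → Prop
  | d, .atom (.dat c E F) =>
      ∀ k < d, ∀ l < d, (Atom.dat c E F).Has k → (Atom.dat c E F).Has l → k = l
  | _, .atom (.idx _ _ _) => True
  | d, .not φ => φ.SIAux d
  | d, .or φ ψ => φ.SIAux d ∧ ψ.SIAux d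
  | d, .and φ ψ => φ.SIAux d ∧ ψ.SIAux d
  | d, .ex φ => φ.SIAux (d + 1)
  | d, .all φ => φ.SIAux (d + 1)

/-- Singly indexed array (SIA) formulae. -/
def Formula.SIA (φ : Formula) : Prop := φ.SIAux 0

/-- Abstractable array formulae: `∃ i_1 … i_n. φ` with `φ` singly indexed. -/
inductive Formula.Abstractable : Formula → Prop
  | sia {φ : Formula} : φ.SIA → Formula.Abstractable φ
  | ex {φ : Formula} : Formula.Abstractable φ → Formula.Abstractable (.ex φ)

def ArraySystem.Abstractable (S : ArraySystem) : Prop :=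
  S.init.Abstractable ∧ S.trans.Abstractable

/-- The non-temporal part of the grammar of abstractable properties. -/
inductive Formula.StateAbstractable : Formula → Prop
  | sia {φ : Formula} : φ.SIA → Formula.StateAbstractable φ
  | or {φ ψ : Formula} : Formula.StateAbstractable φ → Formula.StateAbstractable ψ →
      Formula.StateAbstractable (.or φ ψ)
  | and {φ ψ : Formula} : Formula.StateAbstractable φ → Formula.StateAbstractable ψ →
      Formula.StateAbstractable (.and φ ψ)
  | ex {φ : Formula} : Formula.StateAbstractable φ → Formula.StateAbstractable (.ex φ)

/-- Abstractable temporal array properties `φ ::= ψ | φ ∨ φ | φ ∧ φ | ∃ i. φ | G φ | F φ`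
for singly indexed `ψ`. -/
inductive TFormula.Abstractable : TFormula → Prop
  | st {ψ : Formula} : ψ.StateAbstractable → TFormula.Abstractable (.st ψ)
  | or {φ ψ : TFormula} : TFormula.Abstractable φ → TFormula.Abstractable ψ →
      TFormula.Abstractable (.or φ ψ)
  | and {φ ψ : TFormula} : TFormula.Abstractable φ → TFormula.Abstractable ψ →
      TFormula.Abstractable (.and φ ψ)
  | ex {φ : TFormula} : TFormula.Abstractable φ → TFormula.Abstractable (.ex φ)
  | glob {φ : TFormula} : TFormula.Abstractable φ → TFormula.Abstractable (.glob φ)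
  | ev {φ : TFormula} : TFormula.Abstractable φ → TFormula.Abstractable (.ev φ)

/-! ### The Skolemized system `(V⋆, φ_I⋆, φ_T, φ_B)` -/

/-- `V⋆`: the vocabulary with `k` fresh system parameters. -/
def Vocab.star (V : Vocab) (k : ℕ) : Vocab := { V with par := V.par + k }

/-- `ψ⋆`: the dangling bound variables are replaced by the fresh parameters. -/
def Formula.star (V : Vocab) (ψ : Formula) : Formula :=
  ψ.subst fun j => .var (.par false (V.par + j))

def initStar (S : ArraySystem) (φ : SafetyProperty) : Formula := .and S.init (φ.pre.star S.V)

def badStar (S : ArraySystem) (φ : SafetyProperty) : Formula := .not (φ.post.star S.V)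

/-! ## Indexed predicate abstraction -/

/-- An indexed predicate over `V`: an atom over `V` and the designated index variable, which is
the bound variable `0` and occurs in the atom. -/
def IsIndexedPredicate (V : Vocab) (A : Atom) : Prop := A.Over V false 1 ∧ A.Has 0

/-- The predicates `P * P'`. -/
def starPred {m : ℕ} (P : Fin m → Atom) : Fin (m + m) → Atom :=
  Fin.append P fun k => (P k).prime

/-- Words over the bitvectors of length `m`. -/
abbrev BWord (m : ℕ) := List (Fin m → Bool)

/-- Interpretations of the parameters and index variables of `V`, i.e. elements of `ℕ ^ r`. -/
@[ext] structure AbsNums (V : Vocab) where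
  par : Fin V.par → ℕ
  idx : Fin V.idx → ℕ

/-- The abstract domain `ℕ ^ r × Σ_m^*`. -/
abbrev AbsState (V : Vocab) (m : ℕ) := AbsNums V × BWord m

def State.restrict (V : Vocab) (s : State) : AbsNums V :=
  ⟨fun x => s.par x, fun x => s.idx x⟩

/-- The values of an abstract state, as a (total) interpretation of names. -/
def AbsNums.toNums {V : Vocab} (t : AbsNums V) : Nums where
  par := fun x => if h : x < V.par then t.par ⟨x, h⟩ else 0
  idx := fun x => if h : x < V.idx then t.idx ⟨x, h⟩ else 0

/-- The largest value of a parameter (`0` if there is no parameter). -/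
def AbsNums.maxPar {V : Vocab} (t : AbsNums V) : ℕ := Finset.univ.sup t.par

/-- `(i, w) ∈ Δ_k`: `1 ≤ i ≤ |w|` and the `k`-th bit of the `i`-th letter of `w` is `1`. -/
def Delta {m : ℕ} (k : Fin m) (i : ℤ) (w : BWord m) : Prop :=
  1 ≤ i ∧ ∃ v : Fin m → Bool, w[(i - 1).toNat]? = some v ∧ v k = true

/-- `σ ⊨ Φ_w^P`: at the positions `1, …, |w|`, the word `w` records the truth values of the
predicates. -/
def Describes (V : Vocab) {m : ℕ} (P : Fin m → Atom) (σ : Bool → State) (w : BWord m) : Prop :=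
  ∀ i : ℤ, 1 ≤ i → i ≤ w.length → ∀ k : Fin m,
    (((P k).inst (.const i)).eval V σ (fun _ => 0) ↔ Delta k i w)

/-- The abstraction `α^P(S)` of a set of concrete states. -/
def alpha (V : Vocab) {m : ℕ} (P : Fin m → Atom) (S : Set State) : Set (AbsState V m) :=
  { a | ∃ s ∈ S, a.1 = s.restrict V ∧ a.2.length = a.1.maxPar ∧ Describes V P (fun _ => s) a.2 }

/-- The abstraction `α^{P * P'}(S)` of a set of interpretations of `V ⊎ V'`. -/
def alphaTrans (V : Vocab) {m : ℕ} (P : Fin m → Atom) (S : Set (State × State)) :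
    Set ((AbsNums V × AbsNums V) × BWord (m + m)) :=
  { a | ∃ p ∈ S, a.1 = (p.1.restrict V, p.2.restrict V) ∧
      a.2.length = max a.1.1.maxPar a.1.2.maxPar ∧
      Describes V (starPred P) (join p.1 p.2) a.2 }

/-- The convolution `u ⊙ v`. -/
def conv {m n : ℕ} (u : BWord m) (v : BWord n) : BWord (m + n) :=
  (List.range (max u.length v.length)).map fun i =>
    Fin.append (u.getD i fun _ => false) (v.getD i fun _ => false)

/-- `τ((s, u), (t, v)) = (s · t, u ⊙ v)`. -/
def tau {V : Vocab} {m : ℕ} (p : AbsState V m × AbsState V m) :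
    (AbsNums V × AbsNums V) × BWord (m + m) :=
  ((p.1.1, p.2.1), conv p.1.2 p.2.2)

/-! ## The abstraction procedure -/

/-- A formula `δ x_1 … δ x_n. ⋁_j ⋀_l A_{jl}` in prenex form with a matrix in disjunctive normal
form: the quantifiers, outermost first (`true` for `∀`, `false` for `∃`), and the matrix. -/
structure PrenexDNF where
  quants : List Bool
  matrix : List (List Atom)

/-- Insert `n` new variables above the `c` innermost bound ones. -/
def raise (c n : ℕ) (M : List (List Atom)) : List (List Atom) :=
  M.map fun l => l.map fun A => A.subst fun k => .var (.bnd (if k < c then k else k + n))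

/-- Disjunction of two formulae in prenex disjunctive normal form. -/
def PrenexDNF.or (φ ψ : PrenexDNF) : PrenexDNF where
  quants := φ.quants ++ ψ.quants
  matrix := raise 0 ψ.quants.length φ.matrix ++ raise ψ.quants.length φ.quants.length ψ.matrix

/-- Conjunction of two formulae in prenex disjunctive normal form. -/
def PrenexDNF.and (φ ψ : PrenexDNF) : PrenexDNF where
  quants := φ.quants ++ ψ.quants
  matrix := (raise 0 ψ.quants.length φ.matrix).flatMap fun l =>
    (raise ψ.quants.length φ.quants.length ψ.matrix).map fun l' => l ++ l'

/-- Prenex disjunctive normal form of `φ` (for `false`) and of `¬ φ` (for `true`). -/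
def Formula.prenex : Bool → Formula → PrenexDNF
  | b, .atom A => ⟨[], [[if b then A.neg else A]]⟩
  | b, .not φ => φ.prenex (!b)
  | b, .or φ ψ => if b then (φ.prenex b).and (ψ.prenex b) else (φ.prenex b).or (ψ.prenex b)
  | b, .and φ ψ => if b then (φ.prenex b).or (ψ.prenex b) else (φ.prenex b).and (ψ.prenex b)
  | b, .ex φ => ⟨b :: (φ.prenex b).quants, (φ.prenex b).matrix⟩
  | b, .all φ => ⟨(!b) :: (φ.prenex b).quants, (φ.prenex b).matrix⟩

def DTerm.iterms : DTerm → List ITerm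
  | .var _ _ => []
  | .const _ => []
  | .get _ _ I => [I]
  | .plus E _ => E.iterms

/-- The index terms of an atom. -/
def Atom.iterms : Atom → List ITerm
  | .idx _ I J => [I, J]
  | .dat _ E F => E.iterms ++ F.iterms

def Atom.IsData : Atom → Prop
  | .idx _ _ _ => False
  | .dat _ _ _ => True

/-- The literal `P_k[t / i]` (for `pos = true`) or `¬ P_k[t / i]` (for `pos = false`). -/
structure Lit (m : ℕ) where
  pos : Bool
  k : Fin m
  t : ITerm

def Lit.eval (V : Vocab) {m : ℕ} (P : Fin m → Atom) (σ : Bool → State) (e : ℕ → ℕ)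
    (l : Lit m) : Prop :=
  ((P l.k).inst l.t).eval V σ e ↔ l.pos = true

/-- `t` is an index term of one of the atoms of `h`, or of a predicate, where the designated
variable of the predicate is instantiated with an index term of `h`. -/
def IsTermOf {m : ℕ} (P : Fin m → Atom) (h : Set Atom) (t : ITerm) : Prop :=
  (∃ A ∈ h, t ∈ A.iterms) ∨
  (∃ k, t ∈ (P k).iterms ∧ ¬ t.Has 0) ∨
  (∃ k, ∃ u ∈ (P k).iterms, ∃ A ∈ h, ∃ t' ∈ A.iterms, t = u.inst t')

/-- The clauses `C ⊆ A(h, P)` such that `⋀ h ⇒ ⋁ C` is valid; the conjunction of these clauses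
is the constraint that replaces `⋀ h`. -/
def IsConstrClause (V : Vocab) {m : ℕ} (P : Fin m → Atom) (h : Set Atom)
    (C : List (Lit m)) : Prop :=
  (∀ l ∈ C, IsTermOf P h l.t) ∧
  ∀ (σ : Bool → State) (e : ℕ → ℕ), (∀ A ∈ h, A.eval V σ e) → ∃ l ∈ C, l.eval V P σ e

/-- The translation `κ(l)` of a literal: within the bounds `1 ≤ t ≤ |w|`, the bit of `w` at
position `t` agrees with the literal. -/
def Lit.kappa (V : Vocab) {m : ℕ} (ν : Bool → Nums) (w : BWord m) (e : ℕ → ℕ)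
    (l : Lit m) : Prop :=
  1 ≤ l.t.eval V ν e → l.t.eval V ν e ≤ w.length →
    (Delta l.k (l.t.eval V ν e) w ↔ l.pos = true)

def Atom.evalIdx (V : Vocab) (ν : Bool → Nums) (e : ℕ → ℕ) : Atom → Prop
  | .idx c I J => c.eval (I.eval V ν e) (J.eval V ν e)
  | .dat _ _ _ => True

/-- Satisfaction of `κ(⋁_j (g_j ∧ constr(h_j)))`, where `g_j` and `h_j` consist of the index
expressions and of the data expressions of the `j`-th disjunct of the matrix `M`. -/
def matrixSat (V : Vocab) {m : ℕ} (P : Fin m → Atom) (M : List (List Atom))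
    (ν : Bool → Nums) (w : BWord m) (e : ℕ → ℕ) : Prop :=
  ∃ c ∈ M, (∀ A ∈ c, A.evalIdx V ν e) ∧
    ∀ C : List (Lit m), IsConstrClause V P {A | A ∈ c ∧ A.IsData} C → ∃ l ∈ C, l.kappa V ν w e

/-- Satisfaction of a block of quantifiers over `ℕ` in front of `p`. -/
def quantSat : List Bool → ((ℕ → ℕ) → Prop) → (ℕ → ℕ) → Prop
  | [], p, e => p e
  | true :: q, p, e => ∀ n, quantSat q p (push n e)
  | false :: q, p, e => ∃ n, quantSat q p (push n e)

/-- Satisfaction of the abstraction `φ^P = κ(φ^*)` of `φ`, where `φ^*` is obtained from the prenex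
disjunctive normal form of `φ` by replacing each `h_j` with its constraint. -/
def Formula.absSat (V : Vocab) {m : ℕ} (P : Fin m → Atom) (φ : Formula)
    (ν : Bool → Nums) (w : BWord m) : Prop :=
  quantSat (φ.prenex false).quants (matrixSat V P (φ.prenex false).matrix ν w) (fun _ => 0)

/-- The abstraction of a state formula: the abstract states satisfying `φ^P` (with words of the
length prescribed by the parameters). -/
def absStates (V : Vocab) {m : ℕ} (P : Fin m → Atom) (φ : Formula) : Set (AbsState V m) :=
  { a | a.2.length = a.1.maxPar ∧ φ.absSat V P (fun _ => a.1.toNums) a.2 }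

/-- The abstraction of a transition formula: the pairs of abstract states satisfying `φ^{P * P'}`
(with words of the prescribed lengths, and with immutable parameters). -/
def absTrans (V : Vocab) {m : ℕ} (P : Fin m → Atom) (φ : Formula) :
    Set (AbsState V m × AbsState V m) :=
  { p | p.1.2.length = p.1.1.maxPar ∧ p.2.2.length = p.2.1.maxPar ∧ p.1.1.par = p.2.1.par ∧
      φ.absSat V (starPred P) (join p.1.1.toNums p.2.1.toNums) (conv p.1.2 p.2.2) }

/-! ## Finite automata and regular relations -/

/-- A nondeterministic finite automaton over bitvectors: the lists of its initial states, of its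
final states, and of its transitions. -/
abbrev Automaton := List ℕ × List ℕ × List (ℕ × List Bool × ℕ)

def Automaton.toNFA (A : Automaton) : NFA (List Bool) ℕ where
  step q a := { q' | (q, a, q') ∈ A.2.2 }
  start := { q | q ∈ A.1 }
  accept := { q | q ∈ A.2.1 }

/-- The `i`-th letter (from `0`) of the convolution of an abstract state, with numbers written in
unary and `0`s as padding. -/
def letter {V : Vocab} {m : ℕ} (a : AbsState V m) (i : ℕ) : List Bool :=
  List.ofFn (fun x => decide (i < a.1.par x)) ++ List.ofFn (fun x => decide (i < a.1.idx x)) ++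
    List.ofFn (a.2.getD i fun _ => false)

/-- The length of the convolution of an abstract state. -/
def convLength {V : Vocab} {m : ℕ} (a : AbsState V m) : ℕ :=
  max (max (Finset.univ.sup a.1.par) (Finset.univ.sup a.1.idx)) a.2.length

/-- The language representation of a set of abstract states. -/
def lang {V : Vocab} {m : ℕ} (R : Set (AbsState V m)) : Language (List Bool) :=
  (fun a => (List.range (convLength a)).map (letter a)) '' R

/-- The language representation of a binary relation on abstract states. -/
def langTrans {V : Vocab} {m : ℕ} (R : Set (AbsState V m × AbsState V m)) :
    Language (List Bool) :=
  (fun p => (List.range (max (convLength p.1) (convLength p.2))).map fun i =>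
    letter p.1 i ++ letter p.2 i) '' R

/-- The safety property `T^*(I) ∩ B = ∅`. -/
def SafetyHolds {α : Type} (I : Set α) (T : Set (α × α)) (B : Set α) : Prop :=
  { b | ∃ a ∈ I, Relation.ReflTransGen (fun x y => (x, y) ∈ T) a b } ∩ B = ∅

/-! ## Codes

Injective numberings of the syntax, through which inputs are passed to a computable function. -/

def IVar.code : IVar → ℕ
  | .par b x => Nat.pair 0 (Nat.pair (Encodable.encode b) x)
  | .idx b x => Nat.pair 1 (Nat.pair (Encodable.encode b) x)
  | .bnd k => Nat.pair 2 k

def ITerm.code : ITerm → ℕ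
  | .var x => Nat.pair 0 x.code
  | .const n => Nat.pair 1 (Encodable.encode n)
  | .size b a => Nat.pair 2 (Nat.pair (Encodable.encode b) a)
  | .plus I n => Nat.pair 3 (Nat.pair I.code (Encodable.encode n))

def DTerm.code : DTerm → ℕ
  | .var b v => Nat.pair 0 (Nat.pair (Encodable.encode b) v)
  | .const n => Nat.pair 1 (Encodable.encode n)
  | .get b a I => Nat.pair 2 (Nat.pair (Encodable.encode b) (Nat.pair a I.code))
  | .plus E n => Nat.pair 3 (Nat.pair E.code (Encodable.encode n))

def Cmp.code : Cmp → ℕ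
  | .eq => 0
  | .ne => 1
  | .le => 2
  | .lt => 3
  | .ge => 4
  | .gt => 5

def Atom.code : Atom → ℕ
  | .idx c I J => Nat.pair 0 (Nat.pair c.code (Nat.pair I.code J.code))
  | .dat c E F => Nat.pair 1 (Nat.pair c.code (Nat.pair E.code F.code))

def Formula.code : Formula → ℕ
  | .atom A => Nat.pair 0 A.code
  | .not φ => Nat.pair 1 φ.code
  | .or φ ψ => Nat.pair 2 (Nat.pair φ.code ψ.code)
  | .and φ ψ => Nat.pair 3 (Nat.pair φ.code ψ.code)
  | .ex φ => Nat.pair 4 φ.code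
  | .all φ => Nat.pair 5 φ.code

theorem IVar.code_injective : Function.Injective IVar.code := by
  intro x y h
  cases x <;> cases y <;> simp [IVar.code, Encodable.encode_inj] at h ⊢ <;> exact h

theorem ITerm.code_injective : Function.Injective ITerm.code := by
  intro x
  induction x with
  | var x => intro y h; cases y <;> simp [ITerm.code] at h ⊢; exact IVar.code_injective h
  | const n => intro y h; cases y <;> simp [ITerm.code] at h ⊢; exact h
  | size b a => intro y h; cases y <;> simp [ITerm.code, Encodable.encode_inj] at h ⊢; exact h
  | plus I n ih => intro y h; cases y <;> simp [ITerm.code] at h ⊢; exact ⟨ih h.1, h.2⟩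

theorem DTerm.code_injective : Function.Injective DTerm.code := by
  intro x
  induction x with
  | var b x => intro y h; cases y <;> simp [DTerm.code, Encodable.encode_inj] at h ⊢; exact h
  | const n => intro y h; cases y <;> simp [DTerm.code] at h ⊢; exact h
  | get b a I =>
    intro y h
    cases y <;> simp [DTerm.code, Encodable.encode_inj] at h ⊢
    exact ⟨h.1, h.2.1, ITerm.code_injective h.2.2⟩
  | plus I n ih => intro y h; cases y <;> simp [DTerm.code] at h ⊢; exact ⟨ih h.1, h.2⟩

theorem Cmp.code_injective : Function.Injective Cmp.code := by
  intro x y h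
  cases x <;> cases y <;> simp [Cmp.code] at h ⊢

theorem Atom.code_injective : Function.Injective Atom.code := by
  intro x y h
  cases x <;> cases y <;> simp [Atom.code] at h ⊢
  · exact ⟨Cmp.code_injective h.1, ITerm.code_injective h.2.1, ITerm.code_injective h.2.2⟩
  · exact ⟨Cmp.code_injective h.1, DTerm.code_injective h.2.1, DTerm.code_injective h.2.2⟩

theorem Formula.code_injective : Function.Injective Formula.code := by
  intro x
  induction x with
  | atom A => intro y h; cases y <;> simp [Formula.code] at h ⊢; exact Atom.code_injective h
  | not φ ih => intro y h; cases y <;> simp [Formula.code] at h ⊢; exact ih h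
  | or φ ψ i j => intro y h; cases y <;> simp [Formula.code] at h ⊢; exact ⟨i h.1, j h.2⟩
  | and φ ψ i j => intro y h; cases y <;> simp [Formula.code] at h ⊢; exact ⟨i h.1, j h.2⟩
  | ex φ ih => intro y h; cases y <;> simp [Formula.code] at h ⊢; exact ih h
  | all φ ih => intro y h; cases y <;> simp [Formula.code] at h ⊢; exact ih h

/-- Vocabularies `(par, idx, dat, size)`. -/
abbrev VocabCode := ℕ × ℕ × ℕ × List ℕ

/-- Codes of a system (vocabulary, initial formula, transition formula), of a safety property
(number of quantified variables, `ψ₁`, `ψ₂`) and of a list of predicates. -/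
abbrev InputCode := (VocabCode × ℕ × ℕ) × (ℕ × ℕ × ℕ) × List ℕ

def inputCode (S : ArraySystem) (φ : SafetyProperty) {m : ℕ} (P : Fin m → Atom) : InputCode :=
  (((S.V.par, S.V.idx, S.V.dat, S.V.size), S.init.code, S.trans.code),
    (φ.k, φ.pre.code, φ.post.code), List.ofFn fun k => (P k).code)

end ArrayAbs

open ArrayAbs

-- The two soundness claims are the easy half. Prenexing preserves meaning (`Formula.sat_prenex`),
-- and the abstraction touches only the matrix: it replaces `h_j` by clauses that `h_j` implies and
-- reads their literals off a word that records the truth values of the predicates. The new matrix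
-- is therefore weaker, and quantifier blocks are monotone (`Formula.absSat_of_eval`). If a path
-- violates the property, the values of the universally quantified variables at the violation become
-- the fresh parameters, constant along the path; each state is abstracted by its own word of truth
-- values, and the result is an abstract run from `I` to `B` (`holds_of_safetyHolds`).
--
-- The substance is that the automata exist and can be computed uniformly. The conjunction of all
-- implied clauses holds for a word if and only if some interpretation satisfies `h_j` and agrees
-- with the word at all relevant positions: otherwise the clause of all literals that the word
-- falsifies would itself be implied (`constr_iff`). Whether such an interpretation exists is a
-- question about difference constraints between finitely many integers. Long gaps can be shortened,
-- so a finite search decides it (`exists_compression`, `matrixBool_iff`).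
--
-- For the input word, an abstracted matrix is a Boolean combination of finitely many comparisons `x
-- + c ≤ y` and bit tests at positions `x + c`. With numbers in unary, each of these is recognized
-- by a finite automaton whose size is bounded explicitly, and hence so is the matrix
-- (`recognizable_matrixPred`). Each quantifier raises the bound from `N` to `4 ^ N`
-- (`Recognizable.ex`). The same automata show that witnesses can be bounded, so membership of a
-- given word is decidable (`Recognizable.exists_bounded`, `quantBounded_iff`).
--
-- The automata behind the bounds are never constructed. A decidable language together with a bound
-- `N` on the index of a right congruence that saturates it determines an automaton, in the manner
-- of Myhill and Nerode: short words serve as states, and short tests tell inequivalent words apart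
-- (`learnedAutomaton_accepts`). This gives `formulaAutomaton_accepts`; the identification of words
-- with abstract states is made in `lang_absStates` and `langTrans_absTrans`. Every ingredient is
-- primitive recursive, with formulae entering as normal forms extracted from their codes
-- (`codeFormula_code`).

attribute [fun_prop] Primrec

namespace ArrayAbs

/-! ### Course-of-values recursion and enumeration of words. -/

section Lists

variable {β σ : Type}

/-! ### Recursion on codes -/

/-- The list of the values at `0, …, n - 1` of a function defined by course-of-values recursion. -/
def courseTable (G : ℕ → List σ → σ) (n : ℕ) : List σ :=
  Nat.rec [] (fun n t => t ++ [G n t]) n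

/-- The function defined by course-of-values recursion. -/
def courseRec (G : ℕ → List σ → σ) (n : ℕ) : σ := G n (courseTable G n)

theorem courseTable_eq (G : ℕ → List σ → σ) (n : ℕ) :
    courseTable G n = (List.range n).map (courseRec G) := by
  induction n with
  | zero => rfl
  | succ n ih =>
    rw [List.range_succ, List.map_append, ← ih]; rfl

/-- Recursive calls at smaller arguments become look-ups; recursion over syntax is run on codes in
this way. -/
theorem courseTable_getD (G : ℕ → List σ → σ) {k n : ℕ} (h : k < n) (d : σ) :
    (courseTable G n).getD k d = courseRec G k := by
  rw [courseTable_eq]; simp [h]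

/-! ### Words -/

/-- The words of length `n` over the alphabet `A`. -/
def words (A : List β) (n : ℕ) : List (List β) :=
  Nat.rec [[]] (fun _ t => t.flatMap fun w => A.map fun a => a :: w) n

theorem mem_words {A : List β} {n : ℕ} {w : List β} :
    w ∈ words A n ↔ w.length = n ∧ ∀ a ∈ w, a ∈ A := by
  induction n generalizing w with
  | zero => simp [words]; rintro rfl; simp
  | succ n ih =>
    change w ∈ (words A n).flatMap _ ↔ _
    cases w with
    | nil => simp
    | cons a w => simp [ih]; tauto

/-- The words of length less than `n` over the alphabet `A`. -/
def wordsLt (A : List β) (n : ℕ) : List (List β) := (List.range n).flatMap (words A)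

theorem mem_wordsLt {A : List β} {n : ℕ} {w : List β} :
    w ∈ wordsLt A n ↔ w.length < n ∧ ∀ a ∈ w, a ∈ A := by
  simp [wordsLt, mem_words]

end Lists

/-! ## Primitive recursive functions -/

section PrimrecLibrary

variable {α β γ σ : Type} [Primcodable α] [Primcodable β] [Primcodable γ] [Primcodable σ]

@[fun_prop] theorem primrec_id : Primrec (fun a : α => a) := Primrec.id

@[fun_prop] theorem primrec_const (x : σ) : Primrec (fun _ : α => x) := Primrec.const x

@[fun_prop] theorem primrec_comp {f : β → σ} {g : α → β} (hf : Primrec f) (hg : Primrec g) :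
    Primrec fun a => f (g a) := hf.comp hg

@[fun_prop] theorem primrec_pair {f : α → β} {g : α → γ} (hf : Primrec f) (hg : Primrec g) :
    Primrec fun a => (f a, g a) := Primrec.pair hf hg

@[fun_prop] theorem primrec_fst {f : α → β × γ} (hf : Primrec f) : Primrec fun a => (f a).1 :=
  Primrec.fst.comp hf

@[fun_prop] theorem primrec_snd {f : α → β × γ} (hf : Primrec f) : Primrec fun a => (f a).2 :=
  Primrec.snd.comp hf

@[fun_prop] theorem primrec_add {f g : α → ℕ} (hf : Primrec f) (hg : Primrec g) :
    Primrec fun a => f a + g a := Primrec.nat_add.comp hf hg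

@[fun_prop] theorem primrec_sub {f g : α → ℕ} (hf : Primrec f) (hg : Primrec g) :
    Primrec fun a => f a - g a := Primrec.nat_sub.comp hf hg

@[fun_prop] theorem primrec_mul {f g : α → ℕ} (hf : Primrec f) (hg : Primrec g) :
    Primrec fun a => f a * g a := Primrec.nat_mul.comp hf hg

@[fun_prop] theorem primrec_pow {f g : α → ℕ} (hf : Primrec f) (hg : Primrec g) :
    Primrec fun a => f a ^ g a :=
  (Primrec₂.unpaired'.1 Nat.Primrec.pow).comp hf hg

@[fun_prop] theorem primrec_div {f g : α → ℕ} (hf : Primrec f) (hg : Primrec g) :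
    Primrec fun a => f a / g a := Primrec.nat_div.comp hf hg

@[fun_prop] theorem primrec_mod {f g : α → ℕ} (hf : Primrec f) (hg : Primrec g) :
    Primrec fun a => f a % g a := Primrec.nat_mod.comp hf hg

@[fun_prop] theorem primrec_unpair {f : α → ℕ} (hf : Primrec f) :
    Primrec fun a => (f a).unpair := Primrec.unpair.comp hf

@[fun_prop] theorem primrec_encode {f : α → β} (hf : Primrec f) :
    Primrec fun a => Encodable.encode (f a) := Primrec.encode.comp hf

@[fun_prop] theorem primrec_decode {f : α → ℕ} (hf : Primrec f) :
    Primrec fun a => (Encodable.decode (f a) : Option β) := Primrec.decode.comp hf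

@[fun_prop] theorem primrec_ofNatInt {f : α → ℕ} (hf : Primrec f) :
    Primrec fun a => Denumerable.ofNat ℤ (f a) := (Primrec.ofNat ℤ).comp hf

@[fun_prop] theorem primrec_natLe {f g : α → ℕ} (hf : Primrec f) (hg : Primrec g) :
    Primrec fun a => decide (f a ≤ g a) := (Primrec.nat_le.comp hf hg).decide

@[fun_prop] theorem primrec_natLt {f g : α → ℕ} (hf : Primrec f) (hg : Primrec g) :
    Primrec fun a => decide (f a < g a) := (Primrec.nat_lt.comp hf hg).decide

@[fun_prop] theorem primrec_decideEq [DecidableEq β] {f g : α → β} (hf : Primrec f)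
    (hg : Primrec g) : Primrec fun a => decide (f a = g a) := (Primrec.eq.comp hf hg).decide

@[fun_prop] theorem primrec_and {f g : α → Bool} (hf : Primrec f) (hg : Primrec g) :
    Primrec fun a => f a && g a := Primrec.and.comp hf hg

@[fun_prop] theorem primrec_or {f g : α → Bool} (hf : Primrec f) (hg : Primrec g) :
    Primrec fun a => f a || g a := Primrec.or.comp hf hg

@[fun_prop] theorem primrec_not {f : α → Bool} (hf : Primrec f) :
    Primrec fun a => !f a := Primrec.not.comp hf

@[fun_prop] theorem primrec_beqBool {f g : α → Bool} (hf : Primrec f) (hg : Primrec g) :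
    Primrec fun a => f a == g a := Primrec.beq.comp hf hg

@[fun_prop] theorem primrec_cond {c : α → Bool} {f g : α → σ} (hc : Primrec c) (hf : Primrec f)
    (hg : Primrec g) : Primrec fun a => bif c a then f a else g a := Primrec.cond hc hf hg

@[fun_prop] theorem primrec_some {f : α → β} (hf : Primrec f) : Primrec fun a => some (f a) :=
  Primrec.option_some.comp hf

@[fun_prop] theorem primrec_inl {f : α → β} (hf : Primrec f) :
    Primrec fun a => (Sum.inl (f a) : β ⊕ γ) := Primrec.sumInl.comp hf

@[fun_prop] theorem primrec_inr {f : α → γ} (hf : Primrec f) :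
    Primrec fun a => (Sum.inr (f a) : β ⊕ γ) := Primrec.sumInr.comp hf

-- For a function argument, here and below, primitive recursiveness is required jointly in the
-- parameter `a` and the bound value, because the function may depend on both.
@[fun_prop] theorem primrec_optionElim {f : α → Option β} {g : α → σ} {h : α → β → σ}
    (hf : Primrec f) (hg : Primrec g) (hh : Primrec fun p : α × β => h p.1 p.2) :
    Primrec fun a => (f a).elim (g a) (h a) :=
  (Primrec.option_casesOn hf hg hh.to₂).of_eq fun a => by cases f a <;> rfl

@[fun_prop] theorem primrec_sumElim {f : α → β ⊕ γ} {g : α → β → σ} {h : α → γ → σ}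
    (hf : Primrec f) (hg : Primrec fun p : α × β => g p.1 p.2)
    (hh : Primrec fun p : α × γ => h p.1 p.2) :
    Primrec fun a => (f a).elim (g a) (h a) :=
  (Primrec.sumCasesOn hf hg.to₂ hh.to₂).of_eq fun a => by cases f a <;> rfl

@[fun_prop] theorem primrec_getD {f : α → Option β} {g : α → β} (hf : Primrec f)
    (hg : Primrec g) : Primrec fun a => (f a).getD (g a) := Primrec.option_getD.comp hf hg

@[fun_prop] theorem primrec_cons {f : α → β} {g : α → List β} (hf : Primrec f)
    (hg : Primrec g) : Primrec fun a => f a :: g a := Primrec.list_cons.comp hf hg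

@[fun_prop] theorem primrec_append {f g : α → List β} (hf : Primrec f)
    (hg : Primrec g) : Primrec fun a => f a ++ g a := Primrec.list_append.comp hf hg

@[fun_prop] theorem primrec_map {f : α → List β} {g : α → β → σ} (hf : Primrec f)
    (hg : Primrec fun p : α × β => g p.1 p.2) : Primrec fun a => (f a).map (g a) :=
  Primrec.list_map hf hg

@[fun_prop] theorem primrec_flatMap {f : α → List β} {g : α → β → List σ} (hf : Primrec f)
    (hg : Primrec fun p : α × β => g p.1 p.2) : Primrec fun a => (f a).flatMap (g a) :=
  Primrec.list_flatMap hf hg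

@[fun_prop] theorem primrec_filterMap {f : α → List β} {g : α → β → Option σ} (hf : Primrec f)
    (hg : Primrec fun p : α × β => g p.1 p.2) : Primrec fun a => (f a).filterMap (g a) :=
  Primrec.listFilterMap hf hg

@[fun_prop] theorem primrec_filter {f : α → List β} {g : α → β → Bool} (hf : Primrec f)
    (hg : Primrec fun p : α × β => g p.1 p.2) : Primrec fun a => (f a).filter (g a) := by
  have h : Primrec fun a => (f a).filterMap fun b => bif g a b then some b else none := by
    fun_prop
  refine h.of_eq fun a => ?_
  rw [← List.filterMap_eq_filter]
  congr 1
  funext b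
  cases hb : g a b <;> simp [Option.guard, hb]

@[fun_prop] theorem primrec_length {f : α → List β} (hf : Primrec f) :
    Primrec fun a => (f a).length := Primrec.list_length.comp hf

@[fun_prop] theorem primrec_flatten {f : α → List (List β)} (hf : Primrec f) :
    Primrec fun a => (f a).flatten := Primrec.list_flatten.comp hf

@[fun_prop] theorem primrec_range {f : α → ℕ} (hf : Primrec f) :
    Primrec fun a => List.range (f a) := Primrec.list_range.comp hf

@[fun_prop] theorem primrec_getElem? {f : α → List β} {g : α → ℕ} (hf : Primrec f)
    (hg : Primrec g) : Primrec fun a => (f a)[g a]? := Primrec.list_getElem?.comp hf hg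

@[fun_prop] theorem primrec_listGetD {f : α → List β} {g : α → ℕ} {h : α → β} (hf : Primrec f)
    (hg : Primrec g) (hh : Primrec h) : Primrec fun a => (f a).getD (g a) (h a) := by
  have : Primrec fun a => ((f a)[g a]?).getD (h a) := by fun_prop
  exact this.of_eq fun a => by simp [List.getD_eq_getElem?_getD]

@[fun_prop] theorem primrec_tail {f : α → List β} (hf : Primrec f) :
    Primrec fun a => (f a).tail := Primrec.list_tail.comp hf

@[fun_prop] theorem primrec_findIdx {f : α → List β} {g : α → β → Bool} (hf : Primrec f)
    (hg : Primrec fun p : α × β => g p.1 p.2) : Primrec fun a => (f a).findIdx (g a) :=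
  Primrec.list_findIdx hf hg

@[fun_prop] theorem primrec_any {f : α → List β} {g : α → β → Bool} (hf : Primrec f)
    (hg : Primrec fun p : α × β => g p.1 p.2) : Primrec fun a => (f a).any (g a) := by
  have h : Primrec fun a => decide (0 < ((f a).filter (g a)).length) := by fun_prop
  refine h.of_eq fun a => ?_
  rw [Bool.eq_iff_iff]
  simp [List.length_pos_iff_exists_mem]

@[fun_prop] theorem primrec_all {f : α → List β} {g : α → β → Bool} (hf : Primrec f)
    (hg : Primrec fun p : α × β => g p.1 p.2) : Primrec fun a => (f a).all (g a) := by
  have h : Primrec fun a => !(f a).any fun b => !g a b := by fun_prop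
  exact h.of_eq fun a => by simp [List.all_eq_not_any_not]

@[fun_prop] theorem primrec_natRec {f : α → ℕ} {g : α → σ} {h : α → ℕ → σ → σ} (hf : Primrec f)
    (hg : Primrec g) (hh : Primrec fun p : α × ℕ × σ => h p.1 p.2.1 p.2.2) :
    Primrec fun a => (Nat.rec (g a) (h a) (f a) : σ) :=
  Primrec.nat_rec' hf hg (h := fun a p => h a p.1 p.2) hh

/-! ### Integers -/

theorem encode_ofNat_int (n : ℕ) : Encodable.encode (n : ℤ) = 2 * n := rfl

theorem encode_negSucc_int (n : ℕ) : Encodable.encode (Int.negSucc n) = 2 * n + 1 := rfl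

-- The numbering of `ℤ` puts nonnegative integers at even codes and negative ones at odd codes, so
-- integer arithmetic reduces to parity and halving of codes.
@[fun_prop] theorem primrec_toNat {f : α → ℤ} (hf : Primrec f) :
    Primrec fun a => (f a).toNat := by
  have h : Primrec fun z : ℤ => bif decide (Encodable.encode z % 2 = 0) then
      Encodable.encode z / 2 else 0 := by fun_prop
  refine (h.of_eq fun z => ?_).comp hf
  rcases z with n | n
  · rw [Int.ofNat_eq_natCast, encode_ofNat_int]; simp
  · rw [encode_negSucc_int]
    simp [show (2 * n + 1) % 2 = 1 by omega]

@[fun_prop] theorem primrec_neg {f : α → ℤ} (hf : Primrec f) : Primrec fun a => -f a := by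
  -- Negation swaps the codes `2n + 1` and `2n + 2`; truncated subtraction keeps the code `0` fixed.
  have h : Primrec fun z : ℤ => Denumerable.ofNat ℤ
      (bif decide (Encodable.encode z % 2 = 1) then Encodable.encode z + 1
        else Encodable.encode z - 1) := by fun_prop
  refine (h.of_eq fun z => ?_).comp hf
  rcases z with n | n
  · rw [Int.ofNat_eq_natCast, encode_ofNat_int]
    rcases n with _ | n
    · rfl
    · have : 2 * (n + 1) - 1 = Encodable.encode (Int.negSucc n) := by
        rw [encode_negSucc_int]; omega
      simp only [Nat.mul_mod_right, zero_ne_one, decide_false, cond_false, this,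
        Denumerable.ofNat_encode]
      omega
  · have : Encodable.encode (Int.negSucc n) + 1 = Encodable.encode ((n + 1 : ℕ) : ℤ) := by
      rw [encode_negSucc_int, encode_ofNat_int]; omega
    have h1 : Encodable.encode (Int.negSucc n) % 2 = 1 := by rw [encode_negSucc_int]; omega
    simp only [h1, decide_true, cond_true, this, Denumerable.ofNat_encode]
    omega

@[fun_prop] theorem primrec_natCast {f : α → ℕ} (hf : Primrec f) :
    Primrec fun a => (f a : ℤ) := by
  have h : Primrec fun n : ℕ => Denumerable.ofNat ℤ (2 * n) := by fun_prop
  refine (h.of_eq fun n => ?_).comp hf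
  rw [← encode_ofNat_int, Denumerable.ofNat_encode]

@[fun_prop] theorem primrec_intAdd {f g : α → ℤ} (hf : Primrec f) (hg : Primrec g) :
    Primrec fun a => f a + g a := by
  have h : Primrec fun p : ℕ × ℕ => bif decide (p.2 ≤ p.1) then ((p.1 - p.2 : ℕ) : ℤ)
      else -((p.2 - p.1 : ℕ) : ℤ) := by fun_prop
  have h' : Primrec fun p : ℕ × ℕ => (p.1 : ℤ) - p.2 := h.of_eq fun p => by
    rw [Bool.cond_decide]; split_ifs <;> omega
  -- Positive and negative parts are added separately, which leaves one difference of natural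
  -- numbers.
  have h2 : Primrec fun a => ((((f a).toNat + (g a).toNat, (-f a).toNat + (-g a).toNat) :
    ℕ × ℕ).1 : ℤ) - (((f a).toNat + (g a).toNat, (-f a).toNat + (-g a).toNat) : ℕ × ℕ).2 :=
    h'.comp (by fun_prop)
  exact h2.of_eq fun a => by push_cast; omega

@[fun_prop] theorem primrec_intSub {f g : α → ℤ} (hf : Primrec f) (hg : Primrec g) :
    Primrec fun a => f a - g a := by
  have h : Primrec fun a => f a + -g a := by fun_prop
  exact h.of_eq fun a => by omega

@[fun_prop] theorem primrec_intLe {f g : α → ℤ} (hf : Primrec f) (hg : Primrec g) :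
    Primrec fun a => decide (f a ≤ g a) := by
  have h : Primrec fun a => decide ((f a - g a).toNat ≤ 0) := by fun_prop
  exact h.of_eq fun a => by simp

@[fun_prop] theorem primrec_intLt {f g : α → ℤ} (hf : Primrec f) (hg : Primrec g) :
    Primrec fun a => decide (f a < g a) := by
  have h : Primrec fun a => decide (f a + 1 ≤ g a) := by fun_prop
  exact h.of_eq fun a => by simp only [Int.add_one_le_iff]

@[fun_prop] theorem primrec_courseRec {G : α → ℕ → List σ → σ} {f : α → ℕ}
    (hG : Primrec fun p : α × ℕ × List σ => G p.1 p.2.1 p.2.2) (hf : Primrec f) :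
    Primrec fun a => courseRec (G a) (f a) := by
  have h : Primrec fun a => courseTable (G a) (f a) := by unfold courseTable; fun_prop
  exact hG.comp (Primrec.pair .id (Primrec.pair hf h))

@[fun_prop] theorem primrec_words {f : α → List β} {g : α → ℕ} (hf : Primrec f)
    (hg : Primrec g) : Primrec fun a => words (f a) (g a) := by
  unfold words; fun_prop

@[fun_prop] theorem primrec_wordsLt {f : α → List β} {g : α → ℕ} (hf : Primrec f)
    (hg : Primrec g) : Primrec fun a => wordsLt (f a) (g a) := by
  unfold wordsLt; fun_prop

end PrimrecLibrary

end ArrayAbs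

namespace ArrayAbs

/-! ## Predicates on numbers and words recognized by finite automata

A predicate speaks about numbers `ν x` and `e k` (written in unary) and about bit sequences `W k`.
An automaton reads all of them synchronously; its verdict must not depend on the padding. -/

section Recognizable

variable {τ : Type}

/-- Predicates on interpretations of free numbers, bit sequences and bound numbers. -/
abbrev NumPred (τ : Type) := (τ → ℕ) → (ℕ → ℕ → Bool) → (ℕ → ℕ) → Prop

/-- The letters that represent one position of all sequences. -/
abbrev Column (τ : Type) := (τ → Bool) × (ℕ → Bool) × (ℕ → Bool)

/-- The column at position `i`. -/
def column (ν : τ → ℕ) (W : ℕ → ℕ → Bool) (e : ℕ → ℕ) (i : ℕ) : Column τ :=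
  (fun x => decide (i < ν x), fun k => W k i, fun k => decide (i < e k))

/-- From position `L` on there is only padding. -/
def PaddedFrom (ν : τ → ℕ) (W : ℕ → ℕ → Bool) (e : ℕ → ℕ) (L : ℕ) : Prop :=
  (∀ x, ν x ≤ L) ∧ (∀ k i, L ≤ i → W k i = false) ∧ ∀ k, e k ≤ L

/-- The state of a deterministic automaton after `i` letters. -/
def runSeq {Q A : Type} (step : Q → A → Q) (q₀ : Q) (a : ℕ → A) : ℕ → Q
  | 0 => q₀
  | i + 1 => step (runSeq step q₀ a i) (a i)

/-- `p` is recognized by a deterministic automaton with at most `N` states. -/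
def Recognizable (N : ℕ) (p : NumPred τ) : Prop :=
  ∃ (Q : Type) (_ : Fintype Q) (step : Q → Column τ → Q) (q₀ : Q) (acc : Set Q),
    Fintype.card Q ≤ N ∧ ∀ ν W e L, PaddedFrom ν W e L →
      (p ν W e ↔ runSeq step q₀ (column ν W e) L ∈ acc)

theorem Recognizable.mono {N N' : ℕ} {p : NumPred τ} (h : Recognizable N p) (hN : N ≤ N') :
    Recognizable N' p := by
  obtain ⟨Q, i, step, q, acc, hc, h⟩ := h
  exact ⟨Q, i, step, q, acc, hc.trans hN, h⟩

theorem Recognizable.not {N : ℕ} {p : NumPred τ} (h : Recognizable N p) :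
    Recognizable N fun ν W e => ¬ p ν W e := by
  obtain ⟨Q, i, step, q, acc, hc, h⟩ := h
  exact ⟨Q, i, step, q, accᶜ, hc, fun ν W e L hL => not_congr (h ν W e L hL)⟩

/-- A predicate that is determined by finitely many recognizable ones is recognizable. -/
theorem Recognizable.of_determined {ι : Type} [Fintype ι] {N : ℕ} {p : ι → NumPred τ}
    (hp : ∀ i, Recognizable N (p i)) {q : NumPred τ}
    (hq : ∀ ν W e ν' W' e', (∀ i, p i ν W e ↔ p i ν' W' e') → q ν W e → q ν' W' e') :
    Recognizable (N ^ Fintype.card ι) q := by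
  classical
  choose Q fQ step q₀ acc hc h using hp
  have hrun : ∀ ν W e L i, runSeq (fun (s : ∀ i, Q i) a i => step i (s i) a) q₀
      (column ν W e) L i = runSeq (step i) (q₀ i) (column ν W e) L := by
    intro ν W e L i
    induction L with
    | zero => rfl
    | succ L ih => simp only [runSeq, ih]
  -- Product automaton. A state accepts if some input satisfying `q` leads to it; two inputs leading
  -- to the same state agree on every `p i`, hence on `q`.
  refine ⟨∀ i, Q i, inferInstance, fun s a i => step i (s i) a, q₀,
    {s | ∃ ν W e L, PaddedFrom ν W e L ∧
      runSeq (fun (s : ∀ i, Q i) a i => step i (s i) a) q₀ (column ν W e) L = s ∧ q ν W e},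
    ?_, ?_⟩
  · rw [Fintype.card_pi]
    exact (Finset.prod_le_pow_card _ _ N fun i _ => hc i)
  · intro ν W e L hL
    refine ⟨fun hqq => ⟨ν, W, e, L, hL, rfl, hqq⟩, ?_⟩
    rintro ⟨ν', W', e', L', hL', heq, hqq⟩
    refine hq ν' W' e' ν W e (fun i => ?_) hqq
    rw [h i _ _ _ _ hL, h i _ _ _ _ hL', ← hrun, ← hrun, heq]

/-! ### Quantification -/

/-- The column where the number `0` is new. -/
def Column.push (b : Bool) (a : Column τ) : Column τ :=
  (a.1, a.2.1, fun k => Nat.casesOn k b a.2.2)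

theorem column_push (ν : τ → ℕ) (W : ℕ → ℕ → Bool) (e : ℕ → ℕ) (n i : ℕ) :
    column ν W (push n e) i = (column ν W e i).push (decide (i < n)) := by
  simp only [column, Column.push, Prod.mk.injEq, true_and]
  funext k
  cases k <;> rfl

/-- The column of the padding, except that the number `0` is still running. -/
def tailColumn : Column τ := (fun _ => false, fun _ => false, fun k => decide (k = 0))

/-- Past the padding bound only the new number can still run, so an automaton merely iterates one
fixed map there. -/
theorem PaddedFrom.column_eq {ν : τ → ℕ} {W : ℕ → ℕ → Bool} {e : ℕ → ℕ} {L i : ℕ}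
    (h : PaddedFrom ν W e L) (hi : L ≤ i) :
    (column ν W e i).push true = tailColumn := by
  obtain ⟨h1, h2, h3⟩ := h
  simp only [column, Column.push, tailColumn, Prod.mk.injEq]
  refine ⟨funext fun x => ?_, funext fun k => h2 k i hi, funext fun k => ?_⟩
  · simpa using (h1 x).trans hi
  · cases k with
    | zero => rfl
    | succ k => simpa using (h3 k).trans hi

theorem PaddedFrom.push {ν : τ → ℕ} {W : ℕ → ℕ → Bool} {e : ℕ → ℕ} {L n L' : ℕ}
    (h : PaddedFrom ν W e L) (hL : L ≤ L') (hn : n ≤ L') :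
    PaddedFrom ν W (push n e) L' := by
  obtain ⟨h1, h2, h3⟩ := h
  refine ⟨fun x => (h1 x).trans hL, fun k i hi => h2 k i (hL.trans hi), fun k => ?_⟩
  cases k with
  | zero => exact hn
  | succ k => exact (h3 k).trans hL

/-- In unary, the first `i` columns cannot distinguish two numbers that are both at least `i`. -/
theorem runSeq_push_eq {Q : Type} (step : Q → Column τ → Q) (q₀ : Q) (ν : τ → ℕ)
    (W : ℕ → ℕ → Bool) (e : ℕ → ℕ) {n n' i : ℕ} (hn : i ≤ n) (hn' : i ≤ n') :
    runSeq step q₀ (column ν W (push n e)) i = runSeq step q₀ (column ν W (push n' e)) i := by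
  induction i with
  | zero => rfl
  | succ i ih =>
    simp only [runSeq, column_push]
    rw [ih (by omega) (by omega), decide_eq_true (show i < n by omega),
      decide_eq_true (show i < n' by omega)]

theorem runSeq_tail {Q : Type} (step : Q → Column τ → Q) (q₀ : Q) {ν : τ → ℕ}
    {W : ℕ → ℕ → Bool} {e : ℕ → ℕ} {L : ℕ} (h : PaddedFrom ν W e L) (k : ℕ) :
    runSeq step q₀ (column ν W (push (L + k) e)) (L + k) =
      (fun q => step q tailColumn)^[k] (runSeq step q₀ (column ν W (push L e)) L) := by
  induction k with
  | zero => rfl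
  | succ k ih =>
    rw [Function.iterate_succ_apply', ← ih, ← Nat.add_assoc]
    simp only [runSeq]
    rw [runSeq_push_eq step q₀ ν W e (n' := L + k) (by omega) le_rfl, column_push,
      decide_eq_true (show L + k < L + k + 1 by omega), h.column_eq (by omega)]

/-- The state after all words of a given length is already reached by a short iteration. -/
theorem exists_iterate_lt_card {Q : Type} [Fintype Q] (f : Q → Q) (q : Q) (k : ℕ) :
    ∃ j < Fintype.card Q, f^[j] q = f^[k] q := by
  induction k using Nat.strong_induction_on with
  | _ k ih =>
    by_cases hk : k < Fintype.card Q
    · exact ⟨k, hk, rfl⟩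
    obtain ⟨i, j, hij, heq⟩ := Fintype.exists_ne_map_eq_of_card_lt
      (fun i : Fin (Fintype.card Q + 1) => f^[i] q) (by simp)
    wlog hlt : i < j generalizing i j
    · exact this j i hij.symm heq.symm (lt_of_le_of_ne (not_lt.1 hlt) hij.symm)
    have hlt' : (i : ℕ) < j := hlt
    have hj : (j : ℕ) ≤ k := by omega
    -- The orbit closes up between `i` and `j`; one turn of the cycle is removed from `k`.
    obtain ⟨l, hl, hl'⟩ := ih (k - (j - i)) (by omega)
    refine ⟨l, hl, hl'.trans ?_⟩
    have h1 : k - (j - i) = (k - j) + i := by omega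
    have h2 : k = (k - j) + j := by omega
    rw [h1, Function.iterate_add_apply]
    conv_rhs => rw [h2, Function.iterate_add_apply]
    exact congrArg _ heq

/-- Subset construction for unary witnesses. At position `i` exactly one run has the witness still
running, and the others have ended it earlier; so a state and a set of states suffice, at most `N *
2 ^ N ≤ 4 ^ N` possibilities. -/
theorem Recognizable.ex {N : ℕ} {p : NumPred τ} (h : Recognizable N p) :
    Recognizable (4 ^ N) fun ν W e => ∃ n, p ν W (push n e) := by
  classical
  obtain ⟨Q, _, step, q₀, acc, hc, h⟩ := h
  let step' : Q × Set Q → Column τ → Q × Set Q := fun s a =>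
    (step s.1 (a.push true),
      insert (step s.1 (a.push false)) ((fun q => step q (a.push false)) '' s.2))
  -- The second component collects the runs for witnesses `n < i`; the run inserted at each step is
  -- the one whose witness ends at the current position.
  have hrun : ∀ ν W e i, runSeq step' (q₀, ∅) (column ν W e) i =
      (runSeq step q₀ (column ν W (ArrayAbs.push i e)) i,
        {q | ∃ n < i, q = runSeq step q₀ (column ν W (ArrayAbs.push n e)) i}) := by
    intro ν W e i
    induction i with
    | zero => simp [runSeq]
    | succ i ih =>
      simp only [runSeq, ih, step', column_push]
      refine Prod.ext ?_ ?_
      · simp only [decide_eq_true (show i < i + 1 by omega)]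
        rw [runSeq_push_eq step q₀ ν W e (n' := i + 1) le_rfl (by omega)]
      · ext q
        simp only [Set.mem_insert_iff, Set.mem_image, Set.mem_ofPred_eq]
        constructor
        · rintro (rfl | ⟨q', ⟨n, hn, rfl⟩, rfl⟩)
          · exact ⟨i, by omega, by simp⟩
          · exact ⟨n, by omega, by rw [decide_eq_false (by omega)]⟩
        · rintro ⟨n, hn, rfl⟩
          rcases Nat.lt_succ_iff_lt_or_eq.1 hn with hn | rfl
          · exact Or.inr ⟨_, ⟨n, hn, rfl⟩, by rw [decide_eq_false (by omega)]⟩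
          · left; simp
  -- Witnesses below the input length are found in the set. Longer ones lie beyond the input, so
  -- acceptance also asks whether reading further padding columns can succeed.
  refine ⟨Q × Set Q, inferInstance, step', (q₀, ∅),
    {s | (∃ q ∈ s.2, q ∈ acc) ∨ ∃ k, (fun q => step q tailColumn)^[k] s.1 ∈ acc}, ?_, ?_⟩
  · rw [Fintype.card_prod, Fintype.card_set]
    calc Fintype.card Q * 2 ^ Fintype.card Q ≤ N * 2 ^ N :=
          Nat.mul_le_mul hc (Nat.pow_le_pow_right (by norm_num) hc)
      _ ≤ 2 ^ N * 2 ^ N := Nat.mul_le_mul_right _ Nat.lt_two_pow_self.le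
      _ = 4 ^ N := by rw [← Nat.mul_pow]
  · intro ν W e L hL
    rw [hrun]
    simp only [Set.mem_ofPred_eq]
    constructor
    · rintro ⟨n, hn⟩
      rcases Nat.lt_or_ge n L with hlt | hge
      · left
        rw [h _ _ _ L (hL.push le_rfl hlt.le)] at hn
        exact ⟨_, ⟨n, hlt, rfl⟩, hn⟩
      · right
        obtain ⟨k, rfl⟩ := Nat.exists_eq_add_of_le hge
        rw [h _ _ _ (L + k) (hL.push hge le_rfl), runSeq_tail step q₀ hL] at hn
        exact ⟨k, hn⟩
    · rintro (⟨_, ⟨n, hn, rfl⟩, hacc⟩ | ⟨k, hk⟩)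
      · exact ⟨n, (h _ _ _ L (hL.push le_rfl hn.le)).2 hacc⟩
      · rw [← runSeq_tail step q₀ hL, ← h _ _ _ _ (hL.push (by omega) le_rfl)] at hk
        exact ⟨_, hk⟩

/-- Witnesses of recognizable predicates can be bounded. -/
theorem Recognizable.exists_bounded {N : ℕ} {p : NumPred τ} (h : Recognizable N p) {ν : τ → ℕ}
    {W : ℕ → ℕ → Bool} {e : ℕ → ℕ} {L : ℕ} (hL : PaddedFrom ν W e L)
    (hp : ∃ n, p ν W (push n e)) : ∃ n < L + N, p ν W (push n e) := by
  obtain ⟨Q, _, step, q₀, acc, hc, h⟩ := h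
  obtain ⟨n, hn⟩ := hp
  rcases Nat.lt_or_ge n L with hlt | hge
  · exact ⟨n, by omega, hn⟩
  obtain ⟨k, rfl⟩ := Nat.exists_eq_add_of_le hge
  rw [h _ _ _ (L + k) (hL.push hge le_rfl), runSeq_tail step q₀ hL] at hn
  -- Beyond `L` the witness only counts iterations of one map on `Q`, and fewer than `card Q ≤ N`
  -- iterations reach the same state.
  obtain ⟨j, hj, hjk⟩ := exists_iterate_lt_card (fun q => step q tailColumn)
    (runSeq step q₀ (column ν W (ArrayAbs.push L e)) L) k
  refine ⟨L + j, by omega, ?_⟩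
  rw [h _ _ _ (L + j) (hL.push (by omega) le_rfl), runSeq_tail step q₀ hL, hjk]
  exact hn

/-- Bounds for the numbers of states after quantification. -/
def tower (N : ℕ) (n : ℕ) : ℕ := Nat.rec N (fun _ t => 4 ^ t) n

@[fun_prop] theorem primrec_tower {α : Type} [Primcodable α] {f g : α → ℕ} (hf : Primrec f)
    (hg : Primrec g) : Primrec fun a => tower (f a) (g a) := by
  unfold tower; fun_prop

theorem tower_succ (N n : ℕ) : tower N (n + 1) = 4 ^ tower N n := rfl

theorem tower_le_succ (N n : ℕ) : tower N n ≤ tower N (n + 1) := by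
  rw [tower_succ]; exact (Nat.lt_pow_self (by norm_num)).le

/-- A universal quantifier is an existential one between two complementations. Complementation is
free, so both kinds cost a single application of `4 ^ ·`. -/
theorem Recognizable.quantSat {N : ℕ} {p : NumPred τ} (h : Recognizable N p) (q : List Bool) :
    Recognizable (tower N q.length) fun ν W e => quantSat q (p ν W) e := by
  induction q with
  | nil => exact h
  | cons b q ih =>
    cases b with
    | false => exact ih.ex
    | true =>
      have := ih.not.ex.not
      simp only [not_exists, not_not] at this
      exact this

/-- Numbers given by a list, with default value `0`. -/
def listEnv (l : List ℕ) : ℕ → ℕ := fun k => l.getD k 0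

theorem listEnv_cons (n : ℕ) (l : List ℕ) : listEnv (n :: l) = push n (listEnv l) := by
  funext k; cases k <;> simp [listEnv, push]

theorem listEnv_nil : listEnv [] = fun _ => 0 := by funext k; simp [listEnv]

/-- Evaluation of a block of bounded quantifiers. -/
def quantBounded (L N : ℕ) (p : List ℕ → Bool) : List Bool → List ℕ → Bool
  | [], e => p e
  | b :: q, e =>
    bif b then (List.range (L + (e.length + 1) * N)).all fun n => quantBounded L N p q (n :: e)
    else (List.range (L + (e.length + 1) * N)).any fun n => quantBounded L N p q (n :: e)

/-- The values chosen so far are at most `L + e.length * N`, so padding begins there and the next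
witness, or counterexample, can be found within `N` further positions. One `N` serves all levels
because `tower` is increasing. -/
theorem quantBounded_iff {N₀ N L : ℕ} {P : NumPred τ} (h : Recognizable N₀ P)
    {ν : τ → ℕ} {W : ℕ → ℕ → Bool} (hL : PaddedFrom ν W (fun _ => 0) L) {p : List ℕ → Bool}
    (hp : ∀ e, p e = true ↔ P ν W (listEnv e)) (q : List Bool) (hN : tower N₀ q.length ≤ N)
    (e : List ℕ) (he : ∀ n ∈ e, n ≤ L + e.length * N) :
    quantBounded L N p q e = true ↔ quantSat q (P ν W) (listEnv e) := by
  induction q generalizing e with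
  | nil => exact hp e
  | cons b q ih =>
    have hN' : tower N₀ q.length ≤ N := (tower_le_succ _ _).trans hN
    have hpad : PaddedFrom ν W (listEnv e) (L + e.length * N) := by
      refine ⟨fun x => (hL.1 x).trans (by omega), fun k i hi => hL.2.1 k i (by omega),
        fun k => ?_⟩
      by_cases hk : k < e.length
      · simp only [listEnv, List.getD_eq_getElem _ _ hk]
        exact he _ (List.getElem_mem hk)
      · simp only [listEnv, List.getD_eq_default _ _ (not_lt.1 hk), Nat.zero_le]
    have hlen : L + (e.length + 1) * N = L + e.length * N + N := by ring
    have hih : ∀ n < L + (e.length + 1) * N, (quantBounded L N p q (n :: e) = true ↔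
        ArrayAbs.quantSat q (P ν W) (push n (listEnv e))) := by
      intro n hn
      rw [← listEnv_cons]
      refine ih hN' (n :: e) fun m hm => ?_
      rcases List.mem_cons.1 hm with rfl | hm
      · rw [List.length_cons]; omega
      · rw [List.length_cons, hlen]
        exact (he m hm).trans (by omega)
    have hrec := h.quantSat q
    cases b with
    | false =>
      simp only [quantBounded, cond_false, List.any_eq_true, List.mem_range, ArrayAbs.quantSat]
      constructor
      · rintro ⟨n, hn, hq⟩
        exact ⟨n, (hih n hn).1 hq⟩
      · intro hq
        obtain ⟨n, hn, hq⟩ := hrec.exists_bounded hpad hq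
        have hn' : n < L + (e.length + 1) * N := by omega
        exact ⟨n, hn', (hih n hn').2 hq⟩
    | true =>
      simp only [quantBounded, cond_true, List.all_eq_true, List.mem_range, ArrayAbs.quantSat]
      constructor
      · intro hq
        by_contra hcon
        rw [not_forall] at hcon
        obtain ⟨n, hn, hq'⟩ := hrec.not.exists_bounded hpad hcon
        have hn' : n < L + (e.length + 1) * N := by omega
        exact hq' ((hih n hn').1 (hq n hn'))
      · intro hq n hn
        exact (hih n hn).2 (hq n)

/-! ### Atomic predicates -/

/-- A number whose unary representation can be read off from the columns. -/
def Tracked (x : (τ → ℕ) → (ℕ → ℕ) → ℕ) : Prop :=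
  ∃ b : Column τ → Bool, ∀ ν W e i, b (column ν W e i) = decide (i < x ν e)

theorem tracked_zero : Tracked fun (_ : τ → ℕ) _ => 0 := ⟨fun _ => false, by simp⟩

theorem tracked_free (x : τ) : Tracked fun (ν : τ → ℕ) _ => ν x :=
  ⟨fun a => a.1 x, fun _ _ _ _ => rfl⟩

theorem tracked_bound (k : ℕ) : Tracked fun (_ : τ → ℕ) e => e k :=
  ⟨fun a => a.2.2 k, fun _ _ _ _ => rfl⟩

/-- Keeps `x` readable under a quantifier, where the bound numbers have moved up by one. -/
theorem Tracked.tail {x : (τ → ℕ) → (ℕ → ℕ) → ℕ} (h : Tracked x) :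
    Tracked fun ν e => x ν fun k => e (k + 1) := by
  obtain ⟨b, hb⟩ := h
  refine ⟨fun a => b (a.1, a.2.1, fun k => a.2.2 (k + 1)), fun ν W e i => ?_⟩
  rw [← hb ν W]; rfl

/-- All columns from `L` on coincide, and far enough out the answer to "is `x` still running" is
negative; hence it is already negative at `L`. -/
theorem Tracked.le {x : (τ → ℕ) → (ℕ → ℕ) → ℕ} (h : Tracked x) {ν : τ → ℕ}
    {W : ℕ → ℕ → Bool} {e : ℕ → ℕ} {L : ℕ} (hL : PaddedFrom ν W e L) : x ν e ≤ L := by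
  obtain ⟨b, hb⟩ := h
  have hcol : ∀ i, L ≤ i → column ν W e i = column ν W e (max L (x ν e)) := by
    intro i hi
    simp only [column, Prod.mk.injEq]
    refine ⟨funext fun y => ?_, funext fun k => ?_, funext fun k => ?_⟩
    · have := hL.1 y
      rw [decide_eq_false (by omega), decide_eq_false (by omega)]
    · rw [hL.2.1 k i hi, hL.2.1 k _ (le_max_left _ _)]
    · have := hL.2.2 k
      rw [decide_eq_false (by omega), decide_eq_false (by omega)]
  have h1 := hb ν W e L
  rw [hcol L le_rfl, hb] at h1
  by_contra hcon
  rw [decide_eq_false (by omega), decide_eq_true (by omega)] at h1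
  exact absurd h1 (by simp)

/-- The automaton counts `y - x`, clipped to `[-K, K]`. While both numbers run the count stays at
`0`, afterwards it moves in one direction only; so clipping never has to be undone, and a threshold
`c` with `|c| < K` is decided correctly. -/
theorem recognizable_diff {x y : (τ → ℕ) → (ℕ → ℕ) → ℕ} (hx : Tracked x) (hy : Tracked y)
    {c : ℤ} {K : ℕ} (hc : |c| < K) :
    Recognizable (2 * K + 1) fun ν _ e => (x ν e : ℤ) + c ≤ y ν e := by
  obtain ⟨bx, hbx⟩ := id hx
  obtain ⟨bY, hby⟩ := id hy
  have hclip : ∀ z : ℤ, max (-(K : ℤ)) (min K z) ∈ Finset.Icc (-(K : ℤ)) K := by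
    intro z; rw [Finset.mem_Icc]; omega
  let step : Finset.Icc (-(K : ℤ)) K → Column τ → Finset.Icc (-(K : ℤ)) K := fun q a =>
    ⟨_, hclip (q.1 + (bif bY a then 1 else 0) - (bif bx a then 1 else 0))⟩
  have hrun : ∀ ν W e i, (runSeq step ⟨_, hclip 0⟩ (column ν W e) i).1 =
      max (-(K : ℤ)) (min K ((min (y ν e) i : ℕ) - (min (x ν e) i : ℕ))) := by
    intro ν W e i
    induction i with
    | zero => simp [runSeq]
    | succ i ih =>
      simp only [runSeq, step, ih, hbx, hby, Bool.cond_decide]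
      split_ifs <;> omega
  refine ⟨Finset.Icc (-(K : ℤ)) K, inferInstance, step, ⟨_, hclip 0⟩, {q | c ≤ q.1}, ?_, ?_⟩
  · rw [Fintype.card_coe, Int.card_Icc]; omega
  · intro ν W e L hL
    have h1 := hx.le hL
    have h2 := hy.le hL
    rw [Set.mem_ofPred_eq, hrun, min_eq_left h1, min_eq_left h2]
    rw [abs_lt] at hc
    omega

/-- One bit of memory holds the latest entry of row `k` seen while `x` was running; at the end this
is the entry at position `x - 1`. -/
theorem recognizable_bit {x : (τ → ℕ) → (ℕ → ℕ) → ℕ} (hx : Tracked x) (k : ℕ) :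
    Recognizable 2 fun (ν : τ → ℕ) W e => 1 ≤ x ν e ∧ W k (x ν e - 1) = true := by
  obtain ⟨bx, hbx⟩ := id hx
  let step : Bool → Column τ → Bool := fun q a => bif bx a then a.2.1 k else q
  have hrun : ∀ ν W e i, runSeq step false (column ν W e) i = true ↔
      1 ≤ min (x ν e) i ∧ W k (min (x ν e) i - 1) = true := by
    intro ν W e i
    induction i with
    | zero => simp [runSeq]
    | succ i ih =>
      simp only [runSeq, step, hbx, Bool.cond_decide]
      split_ifs with hi
      · rw [min_eq_right (by omega)]; simp [column]
      · rw [ih, min_eq_left (by omega), min_eq_left (by omega)]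
  refine ⟨Bool, inferInstance, step, false, {true}, by simp, fun ν W e L hL => ?_⟩
  rw [Set.mem_singleton_iff, hrun, min_eq_left (hx.le hL)]

theorem Recognizable.and {N : ℕ} {p q : NumPred τ} (hp : Recognizable N p)
    (hq : Recognizable N q) : Recognizable (N ^ 2) fun ν W e => p ν W e ∧ q ν W e := by
  have := Recognizable.of_determined (ι := Bool) (N := N) (p := fun b => if b then p else q)
    (q := fun ν W e => p ν W e ∧ q ν W e) (by rintro (_ | _) <;> assumption)
    (by
      intro ν W e ν' W' e' h
      have h1 := h true
      have h2 := h false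
      simp only [if_true, if_false, Bool.false_eq_true] at h1 h2
      rw [h1, h2]; exact id)
  simpa using this

/-- The bit at a shifted position. -/
theorem recognizable_shifted_bit {x : (τ → ℕ) → (ℕ → ℕ) → ℕ} (hx : Tracked x) {c : ℤ} {K : ℕ}
    (hc : |c| < K) (k : ℕ) :
    Recognizable (4 ^ ((2 * K + 2) ^ 4)) fun (ν : τ → ℕ) W e =>
      1 ≤ (x ν e : ℤ) + c ∧ W k ((x ν e : ℤ) + c - 1).toNat = true := by
  -- The shifted position is guessed: some `n` satisfies `x + c ≤ n`, `n - c ≤ x` and carries the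
  -- bit at `n`. Two conjunctions square the bound twice, and the quantifier then exponentiates it.
  have h1 := (recognizable_diff hx.tail (tracked_bound 0) hc).mono
    (show 2 * K + 1 ≤ 2 * K + 2 by omega)
  have h2 := (recognizable_diff (tracked_bound 0) hx.tail (c := -c) (by rwa [abs_neg])).mono
    (show 2 * K + 1 ≤ 2 * K + 2 by omega)
  have h3 := (recognizable_bit (tracked_bound (τ := τ) 0) k).mono
    (show 2 ≤ (2 * K + 2) ^ 2 by nlinarith)
  have h4 := ((h1.and h2).and h3).ex
  rw [← pow_mul] at h4
  obtain ⟨Q, i, step, q₀, acc, hcard, h⟩ := h4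
  refine ⟨Q, i, step, q₀, acc, hcard, fun ν W e L hL => ?_⟩
  rw [← h ν W e L hL]
  have hxe : ∀ n, x ν (fun k => push n e (k + 1)) = x ν e := fun _ => rfl
  have h0 : ∀ n, push n e 0 = n := fun _ => rfl
  simp only [hxe, h0]
  constructor
  · rintro ⟨h5, h6⟩
    refine ⟨((x ν e : ℤ) + c).toNat, ⟨by omega, by omega⟩, by omega, ?_⟩
    rw [← h6]; congr 1; omega
  · rintro ⟨n, ⟨h5, h6⟩, h7, h8⟩
    refine ⟨by omega, ?_⟩
    rw [← h8]; congr 1; omega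

end Recognizable

end ArrayAbs

namespace ArrayAbs

/-! ## Construction of an automaton from a membership test -/

section Learning

variable {A : Type}

/-- The words over the alphabet `S`. -/
def IsWordOver (S : List A) (w : List A) : Prop := ∀ a ∈ w, a ∈ S

theorem IsWordOver.append {S u v : List A} (hu : IsWordOver S u) (hv : IsWordOver S v) :
    IsWordOver S (u ++ v) := by
  intro a ha
  rcases List.mem_append.1 ha with h | h
  exacts [hu a h, hv a h]

/-- A right congruence on the words over `S`, given by its classes. -/
def IsRightCongruence {Q : Type} (S : List A) (st : List A → Q) : Prop :=
  ∀ u v, IsWordOver S u → IsWordOver S v → ∀ a ∈ S, st u = st v → st (u ++ [a]) = st (v ++ [a])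

theorem IsRightCongruence.append {Q : Type} {S : List A} {st : List A → Q}
    (h : IsRightCongruence S st) {u v x : List A} (hu : IsWordOver S u) (hv : IsWordOver S v)
    (hx : IsWordOver S x) (he : st u = st v) : st (u ++ x) = st (v ++ x) := by
  induction x generalizing u v with
  | nil => simpa using he
  | cons a x ih =>
    have ha : a ∈ S := hx a (by simp)
    have hw : IsWordOver S [a] := by intro b hb; rw [List.mem_singleton.1 hb]; exact ha
    have := ih (hu.append hw) (hv.append hw) (fun b hb => hx b (by simp [hb]))
      (h u v hu hv a ha he)
    simpa using this

/-- If a word is at least as long as the number of classes, two of its prefixes fall into the same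
class, and the factor between them can be deleted. -/
theorem IsRightCongruence.exists_short {Q : Type} [Fintype Q] {S : List A} {st : List A → Q}
    (h : IsRightCongruence S st) (w : List A) (hw : IsWordOver S w) :
    ∃ w', IsWordOver S w' ∧ w'.length < Fintype.card Q ∧ st w' = st w := by
  induction hn : w.length using Nat.strong_induction_on generalizing w with
  | _ n ih =>
    subst hn
    by_cases hlt : w.length < Fintype.card Q
    · exact ⟨w, hw, hlt, rfl⟩
    obtain ⟨i, j, hij, heq⟩ := Fintype.exists_ne_map_eq_of_card_lt
      (fun i : Fin (Fintype.card Q + 1) => st (w.take i)) (by simp)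
    wlog hl : i < j generalizing i j
    · exact this j i hij.symm heq.symm (lt_of_le_of_ne (not_lt.1 hl) hij.symm)
    have hl' : (i : ℕ) < j := hl
    have hj : (j : ℕ) ≤ w.length := by omega
    have htake : ∀ k, IsWordOver S (w.take k) := fun k a ha => hw a (List.mem_of_mem_take ha)
    have hdrop : ∀ k, IsWordOver S (w.drop k) := fun k a ha => hw a (List.mem_of_mem_drop ha)
    have h1 := h.append (htake i) (htake j) (hdrop j) heq
    rw [List.take_append_drop] at h1
    obtain ⟨w', h2, h3, h4⟩ := ih _ (by simp; omega) _ ((htake i).append (hdrop j)) rfl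
    exact ⟨w', h2, h3, h4.trans h1⟩

end Learning

/-- The automaton whose states are the words of length less than `N` over the alphabet `S`; there
is a transition from `u` to `v` on reading `a` if `u a` and `v` cannot be told apart. -/
def learnedAutomaton (S : List (List Bool)) (N : ℕ) (mem : List (List Bool) → Bool) : Automaton :=
  ([Encodable.encode ([] : List (List Bool))],
    ((wordsLt S N).filter mem).map Encodable.encode,
    (wordsLt S N).flatMap fun u => S.flatMap fun a =>
      ((wordsLt S N).filter fun v =>
        (wordsLt S (N * N)).all fun x => mem (u ++ a :: x) == mem (v ++ x)).map fun v =>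
          (Encodable.encode u, a, Encodable.encode v))

@[fun_prop] theorem primrec_learnedAutomaton {α : Type} [Primcodable α]
    {S : α → List (List Bool)} {N : α → ℕ} {mem : α → List (List Bool) → Bool} (hS : Primrec S)
    (hN : Primrec N) (hmem : Primrec fun p : α × List (List Bool) => mem p.1 p.2) :
    Primrec fun a => learnedAutomaton (S a) (N a) (mem a) := by
  have h : ∀ {β : Type} [Primcodable β] {f : β → α} {g : β → List (List Bool)}, Primrec f →
      Primrec g → Primrec fun b => mem (f b) (g b) := fun hf hg => hmem.comp (hf.pair hg)
  unfold learnedAutomaton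
  fun_prop (disch := assumption)

/-- The congruence `st` is not available to the construction; only the bound `N` on its index is.
Words shorter than `N` represent all classes. For given `u` and `v` the pairs `(st (u x), st (v x))`
form a right congruence in `x` with at most `N * N` classes, which is where the length of the tests
comes from. The automaton may be nondeterministic, but all states reached by a word are
indistinguishable from it. -/
theorem learnedAutomaton_accepts {S : List (List Bool)} {N : ℕ} {mem : List (List Bool) → Bool}
    {L : Language (List Bool)} (hL : ∀ w ∈ L, IsWordOver S w)
    (hmem : ∀ w, IsWordOver S w → (mem w = true ↔ w ∈ L)) {Q : Type} [Fintype Q]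
    {st : List (List Bool) → Q} (hcard : Fintype.card Q ≤ N) (hst : IsRightCongruence S st)
    (hstL : ∀ u v, IsWordOver S u → IsWordOver S v → st u = st v → (u ∈ L → v ∈ L)) :
    (learnedAutomaton S N mem).toNFA.accepts = L := by
  have hnil : IsWordOver S [] := by intro a ha; simp at ha
  have hstmem : ∀ u v, IsWordOver S u → IsWordOver S v → st u = st v → mem u = mem v := by
    intro u v hu hv h
    rw [Bool.eq_iff_iff, hmem u hu, hmem v hv]
    exact ⟨hstL u v hu hv h, hstL v u hv hu h.symm⟩
  have hN : 0 < N := (Fintype.card_pos_iff.2 ⟨st []⟩).trans_le hcard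
  -- Short tests suffice.
  have htest : ∀ u v, IsWordOver S u → IsWordOver S v →
      (∀ x ∈ wordsLt S (N * N), mem (u ++ x) = mem (v ++ x)) →
      ∀ x, IsWordOver S x → mem (u ++ x) = mem (v ++ x) := by
    intro u v hu hv h x hx
    have hc : IsRightCongruence S fun x => (st (u ++ x), st (v ++ x)) := by
      intro y z hy hz a ha hyz
      rw [Prod.mk.injEq] at hyz ⊢
      rw [← List.append_assoc, ← List.append_assoc, ← List.append_assoc, ← List.append_assoc]
      exact ⟨hst _ _ (hu.append hy) (hu.append hz) a ha hyz.1,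
        hst _ _ (hv.append hy) (hv.append hz) a ha hyz.2⟩
    obtain ⟨x', h1, h2, h3⟩ := hc.exists_short x hx
    rw [Prod.mk.injEq] at h3
    rw [← hstmem _ _ (hu.append h1) (hu.append hx) h3.1,
      ← hstmem _ _ (hv.append h1) (hv.append hx) h3.2]
    refine h x' (mem_wordsLt.2 ⟨h2.trans_le ?_, h1⟩)
    rw [Fintype.card_prod]
    exact Nat.mul_le_mul hcard hcard
  set M := (learnedAutomaton S N mem).toNFA with hM
  have hstep : ∀ q a q', q' ∈ M.step q a ↔ ∃ u v, IsWordOver S u ∧ u.length < N ∧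
      IsWordOver S v ∧ v.length < N ∧ a ∈ S ∧ q = Encodable.encode u ∧ q' = Encodable.encode v ∧
      ∀ x, IsWordOver S x → mem (u ++ a :: x) = mem (v ++ x) := by
    intro q a q'
    change (q, a, q') ∈ (learnedAutomaton S N mem).2.2 ↔ _
    simp only [learnedAutomaton, List.mem_flatMap, List.mem_map, List.mem_filter, mem_wordsLt,
      List.all_eq_true, beq_iff_eq, Prod.mk.injEq]
    constructor
    · rintro ⟨u, ⟨hu1, hu2⟩, b, hb, v, ⟨⟨hv1, hv2⟩, ht⟩, rfl, rfl, rfl⟩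
      refine ⟨u, v, hu2, hu1, hv2, hv1, hb, rfl, rfl, fun x hx => ?_⟩
      have hb' : IsWordOver S [b] := by intro c hc; rw [List.mem_singleton.1 hc]; exact hb
      have := htest (u ++ [b]) v (IsWordOver.append hu2 hb') hv2 (fun x hx => by
        have := ht x (mem_wordsLt.1 hx); simpa using this) x hx
      simpa using this
    · rintro ⟨u, v, hu2, hu1, hv2, hv1, hb, rfl, rfl, ht⟩
      exact ⟨u, ⟨hu1, hu2⟩, a, hb, v, ⟨⟨hv1, hv2⟩, fun x hx => ht x hx.2⟩, rfl, rfl, rfl⟩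
  -- The states reached by a word are equivalent to it.
  have heval : ∀ w, (∀ q ∈ M.eval w, IsWordOver S w ∧ ∃ v, IsWordOver S v ∧ v.length < N ∧
      q = Encodable.encode v ∧ ∀ x, IsWordOver S x → mem (w ++ x) = mem (v ++ x)) ∧
      (IsWordOver S w → ∃ v : List (List Bool), Encodable.encode v ∈ M.eval w) := by
    intro w
    induction w using List.reverseRecOn with
    | nil =>
      have hq : ∀ q, q ∈ M.eval [] ↔ q = Encodable.encode ([] : List (List Bool)) := by
        intro q
        change q ∈ [Encodable.encode ([] : List (List Bool))] ↔ _
        simp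
      refine ⟨fun q h => ⟨hnil, [], hnil, hN, (hq q).1 h, fun x _ => rfl⟩, fun _ => ⟨[], ?_⟩⟩
      exact (hq _).2 rfl
    | append_singleton w a ih =>
      rw [NFA.eval_append_singleton]
      constructor
      · intro q hq
        rw [NFA.mem_stepSet] at hq
        obtain ⟨q', hq', hq⟩ := hq
        obtain ⟨hw, v, hv1, hv2, rfl, hv3⟩ := ih.1 q' hq'
        obtain ⟨u, v', hu1, hu2, hv1', hv2', ha, heq, rfl, ht⟩ := (hstep _ _ _).1 hq
        obtain rfl := Encodable.encode_injective heq
        have ha' : IsWordOver S [a] := by intro c hc; rw [List.mem_singleton.1 hc]; exact ha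
        refine ⟨hw.append ha', v', hv1', hv2', rfl, fun x hx => ?_⟩
        rw [← ht x hx, ← hv3 (a :: x) (by simpa using ha'.append hx)]
        simp
      · intro hwa
        have hw : IsWordOver S w := fun b hb => hwa b (by simp [hb])
        have ha : a ∈ S := hwa a (by simp)
        have ha' : IsWordOver S [a] := by intro c hc; rw [List.mem_singleton.1 hc]; exact ha
        obtain ⟨v, hv⟩ := ih.2 hw
        obtain ⟨-, v', hv1, hv2, heq, -⟩ := ih.1 _ hv
        obtain rfl := Encodable.encode_injective heq
        -- A short word in the class of `v a` is a legitimate successor, so reading letters of `S`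
        -- never gets stuck.
        obtain ⟨v', h1, h2, h3⟩ := hst.exists_short (v ++ [a]) (hv1.append ha')
        refine ⟨v', NFA.mem_stepSet.2 ⟨_, hv, (hstep _ _ _).2 ⟨v, v', hv1, hv2, h1,
          h2.trans_le hcard, ha, rfl, rfl, fun x hx => ?_⟩⟩⟩
        have := hstmem _ _ (h1.append hx) ((hv1.append ha').append hx)
          (hst.append h1 (hv1.append ha') hx h3)
        rw [this]; simp
  have hacc : ∀ q, q ∈ M.accept ↔ ∃ v, IsWordOver S v ∧ v.length < N ∧ mem v = true ∧
      Encodable.encode v = q := by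
    intro q
    change q ∈ (learnedAutomaton S N mem).2.1 ↔ _
    simp only [learnedAutomaton, List.mem_map, List.mem_filter, mem_wordsLt, IsWordOver]
    constructor
    · rintro ⟨v, ⟨⟨h1, h2⟩, h3⟩, h4⟩; exact ⟨v, h2, h1, h3, h4⟩
    · rintro ⟨v, h2, h1, h3, h4⟩; exact ⟨v, ⟨⟨h1, h2⟩, h3⟩, h4⟩
  ext w
  change (∃ q ∈ M.accept, q ∈ M.eval w) ↔ _
  constructor
  · rintro ⟨q, hq, hqw⟩
    obtain ⟨v, hv1, hv2, hv3, rfl⟩ := (hacc q).1 hq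
    obtain ⟨hw, v', -, -, heq, h⟩ := (heval w).1 _ hqw
    obtain rfl := Encodable.encode_injective heq
    have := h [] hnil
    simp only [List.append_nil] at this
    rw [← hmem w hw, this, hv3]
  · intro hw
    have hw' := hL w hw
    obtain ⟨v, hv⟩ := (heval w).2 hw'
    obtain ⟨-, v', hv1, hv2, heq, h⟩ := (heval w).1 _ hv
    obtain rfl := Encodable.encode_injective heq
    have := h [] hnil
    simp only [List.append_nil] at this
    exact ⟨_, (hacc _).2 ⟨v, hv1, hv2, by rw [← this, hmem w hw']; exact hw, rfl⟩, hv⟩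

end ArrayAbs

namespace ArrayAbs

/-! ## Normal forms of terms, atoms and formulae -/

def IVar.equivSum : IVar ≃ (Bool × ℕ) ⊕ (Bool × ℕ) ⊕ ℕ where
  toFun
    | .par b x => .inl (b, x)
    | .idx b x => .inr (.inl (b, x))
    | .bnd k => .inr (.inr k)
  invFun
    | .inl (b, x) => .par b x
    | .inr (.inl (b, x)) => .idx b x
    | .inr (.inr k) => .bnd k
  left_inv x := by cases x <;> rfl
  right_inv x := by rcases x with ⟨_, _⟩ | ⟨_, _⟩ | _ <;> rfl

def Cmp.equivFin : Cmp ≃ Fin 6 where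
  toFun
    | .eq => 0
    | .ne => 1
    | .le => 2
    | .lt => 3
    | .ge => 4
    | .gt => 5
  invFun
    | 0 => .eq
    | 1 => .ne
    | 2 => .le
    | 3 => .lt
    | 4 => .ge
    | 5 => .gt
  left_inv c := by cases c <;> rfl
  right_inv i := by fin_cases i <;> rfl

instance : DecidableEq IVar := IVar.equivSum.decidableEq

instance : Primcodable IVar := Primcodable.ofEquiv _ IVar.equivSum

instance : Primcodable Cmp := Primcodable.ofEquiv _ Cmp.equivFin

instance : Finite Cmp := Finite.of_equiv _ Cmp.equivFin.symm

/-- Index terms `x + n` and `n`. -/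
abbrev NIdx := Option IVar × ℤ

/-- Data variables and array reads, without offset. -/
abbrev Read := (Bool × ℕ) ⊕ (Bool × ℕ × NIdx)

/-- Data variables and array cells. -/
abbrev Cell := (Bool × ℕ) ⊕ (Bool × ℕ × ℤ)

/-- Data terms `r + n` and `n`. -/
abbrev NDat := Option Read × ℤ

/-- Index atoms and data atoms. -/
abbrev NAtom := (Cmp × NIdx × NIdx) ⊕ (Cmp × NDat × NDat)

/-- Formulae in prenex disjunctive normal form. -/
abbrev NPrenex := List Bool × List (List NAtom)

def ITerm.nf (sizes : List ℕ) : ITerm → NIdx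
  | .var x => (some x, 0)
  | .const n => (none, n)
  | .size b a => (some (.par b (sizes.getD a 0)), 0)
  | .plus I n => ((I.nf sizes).1, (I.nf sizes).2 + n)

def DTerm.nf (sizes : List ℕ) : DTerm → NDat
  | .var b v => (some (.inl (b, v)), 0)
  | .const n => (none, n)
  | .get b a I => (some (.inr (b, a, I.nf sizes)), 0)
  | .plus E n => ((E.nf sizes).1, (E.nf sizes).2 + n)

def Atom.nf (sizes : List ℕ) : Atom → NAtom
  | .idx c I J => .inl (c, I.nf sizes, J.nf sizes)
  | .dat c E F => .inr (c, E.nf sizes, F.nf sizes)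

/-! ### Values -/

def idxVal (z : IVar → ℤ) (t : NIdx) : ℤ := t.1.elim 0 z + t.2

/-- Different reads may denote the same cell, depending on the values of their index terms; this
aliasing is why values of reads will have to be checked for consistency. -/
def readCell (z : IVar → ℤ) (r : Read) : Cell :=
  r.elim Sum.inl fun p => .inr (p.1, p.2.1, idxVal z p.2.2)

def datVal (d : Read → ℤ) (t : NDat) : ℤ := t.1.elim 0 d + t.2

def atomHolds (z : IVar → ℤ) (d : Read → ℤ) (A : NAtom) : Prop :=
  A.elim (fun p => p.1.eval (idxVal z p.2.1) (idxVal z p.2.2))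
    fun p => p.1.eval (datVal d p.2.1) (datVal d p.2.2)

/-- The values of the index variables. -/
def varVal (ν : Bool → Nums) (e : ℕ → ℕ) (x : IVar) : ℤ := x.eval ν e

/-- The values of data variables and array cells. -/
def cellVal (σ : Bool → State) (c : Cell) : ℤ :=
  c.elim (fun p => (σ p.1).dat p.2) fun p => (σ p.1).arr p.2.1 p.2.2

theorem ITerm.idxVal_nf (V : Vocab) (ν : Bool → Nums) (e : ℕ → ℕ) (I : ITerm) :
    idxVal (varVal ν e) (I.nf V.size) = I.eval V ν e := by
  induction I with
  | var x => simp [ITerm.nf, idxVal, ITerm.eval, varVal]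
  | const n => simp [ITerm.nf, idxVal, ITerm.eval]
  | size b a => simp [ITerm.nf, idxVal, ITerm.eval, varVal, IVar.eval]
  | plus I n ih => rw [ITerm.eval, ← ih]; simp [ITerm.nf, idxVal, add_assoc]

theorem DTerm.datVal_nf (V : Vocab) (σ : Bool → State) (e : ℕ → ℕ) (E : DTerm) :
    datVal (fun r => cellVal σ (readCell (varVal (fun b => (σ b).toNums) e) r)) (E.nf V.size) =
      E.eval V σ e := by
  induction E with
  | var b v => simp [DTerm.nf, datVal, DTerm.eval, cellVal, readCell]
  | const n => simp [DTerm.nf, datVal, DTerm.eval]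
  | get b a I => simp [DTerm.nf, datVal, DTerm.eval, cellVal, readCell, ITerm.idxVal_nf]
  | plus I n ih => rw [DTerm.eval, ← ih]; simp [DTerm.nf, datVal, add_assoc]

theorem Atom.atomHolds_nf (V : Vocab) (σ : Bool → State) (e : ℕ → ℕ) (A : Atom) :
    atomHolds (varVal (fun b => (σ b).toNums) e)
      (fun r => cellVal σ (readCell (varVal (fun b => (σ b).toNums) e) r)) (A.nf V.size) ↔
      A.eval V σ e := by
  cases A <;> simp [Atom.nf, atomHolds, Atom.eval, ITerm.idxVal_nf, DTerm.datVal_nf]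

/-! ### Substitution -/

/-- Replace every index variable `x` by `f x`. -/
def bindIdx (f : IVar → NIdx) (t : NIdx) : NIdx :=
  t.1.elim t fun x => ((f x).1, (f x).2 + t.2)

def bindRead (f : IVar → NIdx) (r : Read) : Read :=
  r.elim Sum.inl fun p => .inr (p.1, p.2.1, bindIdx f p.2.2)

def bindDat (f : IVar → NIdx) (t : NDat) : NDat :=
  t.1.elim t fun r => (some (bindRead f r), t.2)

def bindAtom (f : IVar → NIdx) (A : NAtom) : NAtom :=
  A.elim (fun p => .inl (p.1, bindIdx f p.2.1, bindIdx f p.2.2))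
    fun p => .inr (p.1, bindDat f p.2.1, bindDat f p.2.2)

theorem bindIdx_bindIdx (f g : IVar → NIdx) (t : NIdx) :
    bindIdx f (bindIdx g t) = bindIdx (fun x => bindIdx f (g x)) t := by
  obtain ⟨_ | x, n⟩ := t
  · rfl
  · rcases h : g x with ⟨_ | y, k⟩ <;> simp [bindIdx, h, add_assoc]

theorem bindAtom_bindAtom (f g : IVar → NIdx) (A : NAtom) :
    bindAtom f (bindAtom g A) = bindAtom (fun x => bindIdx f (g x)) A := by
  have hd : ∀ t, bindDat f (bindDat g t) = bindDat (fun x => bindIdx f (g x)) t := by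
    rintro ⟨_ | (_ | _), n⟩ <;> simp [bindDat, bindRead, bindIdx_bindIdx]
  rcases A with ⟨c, I, J⟩ | ⟨c, E, F⟩ <;> simp [bindAtom, bindIdx_bindIdx, hd]

/-- The normal form of a substitution of the bound variables. -/
def substFun (sizes : List ℕ) (f : ℕ → ITerm) : IVar → NIdx
  | .bnd k => (f k).nf sizes
  | x => (some x, 0)

theorem ITerm.nf_subst (sizes : List ℕ) (f : ℕ → ITerm) (I : ITerm) :
    (I.subst f).nf sizes = bindIdx (substFun sizes f) (I.nf sizes) := by
  induction I with
  | var x => cases x <;> simp [ITerm.subst, ITerm.nf, bindIdx, substFun]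
  | const n => rfl
  | size b a => simp [ITerm.subst, ITerm.nf, bindIdx, substFun]
  | plus I n ih =>
    simp only [ITerm.subst, ITerm.nf, ih, bindIdx]
    rcases h : (I.nf sizes).1 with _ | x <;> simp [h, add_assoc]

theorem DTerm.nf_subst (sizes : List ℕ) (f : ℕ → ITerm) (E : DTerm) :
    (E.subst f).nf sizes = bindDat (substFun sizes f) (E.nf sizes) := by
  induction E with
  | var b v => rfl
  | const n => rfl
  | get b a I => simp [DTerm.subst, DTerm.nf, bindDat, bindRead, ITerm.nf_subst]
  | plus E n ih =>
    simp only [DTerm.subst, DTerm.nf, ih, bindDat]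
    rcases h : (E.nf sizes).1 with _ | x <;> simp [h]

theorem Atom.nf_subst (sizes : List ℕ) (f : ℕ → ITerm) (A : Atom) :
    (A.subst f).nf sizes = bindAtom (substFun sizes f) (A.nf sizes) := by
  cases A <;> simp [Atom.subst, Atom.nf, bindAtom, ITerm.nf_subst, DTerm.nf_subst]

/-- A substitution that renames bound variables. -/
def renameFun (g : ℕ → IVar) : IVar → NIdx
  | .bnd k => (some (g k), 0)
  | x => (some x, 0)

theorem substFun_var (sizes : List ℕ) (g : ℕ → IVar) :
    substFun sizes (fun k => .var (g k)) = renameFun g := by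
  funext x; cases x <;> rfl

theorem bindIdx_renameFun (f g : ℕ → IVar) (x : IVar) :
    bindIdx (renameFun f) (renameFun g x) = match x with
      | .bnd k => renameFun f (g k)
      | x => (some x, 0) := by
  rcases x with _ | _ | k
  · simp [renameFun, bindIdx]
  · simp [renameFun, bindIdx]
  · simp [renameFun, bindIdx]

/-- Substitution of the designated variable. -/
def instFun (t : NIdx) : IVar → NIdx
  | .bnd 0 => t
  | .bnd (k + 1) => (some (.bnd k), 0)
  | x => (some x, 0)

theorem substFun_instMap (sizes : List ℕ) (t : ITerm) :
    substFun sizes (instMap t) = instFun (t.nf sizes) := by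
  funext x
  rcases x with _ | _ | k
  · rfl
  · rfl
  · cases k <;> rfl

/-! ### Prenex normal forms -/

def raiseVar (c n : ℕ) (k : ℕ) : IVar := .bnd (bif decide (k < c) then k else k + n)

/-- Apply a substitution to a matrix. -/
def bindMatrix (f : IVar → NIdx) (M : List (List NAtom)) : List (List NAtom) :=
  M.map fun c => c.map fun A => bindAtom f A

theorem bindMatrix_bindMatrix (f g : IVar → NIdx) (M : List (List NAtom)) :
    bindMatrix f (bindMatrix g M) = bindMatrix (fun x => bindIdx f (g x)) M := by
  simp [bindMatrix, bindAtom_bindAtom]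

def prenexOr (φ ψ : NPrenex) : NPrenex :=
  (φ.1 ++ ψ.1, bindMatrix (renameFun (raiseVar 0 ψ.1.length)) φ.2 ++
    bindMatrix (renameFun (raiseVar ψ.1.length φ.1.length)) ψ.2)

def prenexAnd (φ ψ : NPrenex) : NPrenex :=
  (φ.1 ++ ψ.1, (bindMatrix (renameFun (raiseVar 0 ψ.1.length)) φ.2).flatMap fun l =>
    (bindMatrix (renameFun (raiseVar ψ.1.length φ.1.length)) ψ.2).map fun l' => l ++ l')

def negAtom (A : NAtom) : NAtom :=
  A.elim (fun p => .inl (p.1.neg, p.2)) fun p => .inr (p.1.neg, p.2)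

/-- Normal form of a formula (for `false`) and of its negation (for `true`). -/
def Formula.nprenex (sizes : List ℕ) : Bool → Formula → NPrenex
  | b, .atom A => ([], [[bif b then negAtom (A.nf sizes) else A.nf sizes]])
  | b, .not φ => φ.nprenex sizes (!b)
  | b, .or φ ψ => bif b then prenexAnd (φ.nprenex sizes b) (ψ.nprenex sizes b)
      else prenexOr (φ.nprenex sizes b) (ψ.nprenex sizes b)
  | b, .and φ ψ => bif b then prenexOr (φ.nprenex sizes b) (ψ.nprenex sizes b)
      else prenexAnd (φ.nprenex sizes b) (ψ.nprenex sizes b)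
  | b, .ex φ => (b :: (φ.nprenex sizes b).1, (φ.nprenex sizes b).2)
  | b, .all φ => ((!b) :: (φ.nprenex sizes b).1, (φ.nprenex sizes b).2)

def PrenexDNF.nf (sizes : List ℕ) (φ : PrenexDNF) : NPrenex :=
  (φ.quants, φ.matrix.map fun c => c.map fun A => A.nf sizes)

theorem nf_raise (sizes : List ℕ) (c n : ℕ) (M : List (List Atom)) :
    ((raise c n M).map fun c => c.map fun A => A.nf sizes) =
      bindMatrix (renameFun (raiseVar c n)) (M.map fun c => c.map fun A => A.nf sizes) := by
  have : (fun k => ITerm.var (IVar.bnd (if k < c then k else k + n))) =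
      fun k => ITerm.var (raiseVar c n k) := by
    funext k; simp [raiseVar, Bool.cond_decide]
  simp only [raise, bindMatrix, List.map_map, Function.comp_def, this, Atom.nf_subst,
    substFun_var]

theorem PrenexDNF.nf_or (sizes : List ℕ) (φ ψ : PrenexDNF) :
    (φ.or ψ).nf sizes = prenexOr (φ.nf sizes) (ψ.nf sizes) := by
  simp only [PrenexDNF.nf, PrenexDNF.or, prenexOr, List.map_append, nf_raise]

theorem PrenexDNF.nf_and (sizes : List ℕ) (φ ψ : PrenexDNF) :
    (φ.and ψ).nf sizes = prenexAnd (φ.nf sizes) (ψ.nf sizes) := by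
  simp only [PrenexDNF.nf, PrenexDNF.and, prenexAnd, ← nf_raise]
  simp [List.map_flatMap, List.flatMap_map, Function.comp_def]

theorem Atom.nf_neg (sizes : List ℕ) (A : Atom) : A.neg.nf sizes = negAtom (A.nf sizes) := by
  cases A <;> rfl

/-- Normalizing atoms commutes with prenexing, so computations can stay within normal forms
throughout. -/
theorem Formula.nf_prenex (sizes : List ℕ) (b : Bool) (φ : Formula) :
    (φ.prenex b).nf sizes = φ.nprenex sizes b := by
  induction φ generalizing b with
  | atom A => cases b <;> simp [Formula.prenex, PrenexDNF.nf, Formula.nprenex, Atom.nf_neg]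
  | not φ ih => exact ih _
  | or φ ψ ihφ ihψ =>
    cases b <;> simp [Formula.prenex, Formula.nprenex, PrenexDNF.nf_or, PrenexDNF.nf_and, ihφ, ihψ]
  | and φ ψ ihφ ihψ =>
    cases b <;> simp [Formula.prenex, Formula.nprenex, PrenexDNF.nf_or, PrenexDNF.nf_and, ihφ, ihψ]
  | ex φ ih => simp only [Formula.prenex, Formula.nprenex, ← ih]; rfl
  | all φ ih => simp only [Formula.prenex, Formula.nprenex, ← ih]; rfl

/-- The bound variables from `d` on are replaced by the parameters from `p` on. -/
def starVar (p d : ℕ) (k : ℕ) : IVar :=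
  bif decide (k < d) then .bnd k else .par false (p + (k - d))

/-- The matrix sits under `d` outer quantifiers and the block of `φ` itself, so the variables to be
replaced begin at the sum of the two. -/
def prenexStar (p d : ℕ) (φ : NPrenex) : NPrenex :=
  (φ.1, bindMatrix (renameFun (starVar p (d + φ.1.length))) φ.2)

/-- Inserting `b` variables above the `a` innermost ones shifts the threshold for replacement by
`b`; a replaced variable has become a parameter and is no longer raised. -/
theorem bindMatrix_starVar_raise (p d a b : ℕ) (M : List (List NAtom)) :
    bindMatrix (renameFun (starVar p (d + (a + b)))) (bindMatrix (renameFun (raiseVar a b)) M) =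
      bindMatrix (renameFun (raiseVar a b)) (bindMatrix (renameFun (starVar p (d + a))) M) := by
  rw [bindMatrix_bindMatrix, bindMatrix_bindMatrix]
  congr 1
  funext x
  rcases x with _ | _ | k
  · simp [renameFun, bindIdx]
  · simp [renameFun, bindIdx]
  · simp only [bindIdx_renameFun, raiseVar, starVar, Bool.cond_decide]
    by_cases h1 : k < a
    · simp [h1, renameFun, show k < d + (a + b) by omega, show k < d + a by omega, raiseVar,
        starVar]
    · by_cases h2 : k < d + a
      · simp [h1, h2, renameFun, show k + b < d + (a + b) by omega, raiseVar, starVar]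
      · simp [h1, h2, renameFun, show ¬ k + b < d + (a + b) by omega, starVar,
          show k + b - (d + (a + b)) = k - (d + a) by omega]

theorem prenexStar_or (p d : ℕ) (φ ψ : NPrenex) :
    prenexStar p d (prenexOr φ ψ) = prenexOr (prenexStar p d φ) (prenexStar p d ψ) := by
  have h1 := bindMatrix_starVar_raise p (d + φ.1.length) 0 ψ.1.length φ.2
  have h2 := bindMatrix_starVar_raise p d ψ.1.length φ.1.length ψ.2
  rw [zero_add, add_zero, add_assoc] at h1
  rw [add_comm ψ.1.length] at h2
  have happ : ∀ f M N, bindMatrix f (M ++ N) = bindMatrix f M ++ bindMatrix f N := by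
    intro f M N; simp [bindMatrix]
  simp only [prenexStar, prenexOr, List.length_append, happ, h1, h2]

theorem prenexStar_and (p d : ℕ) (φ ψ : NPrenex) :
    prenexStar p d (prenexAnd φ ψ) = prenexAnd (prenexStar p d φ) (prenexStar p d ψ) := by
  have h1 := bindMatrix_starVar_raise p (d + φ.1.length) 0 ψ.1.length φ.2
  have h2 := bindMatrix_starVar_raise p d ψ.1.length φ.1.length ψ.2
  rw [zero_add, add_zero, add_assoc] at h1
  rw [add_comm ψ.1.length] at h2
  have happ : ∀ f M N, bindMatrix f (List.flatMap (fun l => N.map fun l' => l ++ l') M) =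
      (bindMatrix f M).flatMap fun l => (bindMatrix f N).map fun l' => l ++ l' := by
    intro f M N
    simp [bindMatrix, List.map_flatMap, List.flatMap_map, Function.comp_def]
  simp only [prenexStar, prenexAnd, List.length_append, happ, h1, h2]

theorem under_starVar (p d : ℕ) :
    under (fun k => .var (starVar p d k)) = fun k => .var (starVar p (d + 1) k) := by
  funext k
  cases k with
  | zero => simp [under, starVar]
  | succ k =>
    by_cases h : k < d
    · simp [under, starVar, h, ITerm.subst]
    · simp [under, starVar, h, ITerm.subst]

/-- Allows Skolemization to be carried out on the normal form recovered from a code, instead of on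
the formula. -/
theorem Formula.nprenex_subst_star (sizes : List ℕ) (p d : ℕ) (b : Bool) (φ : Formula) :
    (φ.subst fun k => .var (starVar p d k)).nprenex sizes b =
      prenexStar p d (φ.nprenex sizes b) := by
  induction φ generalizing b d with
  | atom A =>
    have hneg : ∀ f A, bindAtom f (negAtom A) = negAtom (bindAtom f A) := by
      rintro f (_ | _) <;> rfl
    cases b <;> simp [Formula.subst, Formula.nprenex, prenexStar, bindMatrix, Atom.nf_subst,
      substFun_var, hneg]
  | not φ ih => exact ih _ _
  | or φ ψ ihφ ihψ =>
    cases b <;>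
    simp [Formula.subst, Formula.nprenex, prenexStar_or, prenexStar_and, ihφ, ihψ]
  | and φ ψ ihφ ihψ =>
    cases b <;>
    simp [Formula.subst, Formula.nprenex, prenexStar_or, prenexStar_and, ihφ, ihψ]
  | ex φ ih =>
    simp only [Formula.subst, Formula.nprenex, under_starVar, ih, prenexStar, List.length_cons]
    rw [add_assoc, add_comm 1]
  | all φ ih =>
    simp only [Formula.subst, Formula.nprenex, under_starVar, ih, prenexStar, List.length_cons]
    rw [add_assoc, add_comm 1]

theorem Formula.nprenex_star (V : Vocab) (b : Bool) (ψ : Formula) :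
    (ψ.star V).nprenex V.size b = prenexStar V.par 0 (ψ.nprenex V.size b) := by
  rw [← Formula.nprenex_subst_star]
  simp [Formula.star, starVar]

end ArrayAbs

namespace ArrayAbs

/-! ## The abstraction of a matrix in normal form -/

def datTerms (t : NDat) : List NIdx :=
  t.1.elim [] fun r => r.elim (fun _ => []) fun p => [p.2.2]

def atomTerms (A : NAtom) : List NIdx :=
  A.elim (fun p => [p.2.1, p.2.2]) fun p => datTerms p.2.1 ++ datTerms p.2.2

def isDataAtom (A : NAtom) : Bool := A.elim (fun _ => false) fun _ => true

/-- The index terms at which a disjunct constrains the predicates. -/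
def constrTerms (preds : List NAtom) (c : List NAtom) : List NIdx :=
  (c.filter isDataAtom).flatMap atomTerms ++
    ((preds.flatMap atomTerms).filter (fun u => !decide (u.1 = some (.bnd 0))) ++
      (preds.flatMap atomTerms).flatMap fun u =>
        ((c.filter isDataAtom).flatMap atomTerms).map fun t => bindIdx (instFun u) t)

/-- Satisfaction of an abstracted matrix: `z` are the values of the index variables, `len` is the
length of the word, and `bit` tells the bits of the word. -/
def absMatrix (preds : List NAtom) (M : List (List NAtom)) (z : IVar → ℤ) (len : ℕ)
    (bit : ℕ → ℤ → Prop) : Prop :=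
  ∃ c ∈ M, (∀ A ∈ c, isDataAtom A = false → atomHolds z (fun _ => 0) A) ∧
    ∃ (y : IVar → ℕ) (D : Cell → ℤ),
      (∀ A ∈ c, isDataAtom A = true →
        atomHolds (fun x => y x) (fun r => D (readCell (fun x => y x) r)) A) ∧
      ∀ t ∈ constrTerms preds c, ∀ k Q, preds[k]? = some Q →
        1 ≤ idxVal z t → idxVal z t ≤ len →
          (bit k (idxVal z t) ↔
            atomHolds (fun x => y x) (fun r => D (readCell (fun x => y x) r))
              (bindAtom (instFun t) Q))

theorem DTerm.datTerms_nf (sizes : List ℕ) (E : DTerm) :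
    datTerms (E.nf sizes) = E.iterms.map (ITerm.nf sizes) := by
  induction E with
  | var b v => rfl
  | const n => rfl
  | get b a I => rfl
  | plus E n ih => exact ih

theorem Atom.atomTerms_nf (sizes : List ℕ) (A : Atom) :
    atomTerms (A.nf sizes) = A.iterms.map (ITerm.nf sizes) := by
  cases A <;> simp [Atom.nf, atomTerms, Atom.iterms, DTerm.datTerms_nf]

theorem Atom.isDataAtom_nf (sizes : List ℕ) (A : Atom) :
    isDataAtom (A.nf sizes) = true ↔ A.IsData := by
  cases A <;> simp [Atom.nf, isDataAtom, Atom.IsData]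

theorem ITerm.has_zero_iff (sizes : List ℕ) (I : ITerm) :
    I.Has 0 ↔ (I.nf sizes).1 = some (.bnd 0) := by
  induction I with
  | var x => simp [ITerm.nf, ITerm.Has]
  | const n => simp [ITerm.nf, ITerm.Has]
  | size b a => simp [ITerm.nf, ITerm.Has]
  | plus I n ih => simpa [ITerm.nf, ITerm.Has] using ih

theorem mem_constrTerms {m : ℕ} (sizes : List ℕ) (P : Fin m → Atom) (c : List Atom)
    (t : NIdx) :
    t ∈ constrTerms (List.ofFn fun k => (P k).nf sizes) (c.map fun A => A.nf sizes) ↔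
      ∃ u, IsTermOf P {A | A ∈ c ∧ A.IsData} u ∧ u.nf sizes = t := by
  have h1 : ∀ t, t ∈ ((c.map fun A => A.nf sizes).filter isDataAtom).flatMap atomTerms ↔
      ∃ A, (A ∈ c ∧ A.IsData) ∧ ∃ u ∈ A.iterms, u.nf sizes = t := by
    intro t
    simp only [List.mem_flatMap, List.mem_filter, List.mem_map]
    constructor
    · rintro ⟨_, ⟨⟨A, hA, rfl⟩, hd⟩, ht⟩
      rw [Atom.atomTerms_nf, List.mem_map] at ht
      exact ⟨A, ⟨hA, (Atom.isDataAtom_nf _ _).1 hd⟩, ht⟩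
    · rintro ⟨A, ⟨hA, hd⟩, ht⟩
      refine ⟨_, ⟨⟨A, hA, rfl⟩, (Atom.isDataAtom_nf _ _).2 hd⟩, ?_⟩
      rw [Atom.atomTerms_nf, List.mem_map]
      exact ht
  have h2 : ∀ t, t ∈ (List.ofFn fun k => (P k).nf sizes).flatMap atomTerms ↔
      ∃ k, ∃ u ∈ (P k).iterms, u.nf sizes = t := by
    intro t
    simp only [List.mem_flatMap, List.mem_ofFn']
    constructor
    · rintro ⟨_, ⟨k, rfl⟩, ht⟩
      rw [Atom.atomTerms_nf, List.mem_map] at ht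
      exact ⟨k, ht⟩
    · rintro ⟨k, ht⟩
      refine ⟨_, ⟨k, rfl⟩, ?_⟩
      rw [Atom.atomTerms_nf, List.mem_map]
      exact ht
  simp only [constrTerms, List.mem_append, h1, List.mem_filter, h2]
  rw [List.mem_flatMap]
  simp only [List.mem_map (l := List.flatMap _ _), h1, h2]
  constructor
  · rintro (⟨A, hA, u, hu, rfl⟩ | ⟨⟨k, u, hu, rfl⟩, hc⟩ | ⟨_, ⟨k, u, hu, rfl⟩, _, ⟨A, hA, t', ht', rfl⟩, rfl⟩)
    · exact ⟨u, Or.inl ⟨A, hA, hu⟩, rfl⟩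
    · refine ⟨u, Or.inr (Or.inl ⟨k, hu, fun h => ?_⟩), rfl⟩
      rw [ITerm.has_zero_iff sizes] at h
      simp [h] at hc
    · refine ⟨u.inst t', Or.inr (Or.inr ⟨k, u, hu, A, hA, t', ht', rfl⟩), ?_⟩
      rw [ITerm.inst, ITerm.nf_subst, substFun_instMap]
  · rintro ⟨u, (⟨A, hA, hu⟩ | ⟨k, hu, hc⟩ | ⟨k, u, hu, A, hA, t', ht', rfl⟩), rfl⟩
    · exact Or.inl ⟨A, hA, u, hu, rfl⟩
    · refine Or.inr (Or.inl ⟨⟨k, u, hu, rfl⟩, ?_⟩)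
      rw [ITerm.has_zero_iff sizes] at hc
      simp [hc]
    · refine Or.inr (Or.inr ⟨_, ⟨k, u, hu, rfl⟩, _, ⟨A, hA, t', ht', rfl⟩, ?_⟩)
      rw [ITerm.inst, ITerm.nf_subst, substFun_instMap]

/-- Terms of a disjunct form a finite set. -/
theorem exists_termList {m : ℕ} (P : Fin m → Atom) (c : List Atom) :
    ∃ T : List ITerm, ∀ t, t ∈ T ↔ IsTermOf P {A | A ∈ c ∧ A.IsData} t := by
  classical
  have hc : {A | A ∈ c ∧ A.IsData}.Finite := (List.finite_toSet c).subset fun A hA => hA.1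
  have h1 : {t | ∃ A ∈ {A | A ∈ c ∧ A.IsData}, t ∈ A.iterms}.Finite := by
    have := hc.biUnion (t := fun A => {t | t ∈ A.iterms}) fun A _ => List.finite_toSet _
    refine this.subset ?_
    rintro t ⟨A, hA, ht⟩
    exact Set.mem_biUnion hA ht
  have h2 : {t | ∃ k, t ∈ (P k).iterms}.Finite := by
    have := Set.finite_iUnion (f := fun k => {t | t ∈ (P k).iterms}) fun k => List.finite_toSet _
    refine this.subset ?_
    rintro t ⟨k, ht⟩
    exact Set.mem_iUnion.2 ⟨k, ht⟩
  have h3 : {t | IsTermOf P {A | A ∈ c ∧ A.IsData} t}.Finite := by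
    refine (h1.union (h2.union (h2.image2 (fun u t' => u.inst t') h1))).subset ?_
    rintro t (h | ⟨k, hu, -⟩ | ⟨k, u, hu, A, hA, t', ht', rfl⟩)
    · exact Or.inl h
    · exact Or.inr (Or.inl ⟨k, hu⟩)
    · exact Or.inr (Or.inr ⟨u, ⟨k, hu⟩, t', ⟨A, hA, ht'⟩, rfl⟩)
  exact ⟨h3.toFinset.toList, fun t => by simp⟩

/-- The conjunction of all implied clauses holds if and only if it is consistent with the
disjunct. -/
theorem constr_iff (V : Vocab) {m : ℕ} (P : Fin m → Atom) (c : List Atom) (ν : Bool → Nums)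
    (w : BWord m) (e : ℕ → ℕ) :
    (∀ C : List (Lit m), IsConstrClause V P {A | A ∈ c ∧ A.IsData} C → ∃ l ∈ C, l.kappa V ν w e) ↔
      ∃ (σ : Bool → State) (e' : ℕ → ℕ), (∀ A ∈ {A | A ∈ c ∧ A.IsData}, A.eval V σ e') ∧
        ∀ t, IsTermOf P {A | A ∈ c ∧ A.IsData} t → ∀ k, 1 ≤ t.eval V ν e →
          t.eval V ν e ≤ w.length →
            (Delta k (t.eval V ν e) w ↔ ((P k).inst t).eval V σ e') := by
  classical
  constructor
  · intro h
    obtain ⟨T, hT⟩ := exists_termList P c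
    -- The clause of all literals falsified by the word. It cannot be among the implied clauses,
    -- since each of those contains a literal that the word satisfies; a countermodel to its being
    -- implied is the interpretation sought.
    let C : List (Lit m) := (T.flatMap fun t => (List.finRange m).flatMap fun k =>
      [⟨true, k, t⟩, ⟨false, k, t⟩]).filter fun l => ¬ l.kappa V ν w e
    have hC : ∀ l : Lit m, l ∈ C ↔ IsTermOf P {A | A ∈ c ∧ A.IsData} l.t ∧ ¬ l.kappa V ν w e := by
      rintro ⟨b, k, t⟩
      simp only [C, List.mem_filter, List.mem_flatMap, hT, List.mem_finRange, true_and,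
        decide_eq_true_eq]
      refine and_congr_left fun _ => ⟨?_, fun ht => ⟨t, ht, k, ?_⟩⟩
      · rintro ⟨t', ht', k', hk'⟩
        simp only [List.mem_cons, Lit.mk.injEq, List.not_mem_nil, or_false] at hk'
        rcases hk' with ⟨-, -, rfl⟩ | ⟨-, -, rfl⟩ <;> exact ht'
      · cases b <;> simp
    have hnot : ¬ IsConstrClause V P {A | A ∈ c ∧ A.IsData} C := by
      intro hcl
      obtain ⟨l, hl, hk⟩ := h C hcl
      exact ((hC l).1 hl).2 hk
    rw [IsConstrClause, not_and] at hnot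
    have := hnot fun l hl => ((hC l).1 hl).1
    simp only [not_forall, not_exists, not_and] at this
    obtain ⟨σ, e', hh, hl⟩ := this
    refine ⟨σ, e', hh, fun t ht k h1 h2 => ?_⟩
    by_contra hcon
    -- If word and countermodel disagreed here, the literal stating the countermodel's truth value
    -- would be falsified by the word, hence lie in `C`, while being true in the countermodel.
    refine hl ⟨decide (((P k).inst t).eval V σ e'), k, t⟩ ((hC _).2 ⟨ht, fun hk => ?_⟩) ?_
    · have := hk h1 h2
      simp only [decide_eq_true_eq] at this
      exact hcon this
    · simp [Lit.eval]
  · rintro ⟨σ, e', hh, ht⟩ C ⟨hC1, hC2⟩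
    obtain ⟨l, hl, hev⟩ := hC2 σ e' hh
    exact ⟨l, hl, fun h1 h2 => (ht l.t (hC1 l hl) l.k h1 h2).trans hev⟩

/-- Removes states from the consistency condition: an interpretation together with an environment is
the same thing as arbitrary naturals for index variables and arbitrary integers for cells. -/
theorem matrixSat_iff (V : Vocab) {m : ℕ} (P : Fin m → Atom) (M : List (List Atom))
    (ν : Bool → Nums) (w : BWord m) (e : ℕ → ℕ) :
    matrixSat V P M ν w e ↔
      absMatrix (List.ofFn fun k => (P k).nf V.size) (M.map fun c => c.map fun A => A.nf V.size)
        (varVal ν e) w.length fun k i => ∃ hk : k < m, Delta (⟨k, hk⟩ : Fin m) i w := by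
  have hidx : ∀ A : Atom, A.evalIdx V ν e ↔ (isDataAtom (A.nf V.size) = false →
      atomHolds (varVal ν e) (fun _ => 0) (A.nf V.size)) := by
    rintro (_ | _) <;>
      simp [Atom.evalIdx, Atom.nf, isDataAtom, atomHolds, ITerm.idxVal_nf]
  simp only [matrixSat, absMatrix, List.mem_map, exists_exists_and_eq_and, constr_iff]
  refine exists_congr fun c => and_congr_right fun _ => and_congr ?_ ?_
  · constructor
    · rintro h _ ⟨A, hA, rfl⟩
      exact (hidx A).1 (h A hA)
    · exact fun h A hA => (hidx A).2 (h _ ⟨A, hA, rfl⟩)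
  -- both sides for matching interpretations
  have key : ∀ (σ : Bool → State) (e' : ℕ → ℕ) (y : IVar → ℕ) (D : Cell → ℤ),
      varVal (fun b => (σ b).toNums) e' = (fun x => (y x : ℤ)) → cellVal σ = D →
      (((∀ A ∈ {A | A ∈ c ∧ A.IsData}, A.eval V σ e') ∧
        ∀ t, IsTermOf P {A | A ∈ c ∧ A.IsData} t → ∀ k, 1 ≤ t.eval V ν e →
          t.eval V ν e ≤ w.length →
            (Delta k (t.eval V ν e) w ↔ ((P k).inst t).eval V σ e')) ↔
      ((∀ A, (∃ a ∈ c, a.nf V.size = A) → isDataAtom A = true →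
        atomHolds (fun x => y x) (fun r => D (readCell (fun x => y x) r)) A) ∧
      ∀ t ∈ constrTerms (List.ofFn fun k => (P k).nf V.size) (c.map fun A => A.nf V.size),
        ∀ k Q, (List.ofFn fun k => (P k).nf V.size)[k]? = some Q →
        1 ≤ idxVal (varVal ν e) t → idxVal (varVal ν e) t ≤ w.length →
          ((∃ hk : k < m, Delta (⟨k, hk⟩ : Fin m) (idxVal (varVal ν e) t) w) ↔
            atomHolds (fun x => y x) (fun r => D (readCell (fun x => y x) r))
              (bindAtom (instFun t) Q)))) := by
    intro σ e' y D hy hD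
    have hat : ∀ A : Atom, atomHolds (fun x => y x)
        (fun r => D (readCell (fun x => y x) r)) (A.nf V.size) ↔ A.eval V σ e' := by
      intro A
      rw [← hy, ← hD]
      exact Atom.atomHolds_nf V σ e' A
    refine and_congr ?_ ?_
    · constructor
      · rintro h _ ⟨A, hA, rfl⟩ hd
        exact (hat A).2 (h A ⟨hA, (Atom.isDataAtom_nf _ _).1 hd⟩)
      · rintro h A ⟨hA, hd⟩
        exact (hat A).1 (h _ ⟨A, hA, rfl⟩ ((Atom.isDataAtom_nf _ _).2 hd))
    · constructor
      · intro h t ht k Q hQ h1 h2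
        obtain ⟨u, hu, rfl⟩ := (mem_constrTerms _ _ _ _).1 ht
        rw [List.getElem?_ofFn] at hQ
        split_ifs at hQ with hk
        obtain rfl := Option.some.inj hQ
        rw [ITerm.idxVal_nf] at h1 h2 ⊢
        rw [← substFun_instMap, ← Atom.nf_subst, hat, exists_prop_of_true hk]
        exact h u hu ⟨k, hk⟩ h1 h2
      · intro h t ht k h1 h2
        have := h _ ((mem_constrTerms V.size P c _).2 ⟨t, ht, rfl⟩) k ((P k).nf V.size)
          (by rw [List.getElem?_ofFn]; simp)
        rw [ITerm.idxVal_nf, ← substFun_instMap, ← Atom.nf_subst, hat,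
          exists_prop_of_true k.2] at this
        exact this h1 h2
  constructor
  · rintro ⟨σ, e', h⟩
    exact ⟨fun x => x.eval (fun b => (σ b).toNums) e', cellVal σ,
      (key σ e' _ _ rfl rfl).1 h⟩
  · rintro ⟨y, D, h⟩
    refine ⟨fun b => ⟨⟨fun x => y (.par b x), fun x => y (.idx b x)⟩, fun v => D (.inl (b, v)),
      fun a i => D (.inr (b, a, i))⟩,
      fun k => y (.bnd k), (key _ _ y D ?_ ?_).2 h⟩
    · funext x; cases x <;> rfl
    · funext c; rcases c with ⟨_, _⟩ | ⟨_, _, _⟩ <;> rfl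

end ArrayAbs

namespace ArrayAbs

open Encodable

/-! ## Small models -/

/-- Gaps between finitely many integers can be shortened, preserving all differences up to `K`. -/
theorem exists_compression (S : Finset ℤ) (K : ℕ) :
    ∃ f : ℤ → ℤ, f 0 = 0 ∧ (∀ x, |f x| ≤ (S.card * (K + 1) : ℕ)) ∧
      ∀ x ∈ S, ∀ y ∈ S, ∀ c : ℤ, |c| ≤ K → (x + c ≤ y ↔ f x + c ≤ f y) := by
  -- `G` keeps the `K + 1` integers following each point of `S`, and `f` counts the members of `G`
  -- between `0` and `x`, with sign. Distances up to `K + 1` starting in `S` survive unchanged, and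
  -- larger ones remain at least `K + 1`, which exceeds every tested offset.
  let G : Finset ℤ := S.biUnion fun s => Finset.Ioc s (s + (K + 1))
  let f : ℤ → ℤ := fun x => ∑ z ∈ G, ((if 0 < z ∧ z ≤ x then 1 else 0) -
    (if x < z ∧ z ≤ 0 then 1 else 0))
  have hG : G.card ≤ S.card * (K + 1) := by
    refine Finset.card_biUnion_le_card_mul _ _ _ fun s _ => ?_
    rw [Int.card_Ioc]; omega
  have hdiff : ∀ x y, x ≤ y → f y - f x = (G.filter fun z => x < z ∧ z ≤ y).card := by
    intro x y hxy
    rw [Finset.card_filter, ← Finset.sum_sub_distrib]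
    push_cast
    refine Finset.sum_congr rfl fun z _ => ?_
    split_ifs <;> omega
  have hle : ∀ x ∈ S, ∀ y, x ≤ y → (f y - f x = y - x ∧ y - x ≤ K + 1) ∨
      (K + 1 ≤ f y - f x ∧ K + 1 < y - x) := by
    intro x hx y hxy
    rw [hdiff x y hxy]
    by_cases hK : y - x ≤ K + 1
    · left
      have : (G.filter fun z => x < z ∧ z ≤ y) = Finset.Ioc x y := by
        ext z
        simp only [Finset.mem_filter, Finset.mem_Ioc, G, Finset.mem_biUnion]
        refine ⟨fun h => h.2, fun h => ⟨⟨x, hx, h.1, by omega⟩, h⟩⟩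
      rw [this, Int.card_Ioc]
      omega
    · right
      have : Finset.Ioc x (x + (K + 1)) ⊆ (G.filter fun z => x < z ∧ z ≤ y) := by
        intro z hz
        simp only [Finset.mem_filter, Finset.mem_Ioc, G, Finset.mem_biUnion] at hz ⊢
        exact ⟨⟨x, hx, hz⟩, hz.1, by omega⟩
      have := Finset.card_le_card this
      rw [Int.card_Ioc] at this
      omega
  refine ⟨f, ?_, fun x => ?_, ?_⟩
  · refine Finset.sum_eq_zero fun z _ => ?_
    split_ifs <;> omega
  · refine (Finset.abs_sum_le_sum_abs _ _).trans ?_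
    have : ∑ z ∈ G, |((if 0 < z ∧ z ≤ x then 1 else 0) -
        (if x < z ∧ z ≤ 0 then 1 else 0) : ℤ)| ≤ ∑ _z ∈ G, 1 := by
      refine Finset.sum_le_sum fun z _ => ?_
      split_ifs <;> simp
    refine this.trans ?_
    simp only [Finset.sum_const, mul_one, nsmul_eq_mul]
    exact_mod_cast hG
  · intro x hx y hy c hc
    rw [abs_le] at hc
    rcases le_total x y with h | h
    · have := hle x hx y h
      omega
    · have := hle y hy x h
      omega

theorem Cmp.eval_congr {u v u' v' : ℤ} (h1 : u ≤ v ↔ u' ≤ v') (h2 : v ≤ u ↔ v' ≤ u') (c : Cmp) :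
    c.eval u v ↔ c.eval u' v' := by
  cases c <;> simp only [Cmp.eval] <;> omega

/-! ### Bounds from codes -/

theorem encode_le_of_pair {α β : Type} [Encodable α] [Encodable β] {a : α} {b : β} {E : ℕ}
    (h : encode (a, b) ≤ E) : encode a ≤ E ∧ encode b ≤ E := by
  rw [encode_prod_val] at h
  exact ⟨(Nat.left_le_pair _ _).trans h, (Nat.right_le_pair _ _).trans h⟩

theorem encode_le_of_inl {α β : Type} [Encodable α] [Encodable β] {a : α} {E : ℕ}
    (h : encode (Sum.inl a : α ⊕ β) ≤ E) : encode a ≤ E := by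
  rw [encode_inl] at h; omega

theorem encode_le_of_inr {α β : Type} [Encodable α] [Encodable β] {b : β} {E : ℕ}
    (h : encode (Sum.inr b : α ⊕ β) ≤ E) : encode b ≤ E := by
  rw [encode_inr] at h; omega

theorem encode_le_of_some {α : Type} [Encodable α] {a : α} {E : ℕ}
    (h : encode (some a) ≤ E) : encode a ≤ E := by
  rw [encode_some] at h; omega

/-- Codes dominate the codes of components, so a single number bounds all symbols, offsets and terms
that occur in a matrix. -/
theorem encode_le_of_mem {α : Type} [Encodable α] {a : α} {l : List α} (h : a ∈ l) :
    encode a ≤ encode l := by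
  induction l with
  | nil => simp at h
  | cons b l ih =>
    rw [encode_list_cons]
    rcases List.mem_cons.1 h with rfl | h
    · exact (Nat.left_le_pair _ _).trans (Nat.le_succ _)
    · exact ((ih h).trans (Nat.right_le_pair _ _)).trans (Nat.le_succ _)

theorem abs_le_of_encode_le {n : ℤ} {E : ℕ} (h : encode n ≤ E) : |n| ≤ E := by
  rcases n with n | n
  · rw [Int.ofNat_eq_natCast, encode_ofNat_int] at h
    rw [Int.ofNat_eq_natCast, abs_le]; omega
  · rw [encode_negSucc_int] at h
    rw [abs_le]; omega

/-- All variables that occur have code at most `E`. -/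
def SmallOption {α : Type} [Encodable α] (E : ℕ) (o : Option α) : Prop := ∀ x ∈ o, encode x ≤ E

theorem small_of_encode_le {α : Type} [Encodable α] {t : Option α × ℤ} {E : ℕ}
    (h : encode t ≤ E) : SmallOption E t.1 ∧ |t.2| ≤ E := by
  obtain ⟨o, n⟩ := t
  obtain ⟨h1, h2⟩ := encode_le_of_pair h
  refine ⟨fun x hx => ?_, abs_le_of_encode_le h2⟩
  rw [Option.mem_def] at hx
  simp only at hx
  subst hx
  exact encode_le_of_some h1

/-- Two interpretations of the symbols with code at most `E` have the same small differences. -/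
def SameDiffs {α : Type} [Encodable α] (E : ℕ) (y y' : α → ℤ) : Prop :=
  ∀ o o' : Option α, SmallOption E o → SmallOption E o' → ∀ c : ℤ, |c| ≤ (2 * E : ℕ) →
    (o.elim 0 y + c ≤ o'.elim 0 y ↔ o.elim 0 y' + c ≤ o'.elim 0 y')

theorem SameDiffs.of_eq {α : Type} [Encodable α] {E : ℕ} {y y' : α → ℤ}
    (h : ∀ x, encode x ≤ E → y x = y' x) : SameDiffs E y y' := by
  have : ∀ o : Option α, SmallOption E o → o.elim 0 y = o.elim 0 y' := by
    rintro (_ | x) ho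
    · rfl
    · exact h x (ho x rfl)
  intro o o' ho ho' c _
  rw [this o ho, this o' ho']

/-- Each offset is at most `E` in absolute value, so collecting both on one side gives at most `2 *
E`. A missing variable counts as `0`, so constants are covered as well. -/
theorem SameDiffs.le_iff {α : Type} [Encodable α] {E : ℕ} {y y' : α → ℤ} (h : SameDiffs E y y')
    {t u : Option α × ℤ} (ht : encode t ≤ E) (hu : encode u ≤ E) :
    t.1.elim 0 y + t.2 ≤ u.1.elim 0 y + u.2 ↔ t.1.elim 0 y' + t.2 ≤ u.1.elim 0 y' + u.2 := by
  obtain ⟨h1, h2⟩ := small_of_encode_le ht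
  obtain ⟨h3, h4⟩ := small_of_encode_le hu
  have := h t.1 u.1 h1 h3 (t.2 - u.2) (by rw [abs_le] at *; push_cast; omega)
  constructor <;> intro hh
  · have := this.1 (by omega)
    omega
  · have := this.2 (by omega)
    omega

theorem atomHolds_congr {E : ℕ} {z z' : IVar → ℤ} {d d' : Read → ℤ} (hz : SameDiffs E z z')
    (hd : SameDiffs E d d') {A : NAtom} (hA : encode A ≤ E) :
    atomHolds z d A ↔ atomHolds z' d' A := by
  rcases A with ⟨c, I, J⟩ | ⟨c, F, G⟩
  · obtain ⟨-, h⟩ := encode_le_of_pair (encode_le_of_inl hA)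
    obtain ⟨h1, h2⟩ := encode_le_of_pair h
    exact Cmp.eval_congr (hz.le_iff h1 h2) (hz.le_iff h2 h1) c
  · obtain ⟨-, h⟩ := encode_le_of_pair (encode_le_of_inr hA)
    obtain ⟨h1, h2⟩ := encode_le_of_pair h
    exact Cmp.eval_congr (hd.le_iff h1 h2) (hd.le_iff h2 h1) c

/-- Aliasing depends only on equality of index values, that is, on two comparisons of small terms.
-/
theorem readCell_congr {E : ℕ} {z z' : IVar → ℤ} (hz : SameDiffs E z z') {r s : Read}
    (hr : encode r ≤ E) (hs : encode s ≤ E) :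
    readCell z r = readCell z s ↔ readCell z' r = readCell z' s := by
  rcases r with r | ⟨b, a, t⟩ <;> rcases s with s | ⟨b', a', t'⟩
  · simp [readCell]
  · simp [readCell]
  · simp [readCell]
  · obtain ⟨-, h1⟩ := encode_le_of_pair (encode_le_of_inr hr)
    obtain ⟨-, h1⟩ := encode_le_of_pair h1
    obtain ⟨-, h2⟩ := encode_le_of_pair (encode_le_of_inr hs)
    obtain ⟨-, h2⟩ := encode_le_of_pair h2
    have h3 := hz.le_iff h1 h2
    have h4 := hz.le_iff h2 h1
    simp only [readCell, Sum.elim_inr, Sum.inr.injEq, Prod.mk.injEq]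
    refine and_congr_right fun _ => and_congr_right fun _ => ?_
    change idxVal z t ≤ idxVal z t' ↔ idxVal z' t ≤ idxVal z' t' at h3
    change idxVal z t' ≤ idxVal z t ↔ idxVal z' t' ≤ idxVal z' t at h4
    omega

/-- The bound for the values in small models. -/
def modelBound (E : ℕ) : ℕ := (E + 2) * (2 * E + 1)

/-- The values of the symbols with code at most `E` can be made small. -/
theorem exists_small_values {α : Type} [Encodable α] (E : ℕ) (y : α → ℤ) :
    ∃ f : ℤ → ℤ, (∀ x, |f x| ≤ modelBound E) ∧ (∀ x, encode x ≤ E → 0 ≤ y x → 0 ≤ f (y x)) ∧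
      SameDiffs E y fun x => f (y x) := by
  -- The values to be kept apart: those of the symbols with small code, and `0` for the constants.
  -- There are at most `E + 2` of them, and compression with `K = 2 * E` yields `modelBound E`.
  let S : Finset ℤ := insert 0 ((Finset.range (E + 1)).image fun i =>
    ((decode i : Option α).elim 0 y))
  have hS : S.card ≤ E + 2 := by
    refine (Finset.card_insert_le _ _).trans ?_
    have := Finset.card_image_le (s := Finset.range (E + 1))
      (f := fun i => ((decode i : Option α).elim 0 y))
    rw [Finset.card_range] at this
    omega
  have hmem : ∀ o : Option α, SmallOption E o → o.elim 0 y ∈ S := by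
    rintro (_ | x) ho
    · exact Finset.mem_insert_self _ _
    · refine Finset.mem_insert_of_mem (Finset.mem_image.2 ⟨encode x, ?_, by simp [encodek]⟩)
      have := ho x rfl
      rw [Finset.mem_range]; omega
  obtain ⟨f, h0, hb, hf⟩ := exists_compression S (2 * E)
  have helim : ∀ o : Option α, f (o.elim 0 y) = o.elim 0 fun x => f (y x) := by
    rintro (_ | x)
    · exact h0
    · rfl
  refine ⟨f, fun x => (hb x).trans ?_, fun x hx hpos => ?_, fun o o' ho ho' c hc => ?_⟩
  · exact_mod_cast Nat.mul_le_mul_right _ hS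
  · have := (hf 0 (Finset.mem_insert_self _ _) (y x) (hmem (some x) (by rintro _ ⟨⟩; exact hx)) 0
      (by simp)).1 (by simpa using hpos)
    simpa [h0] using this
  · rw [← helim, ← helim]
    exact hf _ (hmem o ho) _ (hmem o' ho') c hc

/-- The list of the values of the symbols with code at most `E`. -/
theorem exists_valueList {α β : Type} [Encodable α] (E : ℕ) (y : α → β) (b : β) :
    ∃ l : List β, l.length = E + 1 ∧ (∀ v ∈ l, v = b ∨ ∃ x, encode x ≤ E ∧ v = y x) ∧
      ∀ x, encode x ≤ E → l.getD (encode x) b = y x := by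
  -- `decode₂` succeeds only at genuine codes, so every other entry is the default `b`.
  refine ⟨(List.range (E + 1)).map fun i => (decode₂ α i).elim b y, by simp, ?_, ?_⟩
  · intro v hv
    simp only [List.mem_map, List.mem_range] at hv
    obtain ⟨i, hi, rfl⟩ := hv
    rcases h : decode₂ α i with _ | x
    · exact Or.inl rfl
    · refine Or.inr ⟨x, ?_, rfl⟩
      have := decode₂_eq_some.1 h
      omega
  · intro x hx
    rw [List.getD_eq_getElem?_getD]
    simp [show encode x < E + 1 by omega, decode₂_encode]

/-! ### Deciding abstracted matrices -/

/-- The three entries are the verdicts for "less", "equal" and "greater". -/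
def cmpTable : Cmp → Bool × Bool × Bool
  | .eq => (false, true, false)
  | .ne => (true, false, true)
  | .le => (true, true, false)
  | .lt => (true, false, false)
  | .ge => (false, true, true)
  | .gt => (false, false, true)

def cmpBool (c : Cmp) (x y : ℤ) : Bool :=
  ((cmpTable c).1 && decide (x < y)) ||
    (((cmpTable c).2.1 && decide (x = y)) || ((cmpTable c).2.2 && decide (y < x)))

theorem cmpBool_iff (c : Cmp) (x y : ℤ) : cmpBool c x y = true ↔ c.eval x y := by
  cases c <;> simp [cmpBool, cmpTable, Cmp.eval] <;> omega

def atomBool (z : IVar → ℤ) (d : Read → ℤ) (A : NAtom) : Bool :=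
  A.elim (fun p => cmpBool p.1 (idxVal z p.2.1) (idxVal z p.2.2))
    fun p => cmpBool p.1 (datVal d p.2.1) (datVal d p.2.2)

theorem atomBool_iff (z : IVar → ℤ) (d : Read → ℤ) (A : NAtom) :
    atomBool z d A = true ↔ atomHolds z d A := by
  cases A <;> simp [atomBool, atomHolds, cmpBool_iff]

/-- Values given by a list, through the codes. -/
def codeEnv {α β : Type} [Encodable α] (b : β) (l : List β) (x : α) : β := l.getD (encode x) b

/-- The values of the data variables and reads in `D` are consistent. -/
def consistentBool (E : ℕ) (z : IVar → ℤ) (D : List ℤ) : Bool :=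
  ((List.range (E + 1)).filterMap (fun i => (decode i : Option Read))).all fun r =>
    ((List.range (E + 1)).filterMap (fun i => (decode i : Option Read))).all fun s =>
      !decide (encode r ≤ E) || (!decide (encode s ≤ E) ||
        (!decide (readCell z r = readCell z s) ||
          decide (codeEnv 0 D r = codeEnv 0 D s)))

theorem consistentBool_iff (E : ℕ) (z : IVar → ℤ) (D : List ℤ) :
    consistentBool E z D = true ↔ ∀ r s : Read, encode r ≤ E → encode s ≤ E →
      readCell z r = readCell z s → codeEnv 0 D r = codeEnv 0 D s := by
  have hmem : ∀ r : Read, encode r ≤ E →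
      r ∈ (List.range (E + 1)).filterMap (fun i => (decode i : Option Read)) := by
    intro r hr
    rw [List.mem_filterMap]
    exact ⟨encode r, by rw [List.mem_range]; omega, encodek r⟩
  simp only [consistentBool, List.all_eq_true, Bool.or_eq_true, Bool.not_eq_true',
    decide_eq_false_iff_not, decide_eq_true_eq]
  constructor
  · intro h r s hr hs he
    have := h r (hmem r hr) s (hmem s hs)
    tauto
  · intro h r _ s _
    have := h r s
    tauto

/-- The integers of absolute value at most `B`. -/
def intRange (B : ℕ) : List ℤ := (List.range (2 * B + 1)).map fun n : ℕ => (n : ℤ) - B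

theorem mem_intRange {B : ℕ} {x : ℤ} : x ∈ intRange B ↔ |x| ≤ B := by
  simp only [intRange, List.mem_map, List.mem_range, abs_le]
  constructor
  · rintro ⟨n, hn, rfl⟩; omega
  · intro h; exact ⟨(x + B).toNat, by omega, by omega⟩

/-- A bound for the codes of everything that occurs in an abstracted matrix. -/
def matrixCode (preds : List NAtom) (M : List (List NAtom)) : ℕ :=
  encode (M.flatten ++ M.flatMap (fun c => (constrTerms preds c).flatMap fun t =>
    preds.map fun Q => bindAtom (instFun t) Q)) + encode (M.flatMap (constrTerms preds)) +
    preds.length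

theorem encode_le_matrixCode {preds : List NAtom} {M : List (List NAtom)} {c : List NAtom}
    (hc : c ∈ M) : (∀ A ∈ c, encode A ≤ matrixCode preds M) ∧
      ∀ t ∈ constrTerms preds c, encode t ≤ matrixCode preds M ∧
        ∀ Q ∈ preds, encode (bindAtom (instFun t) Q) ≤ matrixCode preds M := by
  have h1 : ∀ A, A ∈ c ∨ (∃ t ∈ constrTerms preds c, ∃ Q ∈ preds, bindAtom (instFun t) Q = A) →
      encode A ≤ matrixCode preds M := by
    intro A hA
    have : A ∈ M.flatten ++ M.flatMap (fun c => (constrTerms preds c).flatMap fun t =>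
        preds.map fun Q => bindAtom (instFun t) Q) := by
      rw [List.mem_append, List.mem_flatten, List.mem_flatMap]
      refine hA.imp (fun h => ⟨c, hc, h⟩) ?_
      rintro ⟨t, ht, Q, hQ, rfl⟩
      exact ⟨c, hc, List.mem_flatMap.2 ⟨t, ht, List.mem_map.2 ⟨Q, hQ, rfl⟩⟩⟩
    have := encode_le_of_mem this
    rw [matrixCode]
    omega
  refine ⟨fun A hA => h1 A (Or.inl hA), fun t ht => ⟨?_, fun Q hQ =>
    h1 _ (Or.inr ⟨t, ht, Q, hQ, rfl⟩)⟩⟩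
  have : t ∈ M.flatMap (constrTerms preds) := List.mem_flatMap.2 ⟨c, hc, ht⟩
  have := encode_le_of_mem this
  rw [matrixCode]
  omega

def boundedBeq (i : ℤ) (len : ℕ) (a b : Bool) : Bool :=
  !decide (1 ≤ i) || (!decide (i ≤ len) || (a == b))

def termsBool (preds c : List NAtom) (z : IVar → ℤ) (len : ℕ) (bit : ℕ → ℤ → Bool)
    (y : IVar → ℤ) (d : Read → ℤ) : Bool :=
  (constrTerms preds c).all fun t => (List.range preds.length).all fun k =>
    (preds[k]?).elim true fun Q =>
      boundedBeq (idxVal z t) len (bit k (idxVal z t)) (atomBool y d (bindAtom (instFun t) Q))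

/-- The lists `Y` and `D` of values give a model of a disjunct. -/
def modelBool (E : ℕ) (preds c : List NAtom) (z : IVar → ℤ) (len : ℕ) (bit : ℕ → ℤ → Bool)
    (Y : List ℕ) (D : List ℤ) : Bool :=
  consistentBool E (fun x => (codeEnv 0 Y x : ℕ)) D &&
    ((c.all fun A => !isDataAtom A || atomBool (fun x => (codeEnv 0 Y x : ℕ)) (codeEnv 0 D) A) &&
      termsBool preds c z len bit (fun x => (codeEnv 0 Y x : ℕ)) (codeEnv 0 D))

def matrixBool (preds : List NAtom) (M : List (List NAtom)) (z : IVar → ℤ) (len : ℕ)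
    (bit : ℕ → ℤ → Bool) : Bool :=
  M.any fun c => (c.all fun A => isDataAtom A || atomBool z (fun _ => 0) A) &&
    (words (List.range (modelBound (matrixCode preds M) + 1)) (matrixCode preds M + 1)).any fun Y =>
      (words (intRange (modelBound (matrixCode preds M))) (matrixCode preds M + 1)).any fun D =>
        modelBool (matrixCode preds M) preds c z len bit Y D

/-- The search ranges over values of reads instead of values of cells, because only finitely many
reads have a small code. Consistency makes the two views interchangeable. -/
theorem matrixBool_iff (preds : List NAtom) (M : List (List NAtom)) (z : IVar → ℤ) (len : ℕ)
    (bit : ℕ → ℤ → Bool) :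
    matrixBool preds M z len bit = true ↔
      absMatrix preds M z len fun k i => bit k i = true := by
  classical
  set E := matrixCode preds M with hE
  have hlist : ∀ (p : ℕ → NAtom → Prop), (∀ k < preds.length, ∀ Q, preds[k]? = some Q → p k Q) ↔
      ∀ k Q, preds[k]? = some Q → p k Q := by
    intro p
    refine ⟨fun h k Q hQ => h k ?_ Q hQ, fun h k _ Q hQ => h k Q hQ⟩
    exact (List.getElem?_eq_some_iff.1 hQ).1
  have hterm : ∀ (c : List NAtom) (y : IVar → ℤ) (d : Read → ℤ),
      termsBool preds c z len bit y d = true ↔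
      ∀ t ∈ constrTerms preds c, ∀ k Q, preds[k]? = some Q →
        1 ≤ idxVal z t → idxVal z t ≤ len →
          (bit k (idxVal z t) = true ↔ atomHolds y d (bindAtom (instFun t) Q)) := by
    intro c y d
    simp only [termsBool, boundedBeq, List.all_eq_true, List.mem_range]
    refine forall_congr' fun t => forall_congr' fun _ => ?_
    rw [← hlist]
    refine forall_congr' fun k => forall_congr' fun hk => ?_
    rcases h : preds[k]? with _ | Q
    · simp
    · have hbeq : (bit k (idxVal z t) == atomBool y d (bindAtom (instFun t) Q)) = true ↔
          (bit k (idxVal z t) = true ↔ atomHolds y d (bindAtom (instFun t) Q)) := by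
        rw [← atomBool_iff, beq_iff_eq, Bool.eq_iff_iff]
      simp only [Option.elim_some, Bool.or_eq_true, Bool.not_eq_true', decide_eq_false_iff_not,
        hbeq, Option.some.injEq, forall_eq']
      tauto
  simp only [matrixBool, modelBool, List.any_eq_true, Bool.and_eq_true, hterm, consistentBool_iff, ← hE,
    absMatrix]
  refine exists_congr fun c => and_congr_right fun hc => and_congr ?_ ?_
  · simp only [List.all_eq_true, Bool.or_eq_true, atomBool_iff]
    refine forall_congr' fun A => forall_congr' fun _ => ?_
    cases isDataAtom A <;> simp
  obtain ⟨hcA, hcT⟩ := encode_le_matrixCode (preds := preds) hc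
  rw [← hE] at hcA hcT
  have hall : ∀ (y : IVar → ℤ) (d : Read → ℤ), (c.all fun A => !isDataAtom A ||
      atomBool y d A) = true ↔ ∀ A ∈ c, isDataAtom A = true → atomHolds y d A := by
    intro y d
    simp only [List.all_eq_true, Bool.or_eq_true, atomBool_iff]
    refine forall_congr' fun A => forall_congr' fun _ => ?_
    cases isDataAtom A <;> simp
  simp only [hall]
  -- transfer between interpretations with the same differences
  have htrans : ∀ (y y' : IVar → ℤ) (d d' : Read → ℤ), SameDiffs E y y' → SameDiffs E d d' →
      ((∀ A ∈ c, isDataAtom A = true → atomHolds y d A) ∧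
        ∀ t ∈ constrTerms preds c, ∀ k Q, preds[k]? = some Q →
        1 ≤ idxVal z t → idxVal z t ≤ len →
          (bit k (idxVal z t) = true ↔ atomHolds y d (bindAtom (instFun t) Q))) →
      ((∀ A ∈ c, isDataAtom A = true → atomHolds y' d' A) ∧
        ∀ t ∈ constrTerms preds c, ∀ k Q, preds[k]? = some Q →
        1 ≤ idxVal z t → idxVal z t ≤ len →
          (bit k (idxVal z t) = true ↔ atomHolds y' d' (bindAtom (instFun t) Q))) := by
    intro y y' d d' hy hd h
    refine ⟨fun A hA hAd => (atomHolds_congr hy hd (hcA A hA)).1 (h.1 A hA hAd),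
      fun t ht k Q hQ h1 h2 => ?_⟩
    rw [← atomHolds_congr hy hd ((hcT t ht).2 Q (List.mem_of_getElem? hQ))]
    exact h.2 t ht k Q hQ h1 h2
  constructor
  · rintro ⟨Y, -, D, -, hcons, h⟩
    -- A cell takes the value of any small read that denotes it, and `0` if there is none;
    -- consistency makes the choice immaterial.
    let val : Cell → ℤ := fun x =>
      if hx : ∃ r : Read, encode r ≤ E ∧ readCell (fun x => (codeEnv 0 Y x : ℕ)) r = x then
        codeEnv 0 D hx.choose else 0
    refine ⟨codeEnv 0 Y, val, htrans _ _ _ _ (.of_eq fun _ _ => rfl) (.of_eq fun r hr => ?_) h⟩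
    have hx : ∃ s : Read, encode s ≤ E ∧ readCell (fun x => (codeEnv 0 Y x : ℕ)) s =
        readCell (fun x => (codeEnv 0 Y x : ℕ)) r := ⟨r, hr, rfl⟩
    simp only [val, dif_pos hx]
    exact hcons _ _ hr hx.choose_spec.1 hx.choose_spec.2.symm
  · rintro ⟨y, val, h⟩
    -- Index values and data values are compressed independently, since no atom compares them with
    -- each other. Compression of the indices preserves aliasing, so the compressed data remain
    -- consistent.
    obtain ⟨f, hf1, hf2, hf3⟩ := exists_small_values E fun x => (y x : ℤ)
    obtain ⟨g, hg1, -, hg3⟩ := exists_small_values E fun r => val (readCell (fun x => y x) r)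
    obtain ⟨Y, hY1, hY2, hY3⟩ := exists_valueList E (fun x => (f (y x)).toNat) 0
    obtain ⟨D, hD1, hD2, hD3⟩ := exists_valueList E
      (fun r => g (val (readCell (fun x => y x) r))) 0
    have hy : SameDiffs E (fun x => (y x : ℤ)) fun x => (codeEnv 0 Y x : ℕ) := by
      intro o o' ho ho' c hc
      rw [hf3 o o' ho ho' c hc]
      have := SameDiffs.of_eq (E := E) (y := fun x => f (y x))
        (y' := fun x => (codeEnv 0 Y x : ℕ)) fun x hx => by
          rw [codeEnv, hY3 x hx]
          -- Compression keeps index values nonnegative, so `toNat` loses nothing.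
          have := hf2 x hx (by positivity)
          omega
      exact this o o' ho ho' c hc
    have hd : SameDiffs E (fun r => val (readCell (fun x => y x) r)) (codeEnv 0 D) := by
      intro o o' ho ho' c hc
      rw [hg3 o o' ho ho' c hc]
      exact (SameDiffs.of_eq fun r hr => (hD3 r hr).symm) o o' ho ho' c hc
    refine ⟨Y, mem_words.2 ⟨hY1, fun v hv => ?_⟩, D, mem_words.2 ⟨hD1, fun v hv => ?_⟩, ?_,
      htrans _ _ _ _ hy hd h⟩
    · rw [List.mem_range]
      rcases hY2 v hv with rfl | ⟨x, hx, rfl⟩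
      · omega
      · have := hf1 (y x)
        rw [abs_le] at this
        omega
    · rw [mem_intRange]
      rcases hD2 v hv with rfl | ⟨x, hx, rfl⟩
      · simp
      · exact hg1 _
    · intro r s hr hs hrs
      rw [← readCell_congr hy hr hs] at hrs
      rw [codeEnv, codeEnv, hD3 r hr, hD3 s hs, hrs]

end ArrayAbs

namespace ArrayAbs

open Encodable

/-! ## Abstracted matrices are recognizable -/

/-- Values of variables: bound variables are read from `e`, the others from `ν`. -/
def mixVal (ν : Option IVar → ℕ) (e : ℕ → ℕ) : IVar → ℕ
  | .bnd k => e k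
  | x => ν (some x)

/-- An abstracted matrix as a predicate on numbers and words; `ν none` is the length of the word. -/
def matrixPred (preds : List NAtom) (M : List (List NAtom)) : NumPred (Option IVar) :=
  fun ν W e => absMatrix preds M (fun x => mixVal ν e x) (ν none)
    fun k i => 1 ≤ i ∧ W k (i - 1).toNat = true

theorem tracked_leaf (o : Option IVar) :
    Tracked fun ν e => o.elim 0 (mixVal ν e) := by
  rcases o with _ | _ | _ | k
  · exact tracked_zero
  · exact tracked_free _
  · exact tracked_free _
  · exact tracked_bound k

theorem idxVal_mixVal (ν : Option IVar → ℕ) (e : ℕ → ℕ) (t : NIdx) :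
    idxVal (fun x => mixVal ν e x) t = ((t.1.elim 0 (mixVal ν e) : ℕ) : ℤ) + t.2 := by
  rcases t with ⟨_ | x, n⟩ <;> simp [idxVal]

/-- Objects with code at most `E`. -/
abbrev Small (α : Type) [Encodable α] (E : ℕ) : Type := {a : α // encode a ≤ E}

noncomputable instance (α : Type) [Encodable α] (E : ℕ) : Fintype (Small α E) :=
  Fintype.ofInjective (fun a : Small α E => (⟨encode a.1, Nat.lt_succ_iff.2 a.2⟩ : Fin (E + 1)))
    fun a b h => Subtype.ext (encode_injective (by simpa using h))

theorem card_small_le (α : Type) [Encodable α] (E : ℕ) : Fintype.card (Small α E) ≤ E + 1 := by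
  have := Fintype.card_le_of_injective
    (fun a : Small α E => (⟨encode a.1, Nat.lt_succ_iff.2 a.2⟩ : Fin (E + 1)))
    fun a b h => Subtype.ext (encode_injective (by simpa using h))
  simpa using this

/-- A bound for the number of states for atomic predicates. -/
def atomStates (E : ℕ) : ℕ := 4 ^ ((2 * (2 * E + 2) + 2) ^ 4)

/-- A bound for the number of states for abstracted matrices. -/
def matrixStates (E : ℕ) : ℕ := atomStates E ^ (4 * (E + 1) ^ 3)

theorem le_atomStates {E K : ℕ} (hK : K ≤ 2 * E + 2) : 2 * K + 1 ≤ atomStates E := by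
  rw [atomStates]
  calc 2 * K + 1 ≤ (2 * (2 * E + 2) + 2) ^ 1 := by rw [pow_one]; omega
    _ ≤ (2 * (2 * E + 2) + 2) ^ 4 := Nat.pow_le_pow_right (by omega) (by norm_num)
    _ ≤ _ := (Nat.lt_pow_self (by norm_num)).le

/-- The atomic predicates of which an abstracted matrix is a Boolean combination. -/
def basePred (E : ℕ) (i : Small NIdx E × Small NIdx E × Fin (E + 1) × Fin 4) :
    NumPred (Option IVar) := fun ν W e =>
  match i.2.2.2 with
  | 0 => idxVal (fun x => mixVal ν e x) i.1.1 ≤ idxVal (fun x => mixVal ν e x) i.2.1.1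
  | 1 => 1 ≤ idxVal (fun x => mixVal ν e x) i.1.1
  | 2 => idxVal (fun x => mixVal ν e x) i.1.1 ≤ ν none
  | 3 => 1 ≤ idxVal (fun x => mixVal ν e x) i.1.1 ∧
      W i.2.2.1 (idxVal (fun x => mixVal ν e x) i.1.1 - 1).toNat = true

/-- The offsets involved are differences of two numbers of size at most `E`, or `1 - t.2`; all are
smaller than `2 * E + 2` in absolute value. -/
theorem recognizable_basePred (E : ℕ) (i : Small NIdx E × Small NIdx E × Fin (E + 1) × Fin 4) :
    Recognizable (atomStates E) (basePred E i) := by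
  obtain ⟨⟨t, ht⟩, ⟨u, hu⟩, k, j⟩ := i
  have h1 := (small_of_encode_le ht).2
  have h2 := (small_of_encode_le hu).2
  rw [abs_le] at h1 h2
  have hb := le_atomStates (E := E) (K := 2 * E + 2) le_rfl
  fin_cases j
  · have := (recognizable_diff (tracked_leaf t.1) (tracked_leaf u.1) (c := t.2 - u.2)
      (K := 2 * E + 2) (by rw [abs_lt]; push_cast; omega)).mono hb
    refine cast (congrArg _ ?_) this
    funext ν W e
    simp only [basePred, idxVal_mixVal, eq_iff_iff]
    omega
  · have := (recognizable_diff tracked_zero (tracked_leaf t.1) (c := 1 - t.2)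
      (K := 2 * E + 2) (by rw [abs_lt]; push_cast; omega)).mono hb
    refine cast (congrArg _ ?_) this
    funext ν W e
    simp only [basePred, idxVal_mixVal, eq_iff_iff]
    omega
  · have := (recognizable_diff (tracked_leaf t.1) (tracked_free none) (c := t.2)
      (K := 2 * E + 2) (by rw [abs_lt]; push_cast; omega)).mono hb
    refine cast (congrArg _ ?_) this
    funext ν W e
    simp only [basePred, idxVal_mixVal]
  · have := recognizable_shifted_bit (tracked_leaf t.1) (c := t.2)
      (K := 2 * E + 2) (by rw [abs_lt]; push_cast; omega) k
    refine cast (congrArg _ ?_) this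
    funext ν W e
    simp only [basePred, idxVal_mixVal]

theorem recognizable_matrixPred (preds : List NAtom) (M : List (List NAtom)) :
    Recognizable (matrixStates (matrixCode preds M)) (matrixPred preds M) := by
  set E := matrixCode preds M with hE
  refine (Recognizable.of_determined (recognizable_basePred E) (q := matrixPred preds M) ?_).mono ?_
  · intro ν W e ν' W' e' h
    have hle : ∀ t u : NIdx, encode t ≤ E → encode u ≤ E →
        (idxVal (fun x => mixVal ν e x) t ≤ idxVal (fun x => mixVal ν e x) u ↔
          idxVal (fun x => mixVal ν' e' x) t ≤ idxVal (fun x => mixVal ν' e' x) u) :=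
      fun t u ht hu => h ⟨⟨t, ht⟩, ⟨u, hu⟩, 0, 0⟩
    have hone : ∀ t : NIdx, encode t ≤ E →
        (1 ≤ idxVal (fun x => mixVal ν e x) t ↔ 1 ≤ idxVal (fun x => mixVal ν' e' x) t) :=
      fun t ht => h ⟨⟨t, ht⟩, ⟨t, ht⟩, 0, 1⟩
    have hlen : ∀ t : NIdx, encode t ≤ E →
        (idxVal (fun x => mixVal ν e x) t ≤ ν none ↔
          idxVal (fun x => mixVal ν' e' x) t ≤ ν' none) :=
      fun t ht => h ⟨⟨t, ht⟩, ⟨t, ht⟩, 0, 2⟩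
    have hbit : ∀ (t : NIdx) (k : ℕ), encode t ≤ E → k ≤ E →
        ((1 ≤ idxVal (fun x => mixVal ν e x) t ∧
            W k (idxVal (fun x => mixVal ν e x) t - 1).toNat = true) ↔
          (1 ≤ idxVal (fun x => mixVal ν' e' x) t ∧
            W' k (idxVal (fun x => mixVal ν' e' x) t - 1).toNat = true)) :=
      fun t k ht hk => h ⟨⟨t, ht⟩, ⟨t, ht⟩, ⟨k, Nat.lt_succ_iff.2 hk⟩, 3⟩
    rintro ⟨c, hc, hidx, y, D, hdat, hterm⟩
    obtain ⟨hcA, hcT⟩ := encode_le_matrixCode (preds := preds) hc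
    rw [← hE] at hcA hcT
    refine ⟨c, hc, fun A hA hAd => ?_, y, D, hdat, fun t ht k Q hQ h1 h2 => ?_⟩
    · have := hidx A hA hAd
      rcases A with ⟨r, I, J⟩ | A
      · obtain ⟨-, h3⟩ := encode_le_of_pair (encode_le_of_inl (hcA _ hA))
        obtain ⟨h4, h5⟩ := encode_le_of_pair h3
        exact (Cmp.eval_congr (hle I J h4 h5) (hle J I h5 h4) r).1 this
      · simp [isDataAtom] at hAd
    · have het := (hcT t ht).1
      have hk : k ≤ E := by
        have := (List.getElem?_eq_some_iff.1 hQ).1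
        rw [hE, matrixCode]
        omega
      rw [← hterm t ht k Q hQ ((hone t het).2 h1) ((hlen t het).2 h2)]
      exact (hbit t k het hk).symm
  · refine Nat.pow_le_pow_right (Nat.pow_pos (by norm_num)) ?_
    rw [Fintype.card_prod, Fintype.card_prod, Fintype.card_prod, Fintype.card_fin,
      Fintype.card_fin]
    have h := card_small_le NIdx E
    calc _ ≤ (E + 1) * ((E + 1) * ((E + 1) * 4)) :=
          Nat.mul_le_mul h (Nat.mul_le_mul h le_rfl)
      _ = _ := by ring

end ArrayAbs

namespace ArrayAbs

open Encodable

/-! ## Words of columns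

Letters consist of the bits of `p` parameters, of `d` index variables and of `m` predicates. For
transitions, the letters of a second state follow from position `off` on; for states, `off` is `0`
and the second state is the first one. -/

def bitAt (a : List Bool) (j : ℕ) : Bool := a.getD j false

/-- The position of the first letter without the property `f`. -/
def prefixLength (f : List Bool → Bool) (w : List (List Bool)) : ℕ := w.findIdx fun a => !f a

/-- The number written in unary in row `j`. -/
def rowValue (w : List (List Bool)) (j : ℕ) : ℕ := prefixLength (fun a => bitAt a j) w

/-- Serves as a unary row for the length of the predicate word, which is the largest parameter
value. -/
def hasParBit (p : ℕ) (a : List Bool) : Bool := (List.range p).any fun j => bitAt a j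

/-- Besides the letter length: some number is still running, which excludes trailing padding; the
parameters of both halves agree; and predicate bits vanish once all parameters have ended, since the
predicate word is over by then. -/
def letterOk (p d m off : ℕ) (a : List Bool) : Bool :=
  decide (a.length = p + d + m + off) &&
  (((List.range (p + d)).any fun j => bitAt a j || bitAt a (off + j)) &&
  (((List.range p).all fun j => bitAt a j == bitAt a (off + j)) &&
  (hasParBit p a ||
    (List.range m).all fun k => !bitAt a (p + d + k) && !bitAt a (off + (p + d + k)))))

/-- A row of a number may not restart after it has ended, so it is a unary numeral. -/
def stepOk (p d off : ℕ) (a b : List Bool) : Bool :=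
  (List.range (p + d)).all fun j =>
    (!bitAt b j || bitAt a j) && (!bitAt b (off + j) || bitAt a (off + j))

/-- The word represents a state (or a pair of states with equal parameters). -/
def validWord (p d m off : ℕ) (w : List (List Bool)) : Bool :=
  (List.range w.length).all fun i =>
    letterOk p d m off (w.getD i []) && stepOk p d off (w.getD i []) (w.getD (i + 1) [])

def rowOf (off : ℕ) (b : Bool) (x : ℕ) : ℕ := bif b then off + x else x

def wordVal (p d off : ℕ) (w : List (List Bool)) : Option IVar → ℕ
  | none => prefixLength (hasParBit p) w
  | some (.par b x) => bif decide (x < p) then rowValue w (rowOf off b x) else 0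
  | some (.idx b x) => bif decide (x < d) then rowValue w (rowOf off b (p + x)) else 0
  | some (.bnd _) => 0

/-- Predicates below `m` are read in the first half, the primed ones in the second. For states `n =
m`, and the second case yields `false`. -/
def letterBit (p d m n off : ℕ) (a : List Bool) (k : ℕ) : Bool :=
  bif decide (k < m) then bitAt a (p + d + k)
  else decide (k < n) && bitAt a (off + (p + d + (k - m)))

def wordBit (p d m n off : ℕ) (w : List (List Bool)) (k i : ℕ) : Bool :=
  letterBit p d m n off (w.getD i []) k

theorem lt_prefixLength_iff {f : List Bool → Bool} {w : List (List Bool)} (h0 : f [] = false)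
    (h : ∀ i < w.length, f (w.getD (i + 1) []) = true → f (w.getD i []) = true) (i : ℕ) :
    i < prefixLength f w ↔ f (w.getD i []) = true := by
  constructor
  · intro hi
    have hl : i < w.length := hi.trans_le List.findIdx_le_length
    have := List.not_of_lt_findIdx hi
    rw [List.getD_eq_getElem _ _ hl]
    simpa using this
  · intro hi
    have hl : i < w.length := by
      by_contra hcon
      rw [List.getD_eq_default _ _ (not_lt.1 hcon), h0] at hi
      exact absurd hi (by simp)
    have hall : ∀ j ≤ i, f (w.getD j []) = true := by
      intro j hj
      induction i with
      | zero => rw [Nat.le_zero.1 hj]; exact hi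
      | succ i ih =>
        rcases Nat.le_succ_iff.1 hj with hj | rfl
        · exact ih (h i (by omega) hi) (by omega) hj
        · exact hi
    refine List.lt_findIdx_of_not hl fun j hj => ?_
    have := hall j hj
    rw [List.getD_eq_getElem _ _ (by omega)] at this
    simp [this]

theorem prefixLength_le (f : List Bool → Bool) (w : List (List Bool)) :
    prefixLength f w ≤ w.length := List.findIdx_le_length

theorem bitAt_nil (j : ℕ) : bitAt [] j = false := by simp [bitAt]

theorem hasParBit_nil (p : ℕ) : hasParBit p [] = false := by simp [hasParBit, bitAt_nil]

theorem hasParBit_iff {p : ℕ} {a : List Bool} :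
    hasParBit p a = true ↔ ∃ j < p, bitAt a j = true := by simp [hasParBit]

theorem letterOk_iff {p d m off : ℕ} {a : List Bool} :
    letterOk p d m off a = true ↔ a.length = p + d + m + off ∧
      (∃ j < p + d, bitAt a j = true ∨ bitAt a (off + j) = true) ∧
      (∀ j < p, bitAt a j = bitAt a (off + j)) ∧
      (hasParBit p a = true ∨ ∀ k < m, bitAt a (p + d + k) = false ∧
        bitAt a (off + (p + d + k)) = false) := by
  simp [letterOk]

theorem stepOk_iff {p d off : ℕ} {a b : List Bool} :
    stepOk p d off a b = true ↔ ∀ j < p + d, (bitAt b j = true → bitAt a j = true) ∧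
      (bitAt b (off + j) = true → bitAt a (off + j) = true) := by
  simp only [stepOk, List.all_eq_true, List.mem_range, Bool.and_eq_true, Bool.or_eq_true,
    Bool.not_eq_true']
  refine forall_congr' fun j => forall_congr' fun _ => ?_
  cases bitAt b j <;> cases bitAt b (off + j) <;> simp

theorem validWord_iff {p d m off : ℕ} {w : List (List Bool)} :
    validWord p d m off w = true ↔ ∀ i < w.length, letterOk p d m off (w.getD i []) = true ∧
      stepOk p d off (w.getD i []) (w.getD (i + 1) []) = true := by
  simp only [validWord, List.all_eq_true, List.mem_range, Bool.and_eq_true]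

theorem lt_rowValue_iff {p d m off : ℕ} {w : List (List Bool)} (h : validWord p d m off w = true)
    {j : ℕ} (hj : j < p + d) (i : ℕ) :
    (i < rowValue w j ↔ bitAt (w.getD i []) j = true) ∧
      (i < rowValue w (off + j) ↔ bitAt (w.getD i []) (off + j) = true) := by
  rw [validWord_iff] at h
  exact ⟨lt_prefixLength_iff (bitAt_nil _) (fun i hi => (stepOk_iff.1 (h i hi).2 j hj).1) i,
    lt_prefixLength_iff (bitAt_nil _) (fun i hi => (stepOk_iff.1 (h i hi).2 j hj).2) i⟩

theorem lt_parLength_iff {p d m off : ℕ} {w : List (List Bool)}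
    (h : validWord p d m off w = true) (i : ℕ) :
    i < prefixLength (hasParBit p) w ↔ hasParBit p (w.getD i []) = true := by
  rw [validWord_iff] at h
  refine lt_prefixLength_iff (hasParBit_nil _) (fun i hi => ?_) i
  simp only [hasParBit_iff]
  rintro ⟨j, hj, hb⟩
  exact ⟨j, hj, (stepOk_iff.1 (h i hi).2 j (by omega)).1 hb⟩

theorem paddedFrom_word (p d m n off : ℕ) (w : List (List Bool)) :
    PaddedFrom (wordVal p d off w) (wordBit p d m n off w) (fun _ => 0) w.length := by
  refine ⟨fun x => ?_, fun k i hi => ?_, fun _ => Nat.zero_le _⟩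
  · rcases x with _ | b | b | k
    · exact prefixLength_le _ _
    · simp only [wordVal, Bool.cond_decide]
      split_ifs
      exacts [prefixLength_le _ _, Nat.zero_le _]
    · simp only [wordVal, Bool.cond_decide]
      split_ifs
      exacts [prefixLength_le _ _, Nat.zero_le _]
    · exact Nat.zero_le _
  · rw [wordBit, List.getD_eq_default _ _ hi]
    simp [letterBit, bitAt_nil]

/-- The column represented by a letter. -/
def letterColumn (p d m n off : ℕ) (a : List Bool) : Column (Option IVar) :=
  (fun x => match x with
    | none => hasParBit p a
    | some (.par b x) => decide (x < p) && bitAt a (rowOf off b x)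
    | some (.idx b x) => decide (x < d) && bitAt a (rowOf off b (p + x))
    | some (.bnd _) => false,
  letterBit p d m n off a, fun _ => false)

/-- On valid words a column depends only on the letter at its position, so an automaton reading
columns can be run on letters. -/
theorem column_word {p d m n off : ℕ} {w : List (List Bool)} (h : validWord p d m off w = true)
    (i : ℕ) :
    column (wordVal p d off w) (wordBit p d m n off w) (fun _ => 0) i =
      letterColumn p d m n off (w.getD i []) := by
  simp only [column, letterColumn, Prod.mk.injEq]
  refine ⟨funext fun x => ?_, rfl, by simp⟩
  have hrow : ∀ b j, j < p + d →
      decide (i < rowValue w (rowOf off b j)) = bitAt (w.getD i []) (rowOf off b j) := by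
    intro b j hj
    rw [Bool.eq_iff_iff, decide_eq_true_eq]
    cases b
    · exact (lt_rowValue_iff h hj i).1
    · exact (lt_rowValue_iff h hj i).2
  rcases x with _ | ⟨b, x⟩ | ⟨b, x⟩ | k
  · rw [Bool.eq_iff_iff, decide_eq_true_eq]
    exact lt_parLength_iff h i
  · by_cases hx : x < p
    · simp only [wordVal, hx, decide_true, cond_true, Bool.true_and]
      exact hrow b x (by omega)
    · simp [wordVal, hx]
  · by_cases hx : x < d
    · simp only [wordVal, hx, decide_true, cond_true, Bool.true_and]
      exact hrow b (p + x) (by omega)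
    · simp [wordVal, hx]
  · simp [wordVal]

theorem runSeq_eq_foldl {Q A B : Type} (step : Q → A → Q) (q₀ : Q) (a : ℕ → A) (g : B → A)
    (b : B) (w : List B) (h : ∀ i < w.length, a i = g (w.getD i b)) :
    runSeq step q₀ a w.length = w.foldl (fun q x => step q (g x)) q₀ := by
  induction w using List.reverseRecOn with
  | nil => rfl
  | append_singleton w x ih =>
    have h1 := h w.length (by simp)
    rw [List.getD_append_right _ _ _ _ le_rfl] at h1
    rw [List.length_append, List.length_singleton, runSeq, ih, h1]
    · simp
    · intro i hi
      rw [h i (by simp; omega), List.getD_append _ _ _ _ hi]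

/-- The last letter; for the empty word, a letter that admits every successor. -/
def lastLetter (R : ℕ) (w : List (List Bool)) : List Bool :=
  w.getLast?.getD (List.replicate R true)

/-- Validity can be checked online with the last letter as memory; this makes validity together with
that letter a right congruence. -/
theorem validWord_append {p d m off : ℕ} (w : List (List Bool)) (a : List Bool) :
    validWord p d m off (w ++ [a]) = true ↔ validWord p d m off w = true ∧
      letterOk p d m off a = true ∧ stepOk p d off (lastLetter (p + d + m + off) w) a = true := by
  have hnil : ∀ b, stepOk p d off b [] = true := by
    intro b; rw [stepOk_iff]; simp [bitAt_nil]
  simp only [validWord_iff, List.length_append, List.length_singleton]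
  have hlast : (w ++ [a]).getD w.length [] = a := by
    rw [List.getD_append_right _ _ _ _ le_rfl]; simp
  have hout : (w ++ [a]).getD (w.length + 1) [] = [] :=
    List.getD_eq_default _ _ (by simp)
  have hin : ∀ i < w.length, (w ++ [a]).getD i [] = w.getD i [] :=
    fun i hi => List.getD_append _ _ _ _ hi
  rcases List.eq_nil_or_concat' w with rfl | ⟨v, b, rfl⟩
  · have hst : stepOk p d off (lastLetter (p + d + m + off) []) a = true := by
      rw [stepOk_iff]
      intro j hj
      simp [lastLetter, bitAt, List.getD_eq_getElem?_getD,
        show j < p + d + m + off by omega, show off + j < p + d + m + off by omega]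
    simp [hst, hnil]
  · have hlb : lastLetter (p + d + m + off) (v ++ [b]) = b := by simp [lastLetter]
    rw [hlb]
    have hvl : (v ++ [b]).length = v.length + 1 := by simp
    have hvb : (v ++ [b]).getD v.length [] = b := by
      rw [List.getD_append_right _ _ _ _ le_rfl]; simp
    constructor
    · intro h
      refine ⟨fun i hi => ?_, ?_, ?_⟩
      · have := h i (by omega)
        rw [hin i hi] at this
        refine ⟨this.1, ?_⟩
        by_cases hi' : i + 1 < (v ++ [b]).length
        · rw [hin _ hi'] at this; exact this.2
        · rw [List.getD_eq_default _ _ (not_lt.1 hi')]; exact hnil _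
      · have := h (v ++ [b]).length (by omega)
        rw [hlast] at this
        exact this.1
      · have := (h v.length (by omega)).2
        rw [hin _ (by omega), hvb, ← hvl, hlast] at this
        exact this
    · rintro ⟨h1, h2, h3⟩ i hi
      rcases Nat.lt_succ_iff_lt_or_eq.1 hi with hi | rfl
      · rw [hin i hi]
        refine ⟨(h1 i hi).1, ?_⟩
        by_cases hi' : i + 1 < (v ++ [b]).length
        · rw [hin _ hi']; exact (h1 i hi).2
        · have : i = v.length := by omega
          subst this
          rw [hvb, ← hvl, hlast]
          exact h3
      · rw [hlast, hout]
        exact ⟨h2, hnil _⟩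

theorem stepOk_congr {p d off R : ℕ} (hR : p + d + off ≤ R) {a a' b : List Bool}
    (h : ∀ j < R, bitAt a j = bitAt a' j) : stepOk p d off a b = stepOk p d off a' b := by
  rw [Bool.eq_iff_iff, stepOk_iff, stepOk_iff]
  refine forall_congr' fun j => forall_congr' fun hj => ?_
  rw [h j (by omega), h (off + j) (by omega)]

/-! ### The automaton of a formula -/

/-- Satisfaction of an abstracted formula by the state (or pair of states) given by a word. -/
def wordSat (p d m off : ℕ) (preds : List NAtom) (φ : NPrenex) (w : List (List Bool)) : Prop :=
  quantSat φ.1 (matrixPred preds φ.2 (wordVal p d off w) (wordBit p d m preds.length off w))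
    fun _ => 0

/-- The language of the words that represent states satisfying an abstracted formula. -/
def wordLang (p d m off : ℕ) (preds : List NAtom) (φ : NPrenex) : Language (List Bool) :=
  {w | validWord p d m off w = true ∧ wordSat p d m off preds φ w}

/-- A bound for the number of states for an abstracted formula. -/
def formulaStates (preds : List NAtom) (φ : NPrenex) : ℕ :=
  tower (matrixStates (matrixCode preds φ.2)) φ.1.length

def wordMatrixBool (p d m off : ℕ) (preds : List NAtom) (M : List (List NAtom))
    (w : List (List Bool)) (e : List ℕ) : Bool :=
  matrixBool preds M (fun x => (mixVal (wordVal p d off w) (listEnv e) x : ℤ))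
    (wordVal p d off w none)
    fun k i => decide (1 ≤ i) && wordBit p d m preds.length off w k (i - 1).toNat

def wordBool (p d m off : ℕ) (preds : List NAtom) (φ : NPrenex) (w : List (List Bool)) : Bool :=
  validWord p d m off w && quantBounded w.length (formulaStates preds φ)
    (wordMatrixBool p d m off preds φ.2 w) φ.1 []

def formulaAutomaton (p d m off : ℕ) (preds : List NAtom) (φ : NPrenex) : Automaton :=
  learnedAutomaton (words [true, false] (p + d + m + off))
    (2 * (2 ^ (p + d + m + off) * formulaStates preds φ)) (wordBool p d m off preds φ)

/-- Both searches are finite: small models decide the matrix, and `formulaStates` bounds the range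
of each quantifier. -/
theorem wordBool_iff (p d m off : ℕ) (preds : List NAtom) (φ : NPrenex) (w : List (List Bool)) :
    wordBool p d m off preds φ w = true ↔ w ∈ wordLang p d m off preds φ := by
  have h : ∀ e, wordMatrixBool p d m off preds φ.2 w e = true ↔
      matrixPred preds φ.2 (wordVal p d off w) (wordBit p d m preds.length off w)
        (listEnv e) := by
    intro e
    rw [wordMatrixBool, matrixBool_iff]
    simp only [matrixPred, Bool.and_eq_true, decide_eq_true_eq]
  have := quantBounded_iff (recognizable_matrixPred preds φ.2) (paddedFrom_word p d m preds.length
    off w) h φ.1 le_rfl [] (by simp)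
  rw [listEnv_nil] at this
  rw [wordBool, Bool.and_eq_true, formulaStates, this]
  exact Iff.rfl

theorem formulaAutomaton_accepts (p d m off : ℕ) (preds : List NAtom) (φ : NPrenex) :
    (formulaAutomaton p d m off preds φ).toNFA.accepts = wordLang p d m off preds φ := by
  obtain ⟨Q, _, step, q₀, acc, hcard, h⟩ :=
    (recognizable_matrixPred preds φ.2).quantSat φ.1
  let R := p + d + m + off
  -- The three components are validity, the last letter and the state of the automaton for the
  -- formula; their sizes multiply to the bound `2 * (2 ^ R * formulaStates preds φ)`.
  let st : List (List Bool) → Bool × (Fin R → Bool) × Q := fun w =>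
    (validWord p d m off w, fun j => bitAt (lastLetter R w) j,
      w.foldl (fun q a => step q (letterColumn p d m preds.length off a)) q₀)
  refine learnedAutomaton_accepts (st := st) (fun w hw a ha => ?_) (fun w _ => wordBool_iff _ _ _ _ _ _ w)
    ?_ ?_ ?_
  · obtain ⟨i, hi, rfl⟩ := List.mem_iff_getElem.1 ha
    have := (validWord_iff.1 hw.1 i hi).1
    rw [List.getD_eq_getElem _ _ hi] at this
    exact mem_words.2 ⟨(letterOk_iff.1 this).1, fun b _ => by cases b <;> simp⟩
  · simp only [Fintype.card_prod, Fintype.card_bool, Fintype.card_pi, Finset.prod_const,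
      Finset.card_univ, Fintype.card_fin]
    exact Nat.mul_le_mul_left _ (Nat.mul_le_mul_left _ hcard)
  · intro u v _ _ a _ huv
    simp only [st, Prod.mk.injEq] at huv ⊢
    obtain ⟨h1, h2, h3⟩ := huv
    refine ⟨?_, ?_, ?_⟩
    · rw [Bool.eq_iff_iff, validWord_append, validWord_append, h1,
        stepOk_congr (R := R) (by omega) fun j hj => congrFun h2 ⟨j, hj⟩]
    · simp [lastLetter]
    · simp [h3]
  · rintro u v _ _ huv ⟨hu, hsat⟩
    simp only [st, Prod.mk.injEq] at huv
    obtain ⟨h1, -, h3⟩ := huv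
    have hv : validWord p d m off v = true := h1 ▸ hu
    refine ⟨hv, ?_⟩
    have hrun : ∀ w, validWord p d m off w = true → (wordSat p d m off preds φ w ↔
        w.foldl (fun q a => step q (letterColumn p d m preds.length off a)) q₀ ∈ acc) := by
      intro w hw
      rw [← runSeq_eq_foldl step q₀ _ _ [] w fun i _ => column_word hw i]
      exact h _ _ _ _ (paddedFrom_word p d m preds.length off w)
    rw [hrun v hv, ← h3, ← hrun u hu]
    exact hsat

end ArrayAbs

namespace ArrayAbs

open Encodable

/-! ## Words that represent states and pairs of states -/

section Representation

variable {V : Vocab} {m : ℕ}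

theorem getD_ofFn {α : Type} {n : ℕ} (f : Fin n → α) (i : ℕ) (a : α) :
    (List.ofFn f).getD i a = if h : i < n then f ⟨i, h⟩ else a := by
  rw [List.getD_eq_getElem?_getD, List.getElem?_ofFn]
  split_ifs <;> rfl

theorem length_letter (a : AbsState V m) (i : ℕ) : (letter a i).length = V.par + V.idx + m := by
  simp [letter, add_assoc]

theorem bitAt_letter (a : AbsState V m) (i j : ℕ) :
    bitAt (letter a i) j =
      if h : j < V.par then decide (i < a.1.par ⟨j, h⟩)
      else if h : j - V.par < V.idx then decide (i < a.1.idx ⟨j - V.par, h⟩)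
      else if h : j - V.par - V.idx < m then (a.2.getD i fun _ => false) ⟨j - V.par - V.idx, h⟩
      else false := by
  rw [bitAt, letter, List.append_assoc]
  split_ifs with h1 h2 h3
  · rw [List.getD_append _ _ _ _ (by simpa using h1), getD_ofFn, dif_pos h1]
  · rw [List.getD_append_right _ _ _ _ (by simp; omega), List.getD_append _ _ _ _ (by simpa),
      getD_ofFn, dif_pos (by simpa using h2)]
    simp
  · rw [List.getD_append_right _ _ _ _ (by simp; omega), List.getD_append_right _ _ _ _
      (by simp; omega), getD_ofFn, dif_pos (by simpa using h3)]
    simp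
  · rw [List.getD_append_right _ _ _ _ (by simp; omega), List.getD_append_right _ _ _ _
      (by simp; omega), getD_ofFn, dif_neg (by simpa using h3)]

theorem bitAt_letter_par (a : AbsState V m) (i : ℕ) {x : ℕ} (hx : x < V.par) :
    bitAt (letter a i) x = decide (i < a.1.par ⟨x, hx⟩) := by
  rw [bitAt_letter, dif_pos hx]

theorem bitAt_letter_idx (a : AbsState V m) (i : ℕ) {x : ℕ} (hx : x < V.idx) :
    bitAt (letter a i) (V.par + x) = decide (i < a.1.idx ⟨x, hx⟩) := by
  rw [bitAt_letter, dif_neg (by omega), dif_pos (by omega)]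
  simp

theorem bitAt_letter_bit (a : AbsState V m) (i : ℕ) {k : ℕ} (hk : k < m) :
    bitAt (letter a i) (V.par + V.idx + k) = (a.2.getD i fun _ => false) ⟨k, hk⟩ := by
  have h : V.par + V.idx + k - V.par - V.idx = k := by omega
  rw [bitAt_letter, dif_neg (by omega), dif_neg (by omega), dif_pos (by omega)]
  simp only [h]

/-- The letters of `w` from position `0` (from position `off`) on represent `a` (`b`). -/
structure Represents (off : ℕ) (w : List (List Bool)) (a b : AbsState V m) : Prop where
  length_eq : w.length = max (convLength a) (convLength b)
  length_letter : ∀ i < w.length, (w.getD i []).length = V.par + V.idx + m + off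
  left : ∀ i < w.length, ∀ j < V.par + V.idx + m,
    bitAt (w.getD i []) j = bitAt (letter a i) j
  right : ∀ i < w.length, ∀ j < V.par + V.idx + m,
    bitAt (w.getD i []) (off + j) = bitAt (letter b i) j

/-- Beyond the length of the convolution, there are only zeros. -/
theorem letter_eq_false (a : AbsState V m) {i : ℕ} (hi : convLength a ≤ i) (j : ℕ) :
    bitAt (letter a i) j = false := by
  rw [convLength, max_le_iff, max_le_iff] at hi
  rw [bitAt_letter]
  split_ifs with h1 h2 h3
  · have := Finset.le_sup (f := a.1.par) (Finset.mem_univ ⟨j, h1⟩)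
    simpa using this.trans hi.1.1
  · have := Finset.le_sup (f := a.1.idx) (Finset.mem_univ ⟨_, h2⟩)
    simpa using this.trans hi.1.2
  · rw [List.getD_eq_default _ _ hi.2]
  · rfl

theorem Represents.left' {off : ℕ} {w : List (List Bool)} {a b : AbsState V m}
    (h : Represents off w a b) (i : ℕ) {j : ℕ} (hj : j < V.par + V.idx + m) :
    bitAt (w.getD i []) j = bitAt (letter a i) j := by
  by_cases hi : i < w.length
  · exact h.left i hi j hj
  · have := h.length_eq
    rw [List.getD_eq_default _ _ (not_lt.1 hi), bitAt_nil, letter_eq_false _ (by omega)]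

theorem Represents.right' {off : ℕ} {w : List (List Bool)} {a b : AbsState V m}
    (h : Represents off w a b) (i : ℕ) {j : ℕ} (hj : j < V.par + V.idx + m) :
    bitAt (w.getD i []) (off + j) = bitAt (letter b i) j := by
  by_cases hi : i < w.length
  · exact h.right i hi j hj
  · have := h.length_eq
    rw [List.getD_eq_default _ _ (not_lt.1 hi), bitAt_nil, letter_eq_false _ (by omega)]

theorem represents_state (a : AbsState V m) :
    Represents 0 ((List.range (convLength a)).map (letter a)) a a := by
  have h : ∀ i < ((List.range (convLength a)).map (letter a)).length,
      ((List.range (convLength a)).map (letter a)).getD i [] = letter a i := by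
    intro i hi
    rw [List.getD_eq_getElem _ _ hi]; simp
  refine ⟨by simp, fun i hi => ?_, fun i hi j _ => by rw [h i hi], fun i hi j _ => ?_⟩
  · rw [h i hi, ArrayAbs.length_letter]; rfl
  · rw [h i hi, zero_add]

theorem represents_pair (p : AbsState V m × AbsState V m) :
    Represents (V.par + V.idx + m) ((List.range (max (convLength p.1) (convLength p.2))).map
      fun i => letter p.1 i ++ letter p.2 i) p.1 p.2 := by
  set w := (List.range (max (convLength p.1) (convLength p.2))).map
      fun i => letter p.1 i ++ letter p.2 i with hw
  have h : ∀ i < w.length, w.getD i [] = letter p.1 i ++ letter p.2 i := by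
    intro i hi
    rw [List.getD_eq_getElem _ _ hi]; simp [hw]
  refine ⟨by simp [hw], fun i hi => ?_, fun i hi j hj => ?_, fun i hi j _ => ?_⟩
  · rw [h i hi, List.length_append, ArrayAbs.length_letter, ArrayAbs.length_letter]
  · rw [h i hi, bitAt, List.getD_append _ _ _ _ (by rw [ArrayAbs.length_letter]; exact hj)]
    rfl
  · rw [h i hi, bitAt, List.getD_append_right _ _ _ _ (by rw [ArrayAbs.length_letter]; omega),
      ArrayAbs.length_letter, Nat.add_sub_cancel_left]
    rfl

theorem ext_bitAt {a b : List Bool} (hl : a.length = b.length)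
    (h : ∀ j < a.length, bitAt a j = bitAt b j) : a = b := by
  refine List.ext_getElem hl fun j h1 h2 => ?_
  have := h j h1
  rwa [bitAt, bitAt, List.getD_eq_getElem _ _ h1, List.getD_eq_getElem _ _ h2] at this

/-- Length and all bits are prescribed, so a word is determined by the state it represents. -/
theorem Represents.eq_state {w : List (List Bool)} {a : AbsState V m}
    (h : Represents 0 w a a) : (List.range (convLength a)).map (letter a) = w := by
  have hl := h.length_eq
  rw [max_self] at hl
  refine List.ext_getElem (by simp [hl]) fun i h1 h2 => ?_
  rw [← List.getD_eq_getElem (d := []) _ h2]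
  have h3 := h.length_letter i h2
  simp only [List.getElem_map, List.getElem_range]
  refine ext_bitAt (by rw [ArrayAbs.length_letter, h3]; rfl) fun j hj => ?_
  rw [ArrayAbs.length_letter] at hj
  exact (h.left i h2 j hj).symm

theorem Represents.eq_pair {w : List (List Bool)} {a b : AbsState V m}
    (h : Represents (V.par + V.idx + m) w a b) :
    ((List.range (max (convLength a) (convLength b))).map fun i => letter a i ++ letter b i) =
      w := by
  have hl := h.length_eq
  refine List.ext_getElem (by simp [hl]) fun i h1 h2 => ?_
  rw [← List.getD_eq_getElem (d := []) _ h2]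
  have h3 := h.length_letter i h2
  simp only [List.getElem_map, List.getElem_range]
  refine ext_bitAt
    (by rw [List.length_append, ArrayAbs.length_letter, ArrayAbs.length_letter, h3])
    fun j hj => ?_
  rw [List.length_append, ArrayAbs.length_letter, ArrayAbs.length_letter] at hj
  by_cases hj' : j < V.par + V.idx + m
  · rw [h.left i h2 j hj', bitAt,
      List.getD_append _ _ _ _ (by rw [ArrayAbs.length_letter]; exact hj')]
    rfl
  · have := h.right i h2 (j - (V.par + V.idx + m)) (by omega)
    rw [show V.par + V.idx + m + (j - (V.par + V.idx + m)) = j by omega] at this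
    rw [this, bitAt, List.getD_append_right _ _ _ _ (by rw [ArrayAbs.length_letter]; omega),
      ArrayAbs.length_letter]
    rfl

/-- The abstract states whose words have the prescribed lengths, and whose parameters agree. -/
structure Compatible (a b : AbsState V m) : Prop where
  left : a.2.length = a.1.maxPar
  right : b.2.length = b.1.maxPar
  par : a.1.par = b.1.par

theorem Compatible.length_eq {a b : AbsState V m} (h : Compatible a b) :
    b.2.length = a.2.length := by
  rw [h.left, h.right, AbsNums.maxPar, AbsNums.maxPar, h.par]

theorem lt_maxPar_iff (a : AbsNums V) (i : ℕ) : i < a.maxPar ↔ ∃ x, i < a.par x := by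
  simp [AbsNums.maxPar, Finset.lt_sup_iff]

theorem Represents.validWord {off : ℕ} {w : List (List Bool)} {a b : AbsState V m}
    (h : Represents off w a b) (hc : Compatible a b) :
    validWord V.par V.idx m off w = true := by
  have hpar : ∀ i x, x < V.par → bitAt (w.getD i []) x = bitAt (w.getD i []) (off + x) := by
    intro i x hx
    rw [h.left' i (by omega), h.right' i (by omega), bitAt_letter_par _ _ hx,
      bitAt_letter_par _ _ hx, hc.par]
  rw [validWord_iff]
  refine fun i hi => ⟨letterOk_iff.2 ⟨h.length_letter i hi, ?_, hpar i, ?_⟩, stepOk_iff.2 ?_⟩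
  -- The predicate word is exactly as long as the largest parameter, so at each position of the
  -- convolution some number is still running.
  · have hlt := hi
    rw [h.length_eq] at hlt
    have key : ∀ c : AbsState V m, c.2.length = c.1.maxPar → i < convLength c →
        ∃ j < V.par + V.idx, bitAt (letter c i) j = true := by
      intro c hcl hlt
      rw [convLength, hcl, lt_max_iff, lt_max_iff] at hlt
      have hp : i < Finset.univ.sup c.1.par → ∃ j < V.par + V.idx, bitAt (letter c i) j = true := by
        intro hlt
        rw [Finset.lt_sup_iff] at hlt
        obtain ⟨x, -, hx⟩ := hlt
        exact ⟨x, by omega, by rw [bitAt_letter_par _ _ x.2]; simpa using hx⟩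
      rcases hlt with (hlt | hlt) | hlt
      · exact hp hlt
      · rw [Finset.lt_sup_iff] at hlt
        obtain ⟨x, -, hx⟩ := hlt
        exact ⟨V.par + x, by omega, by rw [bitAt_letter_idx _ _ x.2]; simpa using hx⟩
      · exact hp hlt
    rcases lt_max_iff.1 hlt with hlt | hlt
    · obtain ⟨j, hj, hb⟩ := key a hc.left hlt
      exact ⟨j, hj, Or.inl (by rw [h.left' i (by omega), hb])⟩
    · obtain ⟨j, hj, hb⟩ := key b hc.right hlt
      exact ⟨j, hj, Or.inr (by rw [h.right' i (by omega), hb])⟩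
  · by_cases hlt : i < a.1.maxPar
    · left
      obtain ⟨x, hx⟩ := (lt_maxPar_iff _ _).1 hlt
      rw [hasParBit_iff]
      exact ⟨x, x.2, by rw [h.left' i (by omega), bitAt_letter_par _ _ x.2]; simpa using hx⟩
    · right
      intro k hk
      rw [h.left' i (by omega), h.right' i (by omega), bitAt_letter_bit _ _ hk,
        bitAt_letter_bit _ _ hk, List.getD_eq_default _ _ (by rw [hc.left]; omega),
        List.getD_eq_default _ _ (by rw [hc.length_eq, hc.left]; omega)]
      exact ⟨rfl, rfl⟩
  · intro j hj
    rw [h.left' i (by omega), h.right' i (by omega), h.left' (i + 1) (by omega),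
      h.right' (i + 1) (by omega)]
    have key : ∀ c : AbsState V m, bitAt (letter c (i + 1)) j = true →
        bitAt (letter c i) j = true := by
      intro c
      by_cases hj' : j < V.par
      · rw [bitAt_letter_par _ _ hj', bitAt_letter_par _ _ hj']
        simp only [decide_eq_true_eq]; omega
      · obtain ⟨x, rfl⟩ := Nat.exists_eq_add_of_le (not_lt.1 hj')
        rw [bitAt_letter_idx _ _ (by omega), bitAt_letter_idx _ _ (by omega)]
        simp only [decide_eq_true_eq]; omega
    exact ⟨key a, key b⟩

/-- The abstract state represented by the letters of a word from position `o` on. -/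
def decodeState (V : Vocab) (m o : ℕ) (w : List (List Bool)) : AbsState V m :=
  (⟨fun x => rowValue w (o + x), fun x => rowValue w (o + (V.par + x))⟩,
    (List.range (prefixLength (hasParBit V.par) w)).map fun i k =>
      bitAt (w.getD i []) (o + (V.par + V.idx + k)))

/-- The conditions of `validWord` are exactly those under which the rows can be read back. Both
predicate words take their length from the parameters of the first half, which is correct since the
halves agree on parameters. -/
theorem represents_decodeState {off : ℕ} {w : List (List Bool)}
    (h : ArrayAbs.validWord V.par V.idx m off w = true) :
    Represents off w (decodeState V m 0 w) (decodeState V m off w) ∧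
      Compatible (decodeState V m 0 w) (decodeState V m off w) := by
  have hv := validWord_iff.1 h
  have hrow0 : ∀ j, j < V.par + V.idx → ∀ i,
      (i < rowValue w (0 + j) ↔ bitAt (w.getD i []) (0 + j) = true) := by
    intro j hj i
    rw [zero_add]
    exact (lt_rowValue_iff h hj i).1
  have hrow1 : ∀ j, j < V.par + V.idx → ∀ i,
      (i < rowValue w (off + j) ↔ bitAt (w.getD i []) (off + j) = true) :=
    fun j hj i => (lt_rowValue_iff h hj i).2
  have hpareq : ∀ x < V.par, rowValue w (0 + x) = rowValue w (off + x) := by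
    intro x hx
    refine eq_of_forall_lt_iff fun i => ?_
    rw [hrow0 x (by omega), hrow1 x (by omega), zero_add]
    by_cases hi : i < w.length
    · rw [(letterOk_iff.1 (hv i hi).1).2.2.1 x hx]
    · rw [List.getD_eq_default _ _ (not_lt.1 hi), bitAt_nil, bitAt_nil]
  have hpar : (decodeState V m 0 w).1.par = (decodeState V m off w).1.par := by
    funext x
    exact hpareq x x.2
  have hlen0 : (decodeState V m 0 w).2.length = (decodeState V m 0 w).1.maxPar := by
    refine eq_of_forall_lt_iff fun i => ?_
    rw [lt_maxPar_iff]
    simp only [decodeState, List.length_map, List.length_range]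
    rw [lt_parLength_iff h, hasParBit_iff]
    constructor
    · rintro ⟨j, hj, hb⟩
      refine ⟨⟨j, hj⟩, (hrow0 j (by omega) i).2 ?_⟩
      rwa [zero_add]
    · rintro ⟨x, hx⟩
      have := (hrow0 x (by omega) i).1 hx
      rw [zero_add] at this
      exact ⟨x, x.2, this⟩
  have hlen1 : (decodeState V m off w).2.length = (decodeState V m off w).1.maxPar := by
    rw [AbsNums.maxPar, ← hpar, ← AbsNums.maxPar, ← hlen0]
    simp [decodeState]
  have hbits : ∀ o, (o = 0 ∨ o = off) →
      ∀ i, ∀ j < V.par + V.idx + m,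
      bitAt (w.getD i []) (o + j) = bitAt (letter (decodeState V m o w) i) j := by
    intro o ho i j hj
    have hrow : ∀ j, j < V.par + V.idx → ∀ i,
        (i < rowValue w (o + j) ↔ bitAt (w.getD i []) (o + j) = true) := by
      rcases ho with rfl | rfl
      exacts [hrow0, hrow1]
    by_cases h1 : j < V.par
    · rw [bitAt_letter_par _ _ h1, Bool.eq_iff_iff, decide_eq_true_eq]
      exact (hrow j (by omega) i).symm
    by_cases h2 : j < V.par + V.idx
    · obtain ⟨x, rfl⟩ := Nat.exists_eq_add_of_le (not_lt.1 h1)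
      rw [bitAt_letter_idx _ _ (by omega), Bool.eq_iff_iff, decide_eq_true_eq]
      exact (hrow _ h2 i).symm
    · obtain ⟨k, rfl⟩ := Nat.exists_eq_add_of_le (not_lt.1 h2)
      have hdec : (decodeState V m o w).2.getD i (fun _ => false) =
          if i < prefixLength (hasParBit V.par) w then
            (fun k : Fin m => bitAt (w.getD i []) (o + (V.par + V.idx + k)))
          else fun _ => false := by
        simp only [decodeState, List.getD_eq_getElem?_getD (l := List.map _ _), List.getElem?_map]
        split_ifs with hi
        · rw [List.getElem?_range hi]; rfl
        · rw [List.getElem?_eq_none (by simpa using hi)]; rfl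
      rw [bitAt_letter_bit _ _ (by omega), hdec]
      by_cases hi : i < prefixLength (hasParBit V.par) w
      · rw [if_pos hi]
      · have hz : bitAt (w.getD i []) (o + (V.par + V.idx + k)) = false := by
          by_cases hi' : i < w.length
          · have h3 := (letterOk_iff.1 (hv i hi').1).2.2.2
            rw [← lt_parLength_iff h i] at h3
            have h4 := h3.resolve_left hi k (by omega)
            rcases ho with rfl | rfl
            · rw [zero_add]; exact h4.1
            · exact h4.2
          · rw [List.getD_eq_default _ _ (not_lt.1 hi'), bitAt_nil]
        rw [if_neg hi, hz]
  refine ⟨⟨?_, fun i hi => (letterOk_iff.1 (hv i hi).1).1, fun i _ j hj => ?_,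
    fun i _ j hj => hbits off (Or.inr rfl) i j hj⟩, ⟨hlen0, hlen1, hpar⟩⟩
  -- The convolution must have the length of `w`: each letter has a running number, and no row
  -- extends beyond `w`.
  · refine eq_of_forall_lt_iff fun i => ?_
    have hsup : ∀ o, (decodeState V m o w).2.length = (decodeState V m o w).1.maxPar →
        (i < convLength (decodeState V m o w) ↔
        (∃ x : Fin V.par, i < rowValue w (o + x)) ∨
          ∃ x : Fin V.idx, i < rowValue w (o + (V.par + x))) := by
      intro o hlen
      rw [convLength, hlen, lt_max_iff, lt_max_iff, AbsNums.maxPar, Finset.lt_sup_iff,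
        Finset.lt_sup_iff]
      simp only [Finset.mem_univ, true_and, decodeState]
      tauto
    rw [lt_max_iff, hsup 0 hlen0, hsup off hlen1]
    constructor
    · intro hi
      obtain ⟨j, hj, hb⟩ := (letterOk_iff.1 (hv i hi).1).2.1
      replace hb : i < rowValue w (0 + j) ∨ i < rowValue w (off + j) := by
        rw [hrow0 j hj, hrow1 j hj, zero_add]; exact hb
      by_cases hj' : j < V.par
      · exact hb.imp (fun hb => Or.inl ⟨⟨j, hj'⟩, hb⟩) fun hb => Or.inl ⟨⟨j, hj'⟩, hb⟩
      · obtain ⟨x, rfl⟩ := Nat.exists_eq_add_of_le (not_lt.1 hj')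
        exact hb.imp (fun hb => Or.inr ⟨⟨x, by omega⟩, hb⟩) fun hb => Or.inr ⟨⟨x, by omega⟩, hb⟩
    · have hle : ∀ j, i < rowValue w j → i < w.length :=
        fun j hj => hj.trans_le (prefixLength_le _ _)
      rintro ((⟨x, hx⟩ | ⟨x, hx⟩) | ⟨x, hx⟩ | ⟨x, hx⟩) <;> exact hle _ hx
  · rw [← hbits 0 (Or.inl rfl) i j hj, zero_add]

/-! ### Values -/

theorem Represents.wordVal_par {off : ℕ} {w : List (List Bool)} {a b : AbsState V m}
    (h : Represents off w a b) (hc : Compatible a b) (e : ℕ → ℕ) (x : IVar) :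
    varVal (join a.1.toNums b.1.toNums) e x = mixVal (wordVal V.par V.idx off w) e x := by
  have hv := h.validWord hc
  rcases x with ⟨q, x⟩ | ⟨q, x⟩ | k
  · simp only [varVal, IVar.eval, mixVal, wordVal, Bool.cond_decide]
    by_cases hx : x < V.par
    · rw [if_pos hx]
      congr 1
      refine eq_of_forall_lt_iff fun i => ?_
      cases q
      · rw [rowOf, cond_false, (lt_rowValue_iff hv (by omega) i).1, h.left' i (by omega),
          bitAt_letter_par _ _ hx]
        simp [join, AbsNums.toNums, hx]
      · rw [rowOf, cond_true, (lt_rowValue_iff hv (by omega) i).2, h.right' i (by omega),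
          bitAt_letter_par _ _ hx]
        simp [join, AbsNums.toNums, hx]
    · cases q <;> simp [hx, join, AbsNums.toNums]
  · simp only [varVal, IVar.eval, mixVal, wordVal, Bool.cond_decide]
    by_cases hx : x < V.idx
    · rw [if_pos hx]
      congr 1
      refine eq_of_forall_lt_iff fun i => ?_
      cases q
      · rw [rowOf, cond_false, (lt_rowValue_iff hv (by omega) i).1, h.left' i (by omega),
          bitAt_letter_idx _ _ hx]
        simp [join, AbsNums.toNums, hx]
      · rw [rowOf, cond_true, (lt_rowValue_iff hv (by omega) i).2, h.right' i (by omega),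
          bitAt_letter_idx _ _ hx]
        simp [join, AbsNums.toNums, hx]
    · cases q <;> simp [hx, join, AbsNums.toNums]
  · rfl

theorem Represents.wordVal_none {off : ℕ} {w : List (List Bool)} {a b : AbsState V m}
    (h : Represents off w a b) (hc : Compatible a b) :
    wordVal V.par V.idx off w none = a.2.length := by
  refine eq_of_forall_lt_iff fun i => ?_
  rw [hc.left, lt_maxPar_iff, wordVal, lt_parLength_iff (h.validWord hc), hasParBit_iff]
  constructor
  · rintro ⟨j, hj, hb⟩
    rw [h.left' i (by omega), bitAt_letter_par _ _ hj] at hb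
    exact ⟨⟨j, hj⟩, by simpa using hb⟩
  · rintro ⟨x, hx⟩
    exact ⟨x, x.2, by rw [h.left' i (by omega), bitAt_letter_par _ _ x.2]; simpa using hx⟩

theorem delta_iff {m : ℕ} (k : Fin m) (i : ℤ) (w : BWord m) :
    Delta k i w ↔ 1 ≤ i ∧ (w.getD (i - 1).toNat fun _ => false) k = true := by
  rw [Delta, List.getD_eq_getElem?_getD]
  refine and_congr_right fun _ => ?_
  rcases w[(i - 1).toNat]? with _ | v <;> simp

/-- Covers states (`n = m`, both halves equal) and transitions (`n = m + m`, with `u` a convolution)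
at once. -/
theorem absSat_iff_wordSat {n off : ℕ} {w : List (List Bool)} {a b : AbsState V m}
    (h : Represents off w a b) (hc : Compatible a b) (P : Fin n → Atom) (φ : Formula)
    (u : BWord n) (hn : m ≤ n) (hu : u.length = a.2.length)
    (hbit : ∀ (k : Fin n) (i : ℕ), (u.getD i fun _ => false) k =
      wordBit V.par V.idx m n off w k i) :
    φ.absSat V P (join a.1.toNums b.1.toNums) u ↔
      wordSat V.par V.idx m off (List.ofFn fun k => (P k).nf V.size) (φ.nprenex V.size false) w := by
  rw [Formula.absSat, wordSat, ← Formula.nf_prenex]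
  simp only [PrenexDNF.nf]
  have : matrixSat V P (φ.prenex false).matrix (join a.1.toNums b.1.toNums) u =
      matrixPred (List.ofFn fun k => (P k).nf V.size)
        ((φ.prenex false).matrix.map fun c => c.map fun A => A.nf V.size)
        (wordVal V.par V.idx off w)
        (wordBit V.par V.idx m (List.ofFn fun k => (P k).nf V.size).length off w) := by
    funext e
    rw [eq_iff_iff, matrixSat_iff, matrixPred, h.wordVal_none hc, hu]
    have h1 : varVal (join a.1.toNums b.1.toNums) e =
        fun x => (mixVal (wordVal V.par V.idx off w) e x : ℤ) :=
      funext fun x => h.wordVal_par hc e x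
    have h2 : (fun k i => ∃ hk : k < n, Delta (⟨k, hk⟩ : Fin n) i u) = fun k (i : ℤ) => 1 ≤ i ∧
        wordBit V.par V.idx m (List.ofFn fun k => (P k).nf V.size).length off w k
          (i - 1).toNat = true := by
      funext k i
      rw [eq_iff_iff, List.length_ofFn]
      constructor
      · rintro ⟨hk, hd⟩
        rw [delta_iff, hbit] at hd
        exact hd
      · rintro ⟨h1, h2⟩
        -- Rows from `n` on are constantly `false`; `m ≤ n` ensures that such a row is not read from
        -- the first half.
        have hk : k < n := by
          by_contra hk
          rw [wordBit, letterBit] at h2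
          simp [hk, show ¬ k < m by omega] at h2
        exact ⟨hk, (delta_iff _ _ _).2 ⟨h1, by rw [hbit]; exact h2⟩⟩
    rw [h1, h2]
  rw [this]

/-! ### The languages of abstractions -/

/-- With offset `0` both halves are read from the same rows. -/
theorem Represents.state_eq {off : ℕ} {w : List (List Bool)} {a b : AbsState V m}
    (h : Represents off w a b) (h0 : off = 0) (hc : Compatible a b) : b = a := by
  have hv := h.validWord hc
  subst h0
  have hbit : ∀ i, ∀ j < V.par + V.idx + m, bitAt (letter b i) j = bitAt (letter a i) j := by
    intro i j hj
    rw [← h.left' i hj, ← h.right' i hj, zero_add]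
  refine Prod.ext (AbsNums.ext hc.par.symm (funext fun x => ?_)) ?_
  · refine eq_of_forall_lt_iff fun i => ?_
    have := hbit i (V.par + x) (by omega)
    rw [bitAt_letter_idx _ _ x.2, bitAt_letter_idx _ _ x.2] at this
    simpa using this
  · refine List.ext_getElem hc.length_eq fun i h1 h2 => funext fun k => ?_
    have := hbit i (V.par + V.idx + k) (by omega)
    rw [bitAt_letter_bit _ _ k.2, bitAt_letter_bit _ _ k.2, List.getD_eq_getElem _ _ h1,
      List.getD_eq_getElem _ _ h2] at this
    exact this

theorem lang_absStates (P : Fin m → Atom) (φ : Formula) :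
    lang (absStates V P φ) = wordLang V.par V.idx m 0 (List.ofFn fun k => (P k).nf V.size)
      (φ.nprenex V.size false) := by
  have hjoin : ∀ s : Nums, (fun _ => s) = join s s := fun s => funext fun b => by simp [join]
  have key : ∀ (w : List (List Bool)) (a : AbsState V m), Represents 0 w a a → Compatible a a →
      (φ.absSat V P (fun _ => a.1.toNums) a.2 ↔ wordSat V.par V.idx m 0
        (List.ofFn fun k => (P k).nf V.size) (φ.nprenex V.size false) w) := by
    intro w a h hc
    rw [hjoin]
    refine absSat_iff_wordSat h hc P φ a.2 le_rfl rfl fun k i => ?_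
    rw [wordBit, letterBit, decide_eq_true k.2, cond_true, h.left' i (by omega),
      bitAt_letter_bit _ _ k.2]
  ext w
  constructor
  · rintro ⟨a, ⟨hl, hs⟩, rfl⟩
    have hr := represents_state a
    have hc : Compatible a a := ⟨hl, hl, rfl⟩
    exact ⟨hr.validWord hc, (key _ a hr hc).1 hs⟩
  · rintro ⟨hv, hs⟩
    obtain ⟨hr, hc⟩ := represents_decodeState hv
    rw [hr.state_eq rfl hc] at hr hc
    exact ⟨_, ⟨hc.left, (key w _ hr hc).2 hs⟩, hr.eq_state⟩

theorem getD_conv {n : ℕ} (u : BWord m) (v : BWord n) (i : ℕ) :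
    (conv u v).getD i (fun _ => false) =
      Fin.append (u.getD i fun _ => false) (v.getD i fun _ => false) := by
  by_cases h : i < max u.length v.length
  · rw [List.getD_eq_getElem _ _ (by simpa [conv] using h)]
    simp [conv]
  · rw [List.getD_eq_default _ _ (by simpa [conv] using h), List.getD_eq_default _ _ (by omega),
      List.getD_eq_default _ _ (by omega)]
    funext k
    refine Fin.addCases (fun k => ?_) (fun k => ?_) k
    · rw [Fin.append_left]
    · rw [Fin.append_right]

theorem length_conv {n : ℕ} (u : BWord m) (v : BWord n) :
    (conv u v).length = max u.length v.length := by simp [conv]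

theorem langTrans_absTrans (P : Fin m → Atom) (φ : Formula) :
    langTrans (absTrans V P φ) = wordLang V.par V.idx m (V.par + V.idx + m)
      (List.ofFn fun k => (starPred P k).nf V.size) (φ.nprenex V.size false) := by
  have key : ∀ (w : List (List Bool)) (a b : AbsState V m),
      Represents (V.par + V.idx + m) w a b → Compatible a b →
      (φ.absSat V (starPred P) (join a.1.toNums b.1.toNums) (conv a.2 b.2) ↔
        wordSat V.par V.idx m (V.par + V.idx + m)
          (List.ofFn fun k => (starPred P k).nf V.size) (φ.nprenex V.size false) w) := by
    intro w a b h hc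
    refine absSat_iff_wordSat h hc _ φ _ (by omega) ?_ fun k i => ?_
    · rw [length_conv, hc.length_eq, max_self]
    · rw [getD_conv, wordBit, letterBit]
      refine Fin.addCases (fun k => ?_) (fun k => ?_) k
      · rw [Fin.append_left, Fin.val_castAdd, decide_eq_true k.2, cond_true, h.left' i (by omega),
          bitAt_letter_bit _ _ k.2]
      · rw [Fin.append_right, Fin.val_natAdd, decide_eq_false (by omega), cond_false,
          decide_eq_true (by omega), Bool.true_and, Nat.add_sub_cancel_left,
          h.right' i (by omega), bitAt_letter_bit _ _ k.2]
  ext w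
  constructor
  · rintro ⟨p, ⟨h1, h2, h3, hs⟩, rfl⟩
    have hr := represents_pair p
    have hc : Compatible p.1 p.2 := ⟨h1, h2, h3⟩
    exact ⟨hr.validWord hc, (key _ _ _ hr hc).1 hs⟩
  · rintro ⟨hv, hs⟩
    obtain ⟨hr, hc⟩ := represents_decodeState hv
    exact ⟨(_, _), ⟨hc.left, hc.right, hc.par, (key w _ _ hr hc).2 hs⟩, hr.eq_pair⟩

end Representation

end ArrayAbs

namespace ArrayAbs

/-! ## Expressions over a vocabulary -/

/-- Every name of `V` is a name of `V'`. -/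
structure Vocab.Le (V V' : Vocab) : Prop where
  par : V.par ≤ V'.par
  idx : V.idx ≤ V'.idx
  dat : V.dat ≤ V'.dat
  size : V.size = V'.size

theorem Vocab.Le.rfl {V : Vocab} : V.Le V := ⟨le_rfl, le_rfl, le_rfl, Eq.refl _⟩

theorem Vocab.le_star (V : Vocab) (k : ℕ) : V.Le (V.star k) :=
  ⟨Nat.le_add_right _ _, le_rfl, le_rfl, Eq.refl _⟩

theorem Vocab.WF.star {V : Vocab} (h : V.WF) (k : ℕ) : (V.star k).WF :=
  fun p hp => (h p hp).trans_le (Nat.le_add_right _ _)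

section Over

variable {V V' : Vocab} {p p' : Bool}

theorem IVar.Over.mono (hV : V.Le V') (hp : p = true → p' = true) {n n' : ℕ} (hn : n ≤ n')
    {x : IVar} (h : x.Over V p n) : x.Over V' p' n' := by
  have h1 := hV.par
  have h2 := hV.idx
  cases x with
  | par b x => exact ⟨fun hb => hp (h.1 hb), lt_of_lt_of_le h.2 h1⟩
  | idx b x => exact ⟨fun hb => hp (h.1 hb), lt_of_lt_of_le h.2 h2⟩
  | bnd k => exact lt_of_lt_of_le h hn

theorem ITerm.Over.mono (hV : V.Le V') (hp : p = true → p' = true) {n n' : ℕ} (hn : n ≤ n')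
    {t : ITerm} (h : t.Over V p n) : t.Over V' p' n' := by
  induction t with
  | var x => exact IVar.Over.mono hV hp hn h
  | const c => trivial
  | size b a => exact ⟨fun hb => hp (h.1 hb), hV.size ▸ h.2⟩
  | plus I c ih => exact ih h

theorem DTerm.Over.mono (hV : V.Le V') (hp : p = true → p' = true) {n n' : ℕ} (hn : n ≤ n')
    {t : DTerm} (h : t.Over V p n) : t.Over V' p' n' := by
  induction t with
  | var b v => exact ⟨fun hb => hp (h.1 hb), lt_of_lt_of_le h.2 hV.dat⟩
  | const c => trivial
  | get b a I => exact ⟨fun hb => hp (h.1 hb), hV.size ▸ h.2.1, ITerm.Over.mono hV hp hn h.2.2⟩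
  | plus I c ih => exact ih h

theorem Atom.Over.mono (hV : V.Le V') (hp : p = true → p' = true) {n n' : ℕ} (hn : n ≤ n')
    {A : Atom} (h : A.Over V p n) : A.Over V' p' n' := by
  cases A with
  | idx c I J => exact ⟨ITerm.Over.mono hV hp hn h.1, ITerm.Over.mono hV hp hn h.2⟩
  | dat c E F => exact ⟨DTerm.Over.mono hV hp hn h.1, DTerm.Over.mono hV hp hn h.2⟩

theorem Formula.Over.mono (hV : V.Le V') (hp : p = true → p' = true) {n n' : ℕ} (hn : n ≤ n')
    {φ : Formula} (h : φ.Over V p n) : φ.Over V' p' n' := by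
  induction φ generalizing n n' with
  | atom A => exact Atom.Over.mono hV hp hn h
  | not φ ih => exact ih hn h
  | or φ ψ ih1 ih2 => exact ⟨ih1 hn h.1, ih2 hn h.2⟩
  | and φ ψ ih1 ih2 => exact ⟨ih1 hn h.1, ih2 hn h.2⟩
  | ex φ ih => exact ih (Nat.succ_le_succ hn) h
  | all φ ih => exact ih (Nat.succ_le_succ hn) h

theorem ITerm.Over.subst (hV : V.Le V') {n n' : ℕ} {f : ℕ → ITerm}
    (hf : ∀ k < n, (f k).Over V' p n') {t : ITerm} (h : t.Over V p n) :
    (t.subst f).Over V' p n' := by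
  induction t with
  | var x =>
    cases x with
    | bnd k => exact hf k h
    | _ => exact ⟨h.1, lt_of_lt_of_le h.2 (by first | exact hV.par | exact hV.idx)⟩
  | const c => trivial
  | size b a => exact ⟨h.1, hV.size ▸ h.2⟩
  | plus I c ih => exact ih h

theorem DTerm.Over.subst (hV : V.Le V') {n n' : ℕ} {f : ℕ → ITerm}
    (hf : ∀ k < n, (f k).Over V' p n') {t : DTerm} (h : t.Over V p n) :
    (t.subst f).Over V' p n' := by
  induction t with
  | var b v => exact ⟨h.1, lt_of_lt_of_le h.2 hV.dat⟩
  | const c => trivial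
  | get b a I => exact ⟨h.1, hV.size ▸ h.2.1, ITerm.Over.subst hV hf h.2.2⟩
  | plus I c ih => exact ih h

theorem Atom.Over.subst (hV : V.Le V') {n n' : ℕ} {f : ℕ → ITerm}
    (hf : ∀ k < n, (f k).Over V' p n') {A : Atom} (h : A.Over V p n) :
    (A.subst f).Over V' p n' := by
  cases A with
  | idx c I J => exact ⟨ITerm.Over.subst hV hf h.1, ITerm.Over.subst hV hf h.2⟩
  | dat c E F => exact ⟨DTerm.Over.subst hV hf h.1, DTerm.Over.subst hV hf h.2⟩

theorem under_over {n n' : ℕ} {f : ℕ → ITerm} (hf : ∀ k < n, (f k).Over V p n') :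
    ∀ k < n + 1, (under f k).Over V p (n' + 1)
  | 0, _ => Nat.succ_pos n'
  | k + 1, hk => by
    refine ITerm.Over.subst Vocab.Le.rfl (fun j hj => ?_) (hf k (Nat.lt_of_succ_lt_succ hk))
    exact Nat.succ_lt_succ hj

theorem Formula.Over.subst (hV : V.Le V') {n n' : ℕ} {f : ℕ → ITerm}
    (hf : ∀ k < n, (f k).Over V' p n') {φ : Formula} (h : φ.Over V p n) :
    (φ.subst f).Over V' p n' := by
  induction φ generalizing n n' f with
  | atom A => exact Atom.Over.subst hV hf h
  | not φ ih => exact ih hf h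
  | or φ ψ ih1 ih2 => exact ⟨ih1 hf h.1, ih2 hf h.2⟩
  | and φ ψ ih1 ih2 => exact ⟨ih1 hf h.1, ih2 hf h.2⟩
  | ex φ ih => exact ih (under_over hf) h
  | all φ ih => exact ih (under_over hf) h

theorem Formula.Over.star {k : ℕ} {ψ : Formula} (h : ψ.Over V false k) :
    (ψ.star V).Over (V.star k) false 0 := by
  refine Formula.Over.subst (V.le_star k) (fun j hj => ?_) h
  exact ⟨fun h => absurd h (by simp), Nat.add_lt_add_left hj _⟩

theorem ITerm.Over.prime {n : ℕ} {t : ITerm} (h : t.Over V false n) : t.prime.Over V true n := by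
  induction t with
  | var x =>
    cases x with
    | bnd k => exact h
    | _ => exact ⟨fun _ => rfl, h.2⟩
  | const c => trivial
  | size b a => exact ⟨fun _ => rfl, h.2⟩
  | plus I c ih => exact ih h

theorem DTerm.Over.prime {n : ℕ} {t : DTerm} (h : t.Over V false n) : t.prime.Over V true n := by
  induction t with
  | var b v => exact ⟨fun _ => rfl, h.2⟩
  | const c => trivial
  | get b a I => exact ⟨fun _ => rfl, h.2.1, ITerm.Over.prime h.2.2⟩
  | plus I c ih => exact ih h

theorem Atom.Over.prime {n : ℕ} {A : Atom} (h : A.Over V false n) : A.prime.Over V true n := by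
  cases A with
  | idx c I J => exact ⟨ITerm.Over.prime h.1, ITerm.Over.prime h.2⟩
  | dat c E F => exact ⟨DTerm.Over.prime h.1, DTerm.Over.prime h.2⟩

theorem Atom.Over.neg {n : ℕ} {A : Atom} (h : A.Over V p n) : A.neg.Over V p n := by
  cases A <;> exact h

theorem DTerm.Over.iterms {n : ℕ} {E : DTerm} (h : E.Over V p n) {t : ITerm}
    (ht : t ∈ E.iterms) : t.Over V p n := by
  induction E with
  | var b v => simp [DTerm.iterms] at ht
  | const c => simp [DTerm.iterms] at ht
  | get b a I =>
    rw [DTerm.iterms, List.mem_singleton] at ht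
    exact ht ▸ h.2.2
  | plus I c ih => exact ih h ht

theorem Atom.Over.iterms {n : ℕ} {A : Atom} (h : A.Over V p n) {t : ITerm}
    (ht : t ∈ A.iterms) : t.Over V p n := by
  cases A with
  | idx c I J =>
    simp only [Atom.iterms, List.mem_cons, List.not_mem_nil, or_false] at ht
    rcases ht with rfl | rfl
    exacts [h.1, h.2]
  | dat c E F =>
    simp only [Atom.iterms, List.mem_append] at ht
    exact ht.elim (DTerm.Over.iterms h.1) (DTerm.Over.iterms h.2)

theorem starPred_over {m : ℕ} {P : Fin m → Atom} (hP : ∀ k, (P k).Over V false 1)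
    (k : Fin (m + m)) : (starPred P k).Over V true 1 := by
  refine Fin.addCases (fun k => ?_) (fun k => ?_) k
  · rw [starPred, Fin.append_left]
    exact Atom.Over.mono Vocab.Le.rfl (fun _ => rfl) le_rfl (hP k)
  · rw [starPred, Fin.append_right]
    exact Atom.Over.prime (hP k)

/-- One more variable than in `h` is allowed because a term taken from a predicate may contain the
variable `0` even when `n = 0`. -/
theorem IsTermOf.over {m : ℕ} {P : Fin m → Atom} {h : Set Atom} {n : ℕ}
    (hP : ∀ k, (P k).Over V p 1) (hh : ∀ A ∈ h, A.Over V p n) {t : ITerm} (ht : IsTermOf P h t) :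
    t.Over V p (n + 1) := by
  rcases ht with ⟨A, hA, ht⟩ | ⟨k, ht, -⟩ | ⟨k, u, hu, A, hA, t', ht', rfl⟩
  · exact ITerm.Over.mono Vocab.Le.rfl id (Nat.le_succ n) (Atom.Over.iterms (hh A hA) ht)
  · exact ITerm.Over.mono Vocab.Le.rfl id (by omega) (Atom.Over.iterms (hP k) ht)
  · refine ITerm.Over.subst Vocab.Le.rfl (fun k hk => ?_) (Atom.Over.iterms (hh A hA) ht')
    cases k with
    | zero => exact ITerm.Over.mono Vocab.Le.rfl id (by omega) (Atom.Over.iterms (hP _) hu)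
    | succ k => exact (show k < n + 1 by omega)

theorem raise_over {c n d N : ℕ} {M : List (List Atom)} (h : ∀ l ∈ M, ∀ A ∈ l, A.Over V p N)
    (hN : N + n ≤ d) : ∀ l ∈ raise c n M, ∀ A ∈ l, A.Over V p d := by
  intro l hl A hA
  simp only [raise, List.mem_map] at hl
  obtain ⟨l, hl, rfl⟩ := hl
  obtain ⟨A, hA', rfl⟩ := List.mem_map.1 hA
  refine Atom.Over.subst Vocab.Le.rfl (fun k hk => ?_) (h l hl A hA')
  change (if k < c then k else k + n) < d
  split_ifs <;> omega

theorem PrenexDNF.or_over {φ ψ : PrenexDNF} {n : ℕ}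
    (h1 : ∀ l ∈ φ.matrix, ∀ A ∈ l, A.Over V p (n + φ.quants.length))
    (h2 : ∀ l ∈ ψ.matrix, ∀ A ∈ l, A.Over V p (n + ψ.quants.length)) :
    ∀ l ∈ (φ.or ψ).matrix, ∀ A ∈ l, A.Over V p (n + (φ.or ψ).quants.length) := by
  intro l hl
  simp only [PrenexDNF.or, List.mem_append] at hl
  have hlen : (φ.or ψ).quants.length = φ.quants.length + ψ.quants.length := by
    simp [PrenexDNF.or]
  exact hl.elim (raise_over h1 (by omega) l) (raise_over h2 (by omega) l)

theorem PrenexDNF.and_over {φ ψ : PrenexDNF} {n : ℕ}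
    (h1 : ∀ l ∈ φ.matrix, ∀ A ∈ l, A.Over V p (n + φ.quants.length))
    (h2 : ∀ l ∈ ψ.matrix, ∀ A ∈ l, A.Over V p (n + ψ.quants.length)) :
    ∀ l ∈ (φ.and ψ).matrix, ∀ A ∈ l, A.Over V p (n + (φ.and ψ).quants.length) := by
  intro l hl A hA
  simp only [PrenexDNF.and, List.mem_flatMap, List.mem_map] at hl
  have hlen : (φ.and ψ).quants.length = φ.quants.length + ψ.quants.length := by
    simp [PrenexDNF.and]
  obtain ⟨l1, hl1, l2, hl2, rfl⟩ := hl
  exact (List.mem_append.1 hA).elim (raise_over h1 (by omega) l1 hl1 A)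
    (raise_over h2 (by omega) l2 hl2 A)

theorem Formula.Over.prenex {φ : Formula} {n : ℕ} (h : φ.Over V p n) (b : Bool) :
    ∀ l ∈ (φ.prenex b).matrix, ∀ A ∈ l, A.Over V p (n + (φ.prenex b).quants.length) := by
  induction φ generalizing n b with
  | atom A =>
    intro l hl B hB
    simp only [Formula.prenex, List.mem_singleton] at hl
    subst hl
    rw [List.mem_singleton] at hB
    subst hB
    cases b
    exacts [h, Atom.Over.neg h]
  | not φ ih => exact ih h _
  | or φ ψ ih1 ih2 =>
    cases b
    exacts [PrenexDNF.or_over (ih1 h.1 _) (ih2 h.2 _), PrenexDNF.and_over (ih1 h.1 _) (ih2 h.2 _)]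
  | and φ ψ ih1 ih2 =>
    cases b
    exacts [PrenexDNF.and_over (ih1 h.1 _) (ih2 h.2 _), PrenexDNF.or_over (ih1 h.1 _) (ih2 h.2 _)]
  | ex φ ih =>
    have := ih h b
    simpa only [Formula.prenex, List.length_cons, add_assoc, add_comm 1] using this
  | all φ ih =>
    have := ih h b
    simpa only [Formula.prenex, List.length_cons, add_assoc, add_comm 1] using this

end Over

/-! ## Coincidence and substitution -/

/-- The interpretations agree on the parameters and index variables of `V` (of `V ⊎ V'`). -/
def NumsAgree (V : Vocab) (p : Bool) (ν ν' : Bool → Nums) : Prop :=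
  ∀ b, (b = true → p = true) → (∀ x < V.par, (ν b).par x = (ν' b).par x) ∧
    ∀ x < V.idx, (ν b).idx x = (ν' b).idx x

structure StatesAgree (V : Vocab) (p : Bool) (σ σ' : Bool → State) : Prop where
  nums : NumsAgree V p (fun b => (σ b).toNums) fun b => (σ' b).toNums
  dat : ∀ b, (b = true → p = true) → (σ b).dat = (σ' b).dat
  arr : ∀ b, (b = true → p = true) → (σ b).arr = (σ' b).arr

section Coincidence

variable {V V' : Vocab} {p : Bool} {n : ℕ} {e e' : ℕ → ℕ}

/-- Evaluation uses the vocabulary only through the array sizes. Well-formedness makes each size a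
parameter of `V`, on which the interpretations agree. -/
theorem ITerm.eval_congr {ν ν' : Bool → Nums} (hV : V.WF) (hs : V.size = V'.size)
    (h : NumsAgree V p ν ν') (he : ∀ k < n, e k = e' k) {t : ITerm} (ht : t.Over V p n) :
    t.eval V ν e = t.eval V' ν' e' := by
  induction t with
  | var x =>
    simp only [ITerm.eval]
    cases x with
    | par b x => exact congrArg _ ((h b ht.1).1 x ht.2)
    | idx b x => exact congrArg _ ((h b ht.1).2 x ht.2)
    | bnd k => exact congrArg _ (he k ht)
  | const c => rfl
  | size b a =>
    simp only [ITerm.eval, ← hs]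
    refine congrArg _ ((h b ht.1).1 _ (hV _ ?_))
    rw [List.getD_eq_getElem _ _ ht.2]
    exact List.getElem_mem _
  | plus I c ih => simp only [ITerm.eval, ih ht]

theorem DTerm.eval_congr {σ σ' : Bool → State} (hV : V.WF) (hs : V.size = V'.size)
    (h : StatesAgree V p σ σ') (he : ∀ k < n, e k = e' k) {t : DTerm} (ht : t.Over V p n) :
    t.eval V σ e = t.eval V' σ' e' := by
  induction t with
  | var b v => simp only [DTerm.eval, h.dat b ht.1]
  | const c => rfl
  | get b a I => simp only [DTerm.eval, h.arr b ht.1, ITerm.eval_congr hV hs h.nums he ht.2.2]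
  | plus I c ih => simp only [DTerm.eval, ih ht]

theorem Atom.eval_congr {σ σ' : Bool → State} (hV : V.WF) (hs : V.size = V'.size)
    (h : StatesAgree V p σ σ') (he : ∀ k < n, e k = e' k) {A : Atom} (hA : A.Over V p n) :
    A.eval V σ e ↔ A.eval V' σ' e' := by
  cases A with
  | idx c I J =>
    simp only [Atom.eval, ITerm.eval_congr hV hs h.nums he hA.1,
      ITerm.eval_congr hV hs h.nums he hA.2]
  | dat c E F =>
    simp only [Atom.eval, DTerm.eval_congr hV hs h he hA.1, DTerm.eval_congr hV hs h he hA.2]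

theorem push_congr (he : ∀ k < n, e k = e' k) (i : ℕ) : ∀ k < n + 1, push i e k = push i e' k
  | 0, _ => rfl
  | k + 1, hk => he k (Nat.lt_of_succ_lt_succ hk)

theorem Formula.eval_congr {σ σ' : Bool → State} (hV : V.WF) (hs : V.size = V'.size)
    (h : StatesAgree V p σ σ') (he : ∀ k < n, e k = e' k) {φ : Formula} (hφ : φ.Over V p n) :
    φ.eval V σ e ↔ φ.eval V' σ' e' := by
  induction φ generalizing n e e' with
  | atom A => exact Atom.eval_congr hV hs h he hφ
  | not φ ih => exact not_congr (ih he hφ)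
  | or φ ψ ih1 ih2 => exact or_congr (ih1 he hφ.1) (ih2 he hφ.2)
  | and φ ψ ih1 ih2 => exact and_congr (ih1 he hφ.1) (ih2 he hφ.2)
  | ex φ ih => exact exists_congr fun i => ih (push_congr he i) hφ
  | all φ ih => exact forall_congr' fun i => ih (push_congr he i) hφ

end Coincidence

section Substitution

variable {V : Vocab} {f : ℕ → ITerm} {e e' : ℕ → ℕ}

theorem ITerm.eval_subst {ν : Bool → Nums} (h : ∀ k, (f k).eval V ν e = e' k) (t : ITerm) :
    (t.subst f).eval V ν e = t.eval V ν e' := by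
  induction t with
  | var x =>
    cases x with
    | bnd k => exact h k
    | _ => rfl
  | const c => rfl
  | size b a => rfl
  | plus I c ih => simp only [ITerm.subst, ITerm.eval, ih]

theorem DTerm.eval_subst {σ : Bool → State}
    (h : ∀ k, (f k).eval V (fun b => (σ b).toNums) e = e' k) (t : DTerm) :
    (t.subst f).eval V σ e = t.eval V σ e' := by
  induction t with
  | get b a I => simp only [DTerm.subst, DTerm.eval, ITerm.eval_subst h]
  | plus I c ih => simp only [DTerm.subst, DTerm.eval, ih]
  | _ => rfl

theorem Atom.eval_subst {σ : Bool → State}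
    (h : ∀ k, (f k).eval V (fun b => (σ b).toNums) e = e' k) (A : Atom) :
    (A.subst f).eval V σ e ↔ A.eval V σ e' := by
  cases A with
  | idx c I J => simp only [Atom.subst, Atom.eval, ITerm.eval_subst h]
  | dat c E F => simp only [Atom.subst, Atom.eval, DTerm.eval_subst h]

theorem eval_under {ν : Bool → Nums} (h : ∀ k, (f k).eval V ν e = e' k) (n : ℕ) :
    ∀ k, (under f k).eval V ν (push n e) = push n e' k
  | 0 => rfl
  | k + 1 => by
    rw [under, ITerm.eval_subst (e' := e) (fun _ => rfl), h]
    rfl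

theorem Formula.eval_subst {σ : Bool → State}
    (h : ∀ k, (f k).eval V (fun b => (σ b).toNums) e = e' k) (φ : Formula) :
    (φ.subst f).eval V σ e ↔ φ.eval V σ e' := by
  induction φ generalizing e e' f with
  | atom A => exact Atom.eval_subst h A
  | not φ ih => exact not_congr (ih h)
  | or φ ψ ih1 ih2 => exact or_congr (ih1 h) (ih2 h)
  | and φ ψ ih1 ih2 => exact and_congr (ih1 h) (ih2 h)
  | ex φ ih => exact exists_congr fun i => ih (eval_under h i)
  | all φ ih => exact forall_congr' fun i => ih (eval_under h i)

/-- Bound variables range over `ℕ` while terms take integer values, so instantiation can be traded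
for an environment only at nonnegative terms. -/
theorem Atom.eval_inst {σ : Bool → State} {t : ITerm}
    (ht : 0 ≤ t.eval V (fun b => (σ b).toNums) e) (A : Atom) :
    (A.inst t).eval V σ e ↔
      A.eval V σ (push (t.eval V (fun b => (σ b).toNums) e).toNat e) := by
  refine Atom.eval_subst (fun k => ?_) A
  cases k with
  | zero => exact (Int.toNat_of_nonneg ht).symm
  | succ k => rfl

theorem ITerm.eval_prime (ν : Bool → Nums) (t : ITerm) :
    t.prime.eval V ν e = t.eval V (fun _ => ν true) e := by
  induction t with
  | var x => cases x <;> rfl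
  | const c => rfl
  | size b a => rfl
  | plus I c ih => simp only [ITerm.prime, ITerm.eval, ih]

theorem DTerm.eval_prime (σ : Bool → State) (t : DTerm) :
    t.prime.eval V σ e = t.eval V (fun _ => σ true) e := by
  induction t with
  | get b a I => simp only [DTerm.prime, DTerm.eval, ITerm.eval_prime]
  | plus I c ih => simp only [DTerm.prime, DTerm.eval, ih]
  | _ => rfl

theorem Atom.eval_prime (σ : Bool → State) (A : Atom) :
    A.prime.eval V σ e ↔ A.eval V (fun _ => σ true) e := by
  cases A with
  | idx c I J => simp only [Atom.prime, Atom.eval, ITerm.eval_prime]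
  | dat c E F => simp only [Atom.prime, Atom.eval, DTerm.eval_prime]

theorem Atom.eval_neg (σ : Bool → State) (A : Atom) : A.neg.eval V σ e ↔ ¬ A.eval V σ e := by
  rcases A with ⟨c, I, J⟩ | ⟨c, E, F⟩ <;> cases c <;> simp [Atom.neg, Cmp.neg, Atom.eval, Cmp.eval]

end Substitution

/-! ## Correctness of the prenex form -/

section Prenex

theorem quantSat_congr (q : List Bool) {r r' : (ℕ → ℕ) → Prop} (h : ∀ e, r e ↔ r' e)
    (e : ℕ → ℕ) : quantSat q r e ↔ quantSat q r' e := by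
  rw [show r = r' from funext fun e => propext (h e)]

theorem quantSat_mono (q : List Bool) {r r' : (ℕ → ℕ) → Prop} (h : ∀ e, r e → r' e)
    {e : ℕ → ℕ} (hr : quantSat q r e) : quantSat q r' e := by
  induction q generalizing e with
  | nil => exact h e hr
  | cons b q ih =>
    cases b
    · exact hr.imp fun n hn => ih hn
    · exact fun n => ih (hr n)

theorem quantSat_append (q q' : List Bool) (r : (ℕ → ℕ) → Prop) (e : ℕ → ℕ) :
    quantSat (q ++ q') r e ↔ quantSat q (quantSat q' r) e := by
  induction q generalizing e with
  | nil => rfl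
  | cons b q ih =>
    cases b
    · exact exists_congr fun n => ih _
    · exact forall_congr' fun n => ih _

/-- A connective that commutes with quantifiers in its second argument. -/
structure IsMonadic (op : Prop → Prop → Prop) : Prop where
  all : ∀ (a : Prop) (r : ℕ → Prop), op a (∀ n, r n) ↔ ∀ n, op a (r n)
  ex : ∀ (a : Prop) (r : ℕ → Prop), op a (∃ n, r n) ↔ ∃ n, op a (r n)

/-- Commutation with `∃` here, and with `∀` in the case of conjunction, uses that the range `ℕ` is
nonempty. -/
theorem isMonadic_or : IsMonadic Or where
  all a r := by rw [forall_or_left]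
  ex a r := by rw [exists_or, exists_const]

theorem isMonadic_and : IsMonadic And where
  all a r := by rw [forall_and, forall_const]
  ex a r := by rw [exists_and_left]

/-- The argument `s` skips the `q.length` innermost variables, so the block `q` does not bind
anything in it. -/
theorem quantSat_op {op : Prop → Prop → Prop} (hop : IsMonadic op) (q : List Bool)
    (s r : (ℕ → ℕ) → Prop) (e : ℕ → ℕ) :
    quantSat q (fun e' => op (s fun k => e' (k + q.length)) (r e')) e ↔
      op (s e) (quantSat q r e) := by
  induction q generalizing e s with
  | nil => rfl
  | cons b q ih =>
    have key : ∀ n, quantSat q (fun e' => op (s fun k => e' (k + (b :: q).length)) (r e'))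
        (push n e) ↔ op (s e) (quantSat q r (push n e)) := by
      intro n
      have := ih (fun e => s fun k => e (k + 1)) (push n e)
      simp only [push, add_right_comm _ 1 q.length] at this
      exact this
    cases b
    · exact (exists_congr key).trans (hop.ex _ _).symm
    · exact (forall_congr' key).trans (hop.all _ _).symm

/-- A renumbering that spares the variables bound by `q` can be moved outside the block. -/
theorem quantSat_skip (q : List Bool) (c n : ℕ) (r : (ℕ → ℕ) → Prop) (e : ℕ → ℕ) :
    quantSat q (fun e' => r fun k => e' (if k < c + q.length then k else k + n)) e ↔
      quantSat q r fun k => e (if k < c then k else k + n) := by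
  induction q generalizing e c with
  | nil => rfl
  | cons b q ih =>
    have key : ∀ i, quantSat q (fun e' => r fun k => e' (if k < c + (b :: q).length then k
        else k + n)) (push i e) ↔
        quantSat q r (push i fun k => e (if k < c then k else k + n)) := by
      intro i
      have := ih (c + 1) (push i e)
      simp only [List.length_cons]
      simp only [add_assoc, add_comm 1] at this
      rw [this, iff_iff_eq]
      congr 1
      funext k
      cases k with
      | zero => rw [if_pos (Nat.succ_pos c)]; rfl
      | succ k =>
        by_cases hk : k < c
        · rw [if_pos (Nat.succ_lt_succ hk)]
          simp only [push, if_pos hk]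
        · rw [if_neg fun h => hk (Nat.lt_of_succ_lt_succ h), add_right_comm]
          simp only [push, if_neg hk]
    cases b
    · exact exists_congr key
    · exact forall_congr' key

/-- Combine two blocks of quantifiers. -/
theorem quantSat_combine {op : Prop → Prop → Prop} (hop : IsMonadic op)
    (hop' : IsMonadic fun a b => op b a) (q q' : List Bool) (s r : (ℕ → ℕ) → Prop) (e : ℕ → ℕ) :
    quantSat (q ++ q') (fun e' => op (s fun k => e' (k + q'.length))
      (r fun k => e' (if k < q'.length then k else k + q.length))) e ↔
      op (quantSat q s e) (quantSat q' r e) := by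
  rw [quantSat_append]
  have h1 : ∀ e, quantSat q' (fun e' => op (s fun k => e' (k + q'.length))
      (r fun k => e' (if k < q'.length then k else k + q.length))) e ↔
      op (s e) (quantSat q' r fun k => e (k + q.length)) := by
    intro e
    rw [quantSat_op hop q' s]
    have := quantSat_skip q' 0 q.length r e
    simp only [zero_add, Nat.not_lt_zero, if_false] at this
    rw [propext this]
  rw [quantSat_congr q h1]
  exact quantSat_op hop' q (quantSat q' r) s e

/-- Truth of a matrix. -/
def matrixEval (V : Vocab) (σ : Bool → State) (M : List (List Atom)) (e : ℕ → ℕ) : Prop :=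
  ∃ c ∈ M, ∀ A ∈ c, A.eval V σ e

variable {V : Vocab} {σ : Bool → State}

theorem exists_mem_raise {c n : ℕ} {M : List (List Atom)} {e : ℕ → ℕ} :
    (∃ l ∈ raise c n M, ∀ A ∈ l, A.eval V σ e) ↔
      matrixEval V σ M fun k => e (if k < c then k else k + n) := by
  have h : ∀ A : Atom, (A.subst fun k => .var (.bnd (if k < c then k else k + n))).eval V σ e ↔
      A.eval V σ fun k => e (if k < c then k else k + n) :=
    fun A => Atom.eval_subst (fun k => rfl) A
  simp only [raise, matrixEval, List.mem_map, exists_exists_and_eq_and, forall_exists_index,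
    and_imp, forall_apply_eq_imp_iff₂, h]

theorem PrenexDNF.sat_or (φ ψ : PrenexDNF) (e : ℕ → ℕ) :
    quantSat (φ.or ψ).quants (matrixEval V σ (φ.or ψ).matrix) e ↔
      quantSat φ.quants (matrixEval V σ φ.matrix) e ∨
        quantSat ψ.quants (matrixEval V σ ψ.matrix) e := by
  rw [← quantSat_combine isMonadic_or ⟨fun a r => by rw [forall_or_right], fun a r => by
    rw [exists_or, exists_const]⟩]
  refine quantSat_congr _ (fun e => ?_) e
  simp only [PrenexDNF.or, matrixEval, List.mem_append, or_and_right, exists_or]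
  rw [exists_mem_raise, exists_mem_raise]
  simp [matrixEval]

theorem PrenexDNF.sat_and (φ ψ : PrenexDNF) (e : ℕ → ℕ) :
    quantSat (φ.and ψ).quants (matrixEval V σ (φ.and ψ).matrix) e ↔
      quantSat φ.quants (matrixEval V σ φ.matrix) e ∧
        quantSat ψ.quants (matrixEval V σ ψ.matrix) e := by
  rw [← quantSat_combine isMonadic_and ⟨fun a r => by rw [forall_and, forall_const], fun a r => by
    rw [exists_and_right]⟩]
  refine quantSat_congr _ (fun e => ?_) e
  have h1 := exists_mem_raise (V := V) (σ := σ) (c := 0) (n := ψ.quants.length) (M := φ.matrix)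
    (e := e)
  have h2 := exists_mem_raise (V := V) (σ := σ) (c := ψ.quants.length) (n := φ.quants.length)
    (M := ψ.matrix) (e := e)
  simp only [Nat.not_lt_zero, if_false] at h1
  rw [← h1, ← h2]
  constructor
  · rintro ⟨l, hl, h⟩
    simp only [PrenexDNF.and, List.mem_flatMap, List.mem_map] at hl
    obtain ⟨l1, hl1, l2, hl2, rfl⟩ := hl
    exact ⟨⟨l1, hl1, fun A hA => h A (List.mem_append_left _ hA)⟩,
      l2, hl2, fun A hA => h A (List.mem_append_right _ hA)⟩
  · rintro ⟨⟨l1, hl1, h1⟩, l2, hl2, h2⟩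
    refine ⟨l1 ++ l2, ?_, fun A hA => (List.mem_append.1 hA).elim (h1 A) (h2 A)⟩
    simp only [PrenexDNF.and, List.mem_flatMap, List.mem_map]
    exact ⟨l1, hl1, l2, hl2, rfl⟩

theorem Formula.sat_prenex (φ : Formula) (b : Bool) (e : ℕ → ℕ) :
    quantSat (φ.prenex b).quants (matrixEval V σ (φ.prenex b).matrix) e ↔
      (if b then ¬ φ.eval V σ e else φ.eval V σ e) := by
  induction φ generalizing b e with
  | atom A =>
    cases b
    · simp [Formula.prenex, quantSat, matrixEval, Formula.eval]
    · simp [Formula.prenex, quantSat, matrixEval, Formula.eval, Atom.eval_neg]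
  | not φ ih =>
    rw [Formula.prenex, ih]
    cases b <;> simp [Formula.eval]
  | or φ ψ ih1 ih2 =>
    cases b
    · rw [Formula.prenex, if_neg (by simp), PrenexDNF.sat_or, ih1, ih2]
      simp [Formula.eval]
    · rw [Formula.prenex, if_pos rfl, PrenexDNF.sat_and, ih1, ih2]
      simp [Formula.eval]
  | and φ ψ ih1 ih2 =>
    cases b
    · rw [Formula.prenex, if_neg (by simp), PrenexDNF.sat_and, ih1, ih2]
      simp [Formula.eval]
    · rw [Formula.prenex, if_pos rfl, PrenexDNF.sat_or, ih1, ih2]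
      simp [Formula.eval, imp_iff_not_or]
  | ex φ ih =>
    cases b
    · exact (exists_congr fun n => ih false _).trans (by simp [Formula.eval])
    · exact (forall_congr' fun n => ih true _).trans (by simp [Formula.eval])
  | all φ ih =>
    cases b
    · exact (forall_congr' fun n => ih false _).trans (by simp [Formula.eval])
    · exact (exists_congr fun n => ih true _).trans (by simp [Formula.eval])

end Prenex

end ArrayAbs

namespace ArrayAbs

/-! ## Soundness of the abstraction -/

section Soundness

variable {V : Vocab} {p : Bool} {m : ℕ}

/-- An implied clause has a literal that is true in `σ` itself, and within bounds the word records
exactly the truth values of `σ`. -/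
theorem matrixSat_of_eval {P : Fin m → Atom} (hV : V.WF) (hP : ∀ k, (P k).Over V p 1)
    {σ : Bool → State} {ν : Bool → Nums} (hν : NumsAgree V p (fun b => (σ b).toNums) ν)
    {w : BWord m} (hw : Describes V P σ w) {n : ℕ} {c : List Atom} {e : ℕ → ℕ}
    (hc : ∀ A ∈ c, A.Over V p n) (h : ∀ A ∈ c, A.eval V σ e) :
    (∀ A ∈ c, A.evalIdx V ν e) ∧
      ∀ C : List (Lit m), IsConstrClause V P {A | A ∈ c ∧ A.IsData} C →
        ∃ l ∈ C, l.kappa V ν w e := by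
  refine ⟨fun A hA => ?_, fun C hC => ?_⟩
  · have h1 := h A hA
    have h2 := hc A hA
    cases A with
    | dat c E F => trivial
    | idx c I J =>
      rw [Atom.eval, ITerm.eval_congr (e' := e) hV rfl hν (fun _ _ => rfl) h2.1,
        ITerm.eval_congr (e' := e) hV rfl hν (fun _ _ => rfl) h2.2] at h1
      exact h1
  · obtain ⟨l, hl, hlt⟩ := hC.2 σ e fun A hA => h A hA.1
    refine ⟨l, hl, fun h1 h2 => ?_⟩
    rw [Lit.eval] at hlt
    have ht : l.t.Over V p (n + 1) := (hC.1 l hl).over hP fun A hA => hc A hA.1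
    have heq : l.t.eval V (fun b => (σ b).toNums) e = l.t.eval V ν e :=
      ITerm.eval_congr hV rfl hν (fun _ _ => rfl) ht
    -- The literal is instantiated with a term, the description with its value. Both amount to
    -- pushing the same number, and a predicate contains no other bound variable.
    rw [← hw _ h1 h2 l.k, ← hlt, Atom.eval_inst (by exact le_trans (by simp) h1),
      Atom.eval_inst (by rw [heq]; omega), heq]
    refine Atom.eval_congr hV rfl ⟨fun _ _ => ⟨fun _ _ => rfl, fun _ _ => rfl⟩, fun _ _ => rfl,
      fun _ _ => rfl⟩ (fun k hk => ?_) (hP l.k)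
    rw [Nat.lt_one_iff.1 hk]
    rfl

/-- The abstraction of a formula holds wherever the formula holds. -/
theorem Formula.absSat_of_eval {P : Fin m → Atom} (hV : V.WF) (hP : ∀ k, (P k).Over V p 1)
    {σ : Bool → State} {ν : Bool → Nums} (hν : NumsAgree V p (fun b => (σ b).toNums) ν)
    {w : BWord m} (hw : Describes V P σ w) {φ : Formula} (hφ : φ.Over V p 0)
    (h : φ.eval V σ fun _ => 0) : φ.absSat V P ν w := by
  have h1 := (Formula.sat_prenex (V := V) (σ := σ) φ false fun _ => 0).2 h
  -- The abstraction weakens only the matrix, so alternation of quantifiers does no harm.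
  refine quantSat_mono _ (fun e => ?_) h1
  rintro ⟨c, hc, hA⟩
  exact ⟨c, hc, matrixSat_of_eval hV hP hν hw (hφ.prenex false c hc) hA⟩

theorem numsAgree_restrict (s : State) :
    NumsAgree V p (fun _ => s.toNums) fun _ => (s.restrict V).toNums := by
  refine fun _ _ => ⟨fun x hx => ?_, fun x hx => ?_⟩
  · simp [AbsNums.toNums, State.restrict, hx]
  · simp [AbsNums.toNums, State.restrict, hx]

theorem numsAgree_join (s t : State) :
    NumsAgree V p (fun b => (join s t b).toNums)
      (join (s.restrict V).toNums (t.restrict V).toNums) := by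
  intro b _
  cases b
  · exact numsAgree_restrict (p := true) s false fun _ => rfl
  · exact numsAgree_restrict (p := true) t false fun _ => rfl

theorem alpha_subset_absStates {P : Fin m → Atom} (hV : V.WF) (hP : ∀ k, (P k).Over V false 1)
    {φ : Formula} (hφ : φ.Over V false 0) :
    alpha V P {s | φ.Sat V s} ⊆ absStates V P φ := by
  rintro ⟨a, w⟩ ⟨s, hs, rfl, hl, hd⟩
  exact ⟨hl, Formula.absSat_of_eval hV hP (numsAgree_restrict s) hd hφ hs⟩

theorem mem_absTrans {P : Fin m → Atom} (hV : V.WF) (hP : ∀ k, (P k).Over V false 1)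
    {φ : Formula} (hφ : φ.Over V true 0) {s t : State} (hst : Step V φ s t) {u v : BWord m}
    (hu : u.length = (s.restrict V).maxPar) (hv : v.length = (t.restrict V).maxPar)
    (hd : Describes V (starPred P) (join s t) (conv u v)) :
    ((s.restrict V, u), (t.restrict V, v)) ∈ absTrans V P φ :=
  ⟨hu, hv, funext fun x => hst.2 x x.2,
    Formula.absSat_of_eval hV (starPred_over hP) (numsAgree_join s t) hd hφ hst.1⟩

theorem maxPar_restrict_eq {φ : Formula} {s t : State} (hst : Step V φ s t) :
    (t.restrict V).maxPar = (s.restrict V).maxPar := by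
  have : (s.restrict V).par = (t.restrict V).par := funext fun x => hst.2 x x.2
  rw [AbsNums.maxPar, AbsNums.maxPar, this]

theorem conv_halves {m n : ℕ} (w : BWord (m + n)) :
    conv (w.map fun a k => a (Fin.castAdd n k)) (w.map fun a k => a (Fin.natAdd m k)) = w := by
  refine List.ext_getElem (by simp [conv]) fun i h1 h2 => funext fun k => ?_
  rw [← List.getD_eq_getElem (d := fun _ => false) _ h1, getD_conv,
    List.getD_eq_getElem _ _ (by simpa using h2), List.getD_eq_getElem _ _ (by simpa using h2),
    List.getElem_map, List.getElem_map]
  refine Fin.addCases (fun k => ?_) (fun k => ?_) k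
  · rw [Fin.append_left]
  · rw [Fin.append_right]

theorem alphaTrans_subset {P : Fin m → Atom} (hV : V.WF) (hP : ∀ k, (P k).Over V false 1)
    {φ : Formula} (hφ : φ.Over V true 0) :
    alphaTrans V P {p | Step V φ p.1 p.2} ⊆ tau '' absTrans V P φ := by
  rintro ⟨a, w⟩ ⟨⟨s, t⟩, hst, ha, hl, hd⟩
  dsimp only at ha hl hd hst
  subst ha
  rw [maxPar_restrict_eq hst, max_self] at hl
  -- Every letter is cut into its unprimed and primed bits. Since parameters do not change in a
  -- step, both halves have the required length.
  have hw := conv_halves w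
  refine ⟨((s.restrict V, w.map fun a k => a (Fin.castAdd m k)),
    (t.restrict V, w.map fun a k => a (Fin.natAdd m k))), mem_absTrans hV hP hφ hst ?_ ?_ ?_, ?_⟩
  · rw [List.length_map, hl]
  · rw [List.length_map, hl, maxPar_restrict_eq hst]
  · rwa [hw]
  · rw [tau, hw]

/-- The word of the truth values of the predicates. -/
noncomputable def describing (V : Vocab) (P : Fin m → Atom) (s : State) : BWord m :=
  open Classical in
  (List.range (s.restrict V).maxPar).map fun (i : ℕ) k =>
    decide (((P k).inst (.const ((i : ℤ) + 1))).eval V (fun _ => s) fun _ => 0)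

theorem length_describing (P : Fin m → Atom) (s : State) :
    (describing V P s).length = (s.restrict V).maxPar := by simp [describing]

theorem describes_describing (P : Fin m → Atom) (s : State) :
    Describes V P (fun _ => s) (describing V P s) := by
  classical
  intro i h1 h2 k
  obtain ⟨j, rfl⟩ : ∃ j : ℕ, i = j + 1 := ⟨(i - 1).toNat, by omega⟩
  have hj : j < (describing V P s).length := by omega
  rw [delta_iff, and_iff_right h1, show ((j : ℤ) + 1 - 1).toNat = j by omega,
    List.getD_eq_getElem _ _ hj]
  have : (describing V P s)[j] = fun k : Fin m =>
      decide (((P k).inst (.const ((j : ℤ) + 1))).eval V (fun _ => s) fun _ => 0) := by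
    simp only [describing]
    rw [List.getElem_map, List.getElem_range]
  rw [this, decide_eq_true_iff]

theorem eval_inst_const {A : Atom} {σ : Bool → State} {e : ℕ → ℕ} {i : ℤ} (hi : 1 ≤ i) :
    (A.inst (.const i)).eval V σ e ↔ A.eval V σ (push i.toNat e) :=
  Atom.eval_inst (by exact le_trans (by simp) hi) A

/-- Unprimed predicates inspect only the first state and primed ones only the second. Equal lengths
matter: padding in a convolution would otherwise count as truth values. -/
theorem describes_conv {P : Fin m → Atom} (hV : V.WF) (hP : ∀ k, (P k).Over V false 1)
    {s t : State} {u v : BWord m} (hl : v.length = u.length)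
    (hu : Describes V P (fun _ => s) u) (hv : Describes V P (fun _ => t) v) :
    Describes V (starPred P) (join s t) (conv u v) := by
  intro i h1 h2 k
  rw [length_conv, hl, max_self] at h2
  rw [delta_iff, and_iff_right h1, getD_conv, eval_inst_const h1]
  refine Fin.addCases (fun k => ?_) (fun k => ?_) k
  · have h3 := hu i h1 h2 k
    rw [delta_iff, and_iff_right h1, eval_inst_const h1] at h3
    rw [starPred, Fin.append_left, Fin.append_left, ← h3]
    refine Atom.eval_congr hV rfl ⟨fun b hb => ?_, fun b hb => ?_, fun b hb => ?_⟩
      (fun _ _ => rfl) (hP k) <;> cases b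
    all_goals first | exact ⟨fun _ _ => rfl, fun _ _ => rfl⟩ | rfl | simp at hb
  · have h3 := hv i h1 (hl ▸ h2) k
    rw [delta_iff, and_iff_right h1, eval_inst_const h1] at h3
    rw [starPred, Fin.append_right, Fin.append_right, ← h3, Atom.eval_prime]
    rfl

end Soundness

/-! ## Safety -/

section Safety

/-- The state with the values `e 0, e 1, …` for the fresh parameters. -/
def State.extend (V : Vocab) (e : ℕ → ℕ) (s : State) : State :=
  { s with par := fun x => if x < V.par then s.par x else e (x - V.par) }

theorem statesAgree_extend (V : Vocab) (p : Bool) (e : ℕ → ℕ) (σ : Bool → State) :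
    StatesAgree V p σ fun b => (σ b).extend V e :=
  ⟨fun _ _ => ⟨fun _ hx => (if_pos hx).symm, fun _ _ => rfl⟩, fun _ _ => rfl, fun _ _ => rfl⟩

theorem Formula.eval_extend {V : Vocab} (hV : V.WF) (k : ℕ) {p : Bool} {n : ℕ} {φ : Formula}
    (hφ : φ.Over V p n) (σ : Bool → State) (e e' : ℕ → ℕ) :
    φ.eval (V.star k) (fun b => (σ b).extend V e) e' ↔ φ.eval V σ e' :=
  (Formula.eval_congr (V' := V.star k) hV rfl (statesAgree_extend V p e σ) (fun _ _ => rfl)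
    hφ).symm

/-- The fresh parameter with number `V.par + j` carries the value `e j`, just as the dangling
variable `j` did. -/
theorem Formula.sat_star {V : Vocab} (hV : V.WF) {k : ℕ} {ψ : Formula} (hψ : ψ.Over V false k)
    (s : State) (e : ℕ → ℕ) :
    (ψ.star V).Sat (V.star k) (s.extend V e) ↔ ψ.eval V (fun _ => s) e := by
  rw [← Formula.eval_extend hV k hψ (fun _ => s) e e]
  refine Formula.eval_subst (fun j => ?_) ψ
  simp [ITerm.eval, IVar.eval, State.extend]

theorem TFormula.eval_alls (V : Vocab) (L : ℕ∞) (s : ℕ → State) (k : ℕ) (φ : TFormula) (i : ℕ)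
    {e : ℕ → ℕ} (h : ¬ (TFormula.alls k φ).eval V L s i e) : ∃ e', ¬ φ.eval V L s i e' := by
  induction k generalizing e with
  | zero => exact ⟨e, h⟩
  | succ k ih =>
    rw [TFormula.alls, TFormula.eval, not_forall] at h
    obtain ⟨n, h⟩ := h
    exact ih h

/-- A counterexample fixes a path, values for the universal variables, and a position where `ψ₂`
fails. With the values stored in the fresh parameters, the words of truth values turn the path into
an abstract run into `B`. -/
theorem holds_of_safetyHolds {S : ArraySystem} {φ : SafetyProperty} {m : ℕ} {P : Fin m → Atom}
    (hS : S.WF) (hφ : φ.WF S.V) (hP : ∀ k, (P k).Over (S.V.star φ.k) false 1)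
    (h : SafetyHolds (absStates (S.V.star φ.k) P (initStar S φ))
      (absTrans (S.V.star φ.k) P S.trans) (absStates (S.V.star φ.k) P (badStar S φ))) :
    S.Holds φ.toTemporal := by
  rintro ⟨L, s, ⟨h0, hstep⟩, hneg⟩
  have hV := hS.1
  have hV' := hV.star φ.k
  obtain ⟨e, he⟩ := TFormula.eval_alls S.V L s φ.k _ 0 hneg
  simp only [TFormula.eval, not_or, not_not, not_forall] at he
  obtain ⟨hpre, j, -, hj, hpost⟩ := he
  let s' : ℕ → State := fun i => (s i).extend S.V e
  let a : ℕ → AbsState (S.V.star φ.k) m := fun i =>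
    ((s' i).restrict _, describing (S.V.star φ.k) P (s' i))
  have hinit : (initStar S φ).Over (S.V.star φ.k) false 0 :=
    ⟨Formula.Over.mono (S.V.le_star φ.k) id le_rfl hS.2.1, Formula.Over.star hφ.1⟩
  have hbad : (badStar S φ).Over (S.V.star φ.k) false 0 := Formula.Over.star (k := φ.k) hφ.2
  have hα : ∀ ψ : Formula, ∀ i, ψ.Sat (S.V.star φ.k) (s' i) →
      a i ∈ alpha (S.V.star φ.k) P {s | ψ.Sat (S.V.star φ.k) s} := fun ψ i hi =>
    ⟨s' i, hi, rfl, length_describing P _, describes_describing P _⟩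
  have hI : a 0 ∈ absStates (S.V.star φ.k) P (initStar S φ) :=
    alpha_subset_absStates hV' hP hinit <| hα _ 0
      ⟨(Formula.eval_extend hV φ.k hS.2.1 (fun _ => s 0) e _).2 h0,
        (Formula.sat_star hV hφ.1 (s 0) e).2 hpre⟩
  have hB : a j ∈ absStates (S.V.star φ.k) P (badStar S φ) :=
    alpha_subset_absStates hV' hP hbad <| hα _ j fun hc =>
      hpost ((Formula.sat_star hV hφ.2 (s j) e).1 hc)
  have hT : ∀ i : ℕ, ((i + 1 : ℕ) : ℕ∞) ≤ L →
      (a i, a (i + 1)) ∈ absTrans (S.V.star φ.k) P S.trans := by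
    intro i hi
    have hst : Step (S.V.star φ.k) S.trans (s' i) (s' (i + 1)) := by
      refine ⟨?_, fun x _ => ?_⟩
      · have := (Formula.eval_extend hV φ.k hS.2.2 (join (s i) (s (i + 1))) e fun _ => 0).2
          (hstep i hi).1
        rwa [show (fun b => (join (s i) (s (i + 1)) b).extend S.V e) =
          join (s' i) (s' (i + 1)) from funext fun b => by cases b <;> rfl] at this
      -- Old parameters are preserved by the step, and fresh ones carry the same `e` in all states.
      · change ite _ _ _ = ite _ _ _
        split_ifs with hx
        exacts [(hstep i hi).2 x hx, rfl]
    refine mem_absTrans hV' hP (Formula.Over.mono (S.V.le_star φ.k) id le_rfl hS.2.2) hst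
      (length_describing P _) (length_describing P _) (describes_conv hV' hP ?_
        (describes_describing P _) (describes_describing P _))
    rw [length_describing, length_describing, maxPar_restrict_eq hst]
  have hreach : ∀ i : ℕ, (i : ℕ∞) ≤ L →
      Relation.ReflTransGen (fun x y => (x, y) ∈ absTrans (S.V.star φ.k) P S.trans) (a 0) (a i) := by
    intro i
    induction i with
    | zero => exact fun _ => Relation.ReflTransGen.refl
    | succ i ih =>
      intro hi
      exact (ih (le_trans (by exact_mod_cast Nat.le_succ i) hi)).tail (hT i hi)
  exact Set.eq_empty_iff_forall_notMem.1 h (a j) ⟨⟨a 0, hI, hreach j hj⟩, hB⟩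

end Safety

end ArrayAbs

namespace ArrayAbs

open Encodable

/-! ## The abstraction is primitive recursive -/

section Program

variable {α β γ σ : Type} [Primcodable α] [Primcodable β] [Primcodable γ] [Primcodable σ]

/-! ### Constructors and substitutions -/

@[fun_prop] theorem primrec_equivSum {x : α → IVar} (hx : Primrec x) :
    Primrec fun a => IVar.equivSum (x a) := Primrec.of_equiv.comp hx

@[fun_prop] theorem primrec_equivSum_symm {x : α → (Bool × ℕ) ⊕ (Bool × ℕ) ⊕ ℕ} (hx : Primrec x) :
    Primrec fun a => IVar.equivSum.symm (x a) := Primrec.of_equiv_symm.comp hx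

@[fun_prop] theorem primrec_par {b : α → Bool} {x : α → ℕ} (hb : Primrec b) (hx : Primrec x) :
    Primrec fun a => IVar.par (b a) (x a) := by
  have h : Primrec fun a => IVar.equivSum.symm (.inl (b a, x a)) := by fun_prop
  exact h

@[fun_prop] theorem primrec_idx {b : α → Bool} {x : α → ℕ} (hb : Primrec b) (hx : Primrec x) :
    Primrec fun a => IVar.idx (b a) (x a) := by
  have h : Primrec fun a => IVar.equivSum.symm (.inr (.inl (b a, x a))) := by fun_prop
  exact h

@[fun_prop] theorem primrec_bnd {x : α → ℕ} (hx : Primrec x) :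
    Primrec fun a => IVar.bnd (x a) := by
  have h : Primrec fun a => IVar.equivSum.symm (.inr (.inr (x a))) := by fun_prop
  exact h

@[fun_prop] theorem primrec_cmpNeg {c : α → Cmp} (hc : Primrec c) : Primrec fun a => (c a).neg :=
  (Primrec.dom_finite Cmp.neg).comp hc

@[fun_prop] theorem primrec_idxVal {z : α → IVar → ℤ} {t : α → NIdx}
    (hz : Primrec fun p : α × IVar => z p.1 p.2) (ht : Primrec t) :
    Primrec fun a => idxVal (z a) (t a) := by
  unfold idxVal; fun_prop

@[fun_prop] theorem primrec_readCell {z : α → IVar → ℤ} {r : α → Read}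
    (hz : Primrec fun p : α × IVar => z p.1 p.2) (hr : Primrec r) :
    Primrec fun a => readCell (z a) (r a) := by
  -- Extends the hypothesis to arbitrary parameter types, since `z` is applied beneath binders where
  -- further variables are in scope.
  have h : ∀ {β : Type} [Primcodable β] {f : β → α} {g : β → IVar}, Primrec f →
      Primrec g → Primrec fun b => z (f b) (g b) := fun hf hg => hz.comp (hf.pair hg)
  unfold readCell
  fun_prop (disch := assumption)

@[fun_prop] theorem primrec_datVal {d : α → Read → ℤ} {t : α → NDat}
    (hd : Primrec fun p : α × Read => d p.1 p.2) (ht : Primrec t) :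
    Primrec fun a => datVal (d a) (t a) := by
  unfold datVal; fun_prop

@[fun_prop] theorem primrec_bindIdx {f : α → IVar → NIdx} {t : α → NIdx}
    (hf : Primrec fun p : α × IVar => f p.1 p.2) (ht : Primrec t) :
    Primrec fun a => bindIdx (f a) (t a) := by
  unfold bindIdx; fun_prop

@[fun_prop] theorem primrec_bindRead {f : α → IVar → NIdx} {t : α → Read}
    (hf : Primrec fun p : α × IVar => f p.1 p.2) (ht : Primrec t) :
    Primrec fun a => bindRead (f a) (t a) := by
  have h : ∀ {β : Type} [Primcodable β] {u : β → α} {v : β → IVar}, Primrec u →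
      Primrec v → Primrec fun b => f (u b) (v b) := fun hu hv => hf.comp (hu.pair hv)
  unfold bindRead
  fun_prop (disch := assumption)

@[fun_prop] theorem primrec_bindDat {f : α → IVar → NIdx} {t : α → NDat}
    (hf : Primrec fun p : α × IVar => f p.1 p.2) (ht : Primrec t) :
    Primrec fun a => bindDat (f a) (t a) := by
  have h : ∀ {β : Type} [Primcodable β] {u : β → α} {v : β → IVar}, Primrec u →
      Primrec v → Primrec fun b => f (u b) (v b) := fun hu hv => hf.comp (hu.pair hv)
  unfold bindDat
  fun_prop (disch := assumption)

@[fun_prop] theorem primrec_bindAtom {f : α → IVar → NIdx} {t : α → NAtom}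
    (hf : Primrec fun p : α × IVar => f p.1 p.2) (ht : Primrec t) :
    Primrec fun a => bindAtom (f a) (t a) := by
  have h : ∀ {β : Type} [Primcodable β] {u : β → α} {v : β → IVar}, Primrec u →
      Primrec v → Primrec fun b => f (u b) (v b) := fun hu hv => hf.comp (hu.pair hv)
  unfold bindAtom
  fun_prop (disch := assumption)

@[fun_prop] theorem primrec_bindMatrix {f : α → IVar → NIdx} {M : α → List (List NAtom)}
    (hf : Primrec fun p : α × IVar => f p.1 p.2) (hM : Primrec M) :
    Primrec fun a => bindMatrix (f a) (M a) := by
  have h : ∀ {β : Type} [Primcodable β] {u : β → α} {v : β → IVar}, Primrec u →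
      Primrec v → Primrec fun b => f (u b) (v b) := fun hu hv => hf.comp (hu.pair hv)
  unfold bindMatrix
  fun_prop (disch := assumption)

@[fun_prop] theorem primrec_renameFun {g : α → ℕ → IVar} {x : α → IVar}
    (hg : Primrec fun p : α × ℕ => g p.1 p.2) (hx : Primrec x) :
    Primrec fun a => renameFun (g a) (x a) := by
  have hg' : ∀ {β : Type} [Primcodable β] {u : β → α} {v : β → ℕ}, Primrec u →
      Primrec v → Primrec fun b => g (u b) (v b) := fun hu hv => hg.comp (hu.pair hv)
  have h : Primrec fun a => ((IVar.equivSum (x a)).elim (fun p => (some (.par p.1 p.2), 0)) fun s =>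
      s.elim (fun p => (some (.idx p.1 p.2), 0)) fun k => (some (g a k), 0) : NIdx) := by
    fun_prop (disch := assumption)
  exact h.of_eq fun a => by cases x a <;> rfl

@[fun_prop] theorem primrec_instFun {t : α → NIdx} {x : α → IVar} (ht : Primrec t)
    (hx : Primrec x) : Primrec fun a => instFun (t a) (x a) := by
  have h : Primrec fun a => ((IVar.equivSum (x a)).elim (fun p => (some (.par p.1 p.2), 0)) fun s =>
      s.elim (fun p => (some (.idx p.1 p.2), 0)) fun k =>
        bif decide (k = 0) then t a else (some (.bnd (k - 1)), 0) : NIdx) := by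
    fun_prop
  refine h.of_eq fun a => ?_
  rcases x a with _ | _ | _ | k <;> rfl

@[fun_prop] theorem primrec_raiseVar {c n k : α → ℕ} (hc : Primrec c) (hn : Primrec n)
    (hk : Primrec k) : Primrec fun a => raiseVar (c a) (n a) (k a) := by
  unfold raiseVar; fun_prop

@[fun_prop] theorem primrec_starVar {p d k : α → ℕ} (hp : Primrec p) (hd : Primrec d)
    (hk : Primrec k) : Primrec fun a => starVar (p a) (d a) (k a) := by
  unfold starVar; fun_prop

@[fun_prop] theorem primrec_prenexOr {φ ψ : α → NPrenex} (hφ : Primrec φ) (hψ : Primrec ψ) :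
    Primrec fun a => prenexOr (φ a) (ψ a) := by
  unfold prenexOr; fun_prop

@[fun_prop] theorem primrec_prenexAnd {φ ψ : α → NPrenex} (hφ : Primrec φ) (hψ : Primrec ψ) :
    Primrec fun a => prenexAnd (φ a) (ψ a) := by
  unfold prenexAnd; fun_prop

@[fun_prop] theorem primrec_prenexStar {p d : α → ℕ} {φ : α → NPrenex} (hp : Primrec p)
    (hd : Primrec d) (hφ : Primrec φ) : Primrec fun a => prenexStar (p a) (d a) (φ a) := by
  unfold prenexStar; fun_prop

@[fun_prop] theorem primrec_negAtom {A : α → NAtom} (hA : Primrec A) :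
    Primrec fun a => negAtom (A a) := by
  unfold negAtom; fun_prop

/-! ### Constraints -/

@[fun_prop] theorem primrec_atomTerms {A : α → NAtom} (hA : Primrec A) :
    Primrec fun a => atomTerms (A a) := by
  unfold atomTerms datTerms; fun_prop

@[fun_prop] theorem primrec_isDataAtom {A : α → NAtom} (hA : Primrec A) :
    Primrec fun a => isDataAtom (A a) := by
  unfold isDataAtom; fun_prop

@[fun_prop] theorem primrec_constrTerms {P c : α → List NAtom} (hP : Primrec P)
    (hc : Primrec c) : Primrec fun a => constrTerms (P a) (c a) := by
  unfold constrTerms; fun_prop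

@[fun_prop] theorem primrec_cmpBool {c : α → Cmp} {x y : α → ℤ} (hc : Primrec c)
    (hx : Primrec x) (hy : Primrec y) : Primrec fun a => cmpBool (c a) (x a) (y a) := by
  have h : Primrec fun a => cmpTable (c a) := (Primrec.dom_finite cmpTable).comp hc
  unfold cmpBool
  fun_prop

@[fun_prop] theorem primrec_atomBool {z : α → IVar → ℤ} {d : α → Read → ℤ} {A : α → NAtom}
    (hz : Primrec fun p : α × IVar => z p.1 p.2) (hd : Primrec fun p : α × Read => d p.1 p.2)
    (hA : Primrec A) : Primrec fun a => atomBool (z a) (d a) (A a) := by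
  have h : ∀ {β : Type} [Primcodable β] {f : β → α} {g : β → IVar}, Primrec f →
      Primrec g → Primrec fun b => z (f b) (g b) := fun hf hg => hz.comp (hf.pair hg)
  have h' : ∀ {β : Type} [Primcodable β] {f : β → α} {g : β → Read}, Primrec f →
      Primrec g → Primrec fun b => d (f b) (g b) := fun hf hg => hd.comp (hf.pair hg)
  unfold atomBool
  fun_prop (disch := assumption)

@[fun_prop] theorem primrec_codeEnv {b : α → σ} {l : α → List σ} {x : α → β} (hb : Primrec b)
    (hl : Primrec l) (hx : Primrec x) : Primrec fun a => codeEnv (b a) (l a) (x a) := by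
  unfold codeEnv; fun_prop

@[fun_prop] theorem primrec_consistentBool {E : α → ℕ} {z : α → IVar → ℤ} {D : α → List ℤ}
    (hE : Primrec E) (hz : Primrec fun p : α × IVar => z p.1 p.2) (hD : Primrec D) :
    Primrec fun a => consistentBool (E a) (z a) (D a) := by
  have h : ∀ {β : Type} [Primcodable β] {f : β → α} {g : β → IVar}, Primrec f →
      Primrec g → Primrec fun b => z (f b) (g b) := fun hf hg => hz.comp (hf.pair hg)
  unfold consistentBool
  fun_prop (disch := assumption)

@[fun_prop] theorem primrec_intRange {B : α → ℕ} (hB : Primrec B) :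
    Primrec fun a => intRange (B a) := by
  unfold intRange; fun_prop

@[fun_prop] theorem primrec_matrixCode {P : α → List NAtom} {M : α → List (List NAtom)}
    (hP : Primrec P) (hM : Primrec M) : Primrec fun a => matrixCode (P a) (M a) := by
  unfold matrixCode; fun_prop

@[fun_prop] theorem primrec_modelBound {E : α → ℕ} (hE : Primrec E) :
    Primrec fun a => modelBound (E a) := by
  unfold modelBound; fun_prop

@[fun_prop] theorem primrec_boundedBeq {i : α → ℤ} {len : α → ℕ} {b b' : α → Bool}
    (hi : Primrec i) (hlen : Primrec len) (hb : Primrec b) (hb' : Primrec b') :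
    Primrec fun a => boundedBeq (i a) (len a) (b a) (b' a) := by
  unfold boundedBeq; fun_prop

@[fun_prop] theorem primrec_termsBool {P c : α → List NAtom} {z y : α → IVar → ℤ} {len : α → ℕ}
    {bit : α → ℕ → ℤ → Bool} {d : α → Read → ℤ} (hP : Primrec P) (hc : Primrec c)
    (hz : Primrec fun p : α × IVar => z p.1 p.2) (hlen : Primrec len)
    (hbit : Primrec fun p : α × ℕ × ℤ => bit p.1 p.2.1 p.2.2)
    (hy : Primrec fun p : α × IVar => y p.1 p.2) (hd : Primrec fun p : α × Read => d p.1 p.2) :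
    Primrec fun a => termsBool (P a) (c a) (z a) (len a) (bit a) (y a) (d a) := by
  have h : ∀ {β : Type} [Primcodable β] {f : β → α} {g : β → IVar}, Primrec f →
      Primrec g → Primrec fun b => z (f b) (g b) := fun hf hg => hz.comp (hf.pair hg)
  have h' : ∀ {β : Type} [Primcodable β] {f : β → α} {g : β → ℕ} {i : β → ℤ}, Primrec f →
      Primrec g → Primrec i → Primrec fun b => bit (f b) (g b) (i b) :=
    fun hf hg hi => hbit.comp (hf.pair (hg.pair hi))
  have hi : ∀ {β : Type} [Primcodable β] {f : β → α} {t : β → NIdx}, Primrec f →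
      Primrec t → Primrec fun b => idxVal (z (f b)) (t b) := fun hf ht =>
    primrec_idxVal (h (hf.comp .fst) .snd) ht
  have ha : ∀ {β : Type} [Primcodable β] {f : β → α} {A : β → NAtom}, Primrec f →
      Primrec A → Primrec fun b => atomBool (y (f b)) (d (f b)) (A b) := fun hf hA =>
    primrec_atomBool (hy.comp ((hf.comp .fst).pair .snd)) (hd.comp ((hf.comp .fst).pair .snd)) hA
  unfold termsBool
  fun_prop (disch := assumption)

@[fun_prop] theorem primrec_modelBool {E : α → ℕ} {P c : α → List NAtom} {z : α → IVar → ℤ}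
    {len : α → ℕ} {bit : α → ℕ → ℤ → Bool} {Y : α → List ℕ} {D : α → List ℤ} (hE : Primrec E)
    (hP : Primrec P) (hc : Primrec c) (hz : Primrec fun p : α × IVar => z p.1 p.2)
    (hlen : Primrec len) (hbit : Primrec fun p : α × ℕ × ℤ => bit p.1 p.2.1 p.2.2)
    (hY : Primrec Y) (hD : Primrec D) :
    Primrec fun a => modelBool (E a) (P a) (c a) (z a) (len a) (bit a) (Y a) (D a) := by
  unfold modelBool
  fun_prop

@[fun_prop] theorem primrec_matrixBool {P : α → List NAtom} {M : α → List (List NAtom)}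
    {z : α → IVar → ℤ} {len : α → ℕ} {bit : α → ℕ → ℤ → Bool} (hP : Primrec P) (hM : Primrec M)
    (hz : Primrec fun p : α × IVar => z p.1 p.2) (hlen : Primrec len)
    (hbit : Primrec fun p : α × ℕ × ℤ => bit p.1 p.2.1 p.2.2) :
    Primrec fun a => matrixBool (P a) (M a) (z a) (len a) (bit a) := by
  have h : ∀ {β : Type} [Primcodable β] {f : β → α} {g : β → IVar}, Primrec f →
      Primrec g → Primrec fun b => z (f b) (g b) := fun hf hg => hz.comp (hf.pair hg)
  have h' : ∀ {β : Type} [Primcodable β] {f : β → α} {g : β → ℕ} {i : β → ℤ}, Primrec f →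
      Primrec g → Primrec i → Primrec fun b => bit (f b) (g b) (i b) :=
    fun hf hg hi => hbit.comp (hf.pair (hg.pair hi))
  unfold matrixBool
  fun_prop (disch := assumption)

/-! ### Words -/

@[fun_prop] theorem primrec_bitAt {l : α → List Bool} {j : α → ℕ} (hl : Primrec l)
    (hj : Primrec j) : Primrec fun a => bitAt (l a) (j a) := by
  unfold bitAt; fun_prop

@[fun_prop] theorem primrec_prefixLength {f : α → List Bool → Bool} {w : α → List (List Bool)}
    (hf : Primrec fun p : α × List Bool => f p.1 p.2) (hw : Primrec w) :
    Primrec fun a => prefixLength (f a) (w a) := by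
  have h : ∀ {β : Type} [Primcodable β] {u : β → α} {v : β → List Bool}, Primrec u →
      Primrec v → Primrec fun b => f (u b) (v b) := fun hu hv => hf.comp (hu.pair hv)
  unfold prefixLength
  fun_prop (disch := assumption)

@[fun_prop] theorem primrec_rowValue {w : α → List (List Bool)} {j : α → ℕ} (hw : Primrec w)
    (hj : Primrec j) : Primrec fun a => rowValue (w a) (j a) := by
  unfold rowValue; fun_prop

@[fun_prop] theorem primrec_hasParBit {p : α → ℕ} {l : α → List Bool} (hp : Primrec p)
    (hl : Primrec l) : Primrec fun a => hasParBit (p a) (l a) := by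
  unfold hasParBit; fun_prop

@[fun_prop] theorem primrec_validWord {p d m off : α → ℕ} {w : α → List (List Bool)}
    (hp : Primrec p) (hd : Primrec d) (hm : Primrec m) (hoff : Primrec off) (hw : Primrec w) :
    Primrec fun a => validWord (p a) (d a) (m a) (off a) (w a) := by
  unfold validWord letterOk stepOk; fun_prop

@[fun_prop] theorem primrec_rowOf {off x : α → ℕ} {b : α → Bool} (hoff : Primrec off)
    (hb : Primrec b) (hx : Primrec x) : Primrec fun a => rowOf (off a) (b a) (x a) := by
  unfold rowOf; fun_prop

@[fun_prop] theorem primrec_wordVal {p d off : α → ℕ} {w : α → List (List Bool)}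
    {x : α → Option IVar} (hp : Primrec p) (hd : Primrec d) (hoff : Primrec off) (hw : Primrec w)
    (hx : Primrec x) : Primrec fun a => wordVal (p a) (d a) (off a) (w a) (x a) := by
  have h : Primrec fun a => ((x a).elim (prefixLength (hasParBit (p a)) (w a)) fun x =>
      (IVar.equivSum x).elim
        (fun y => bif decide (y.2 < p a) then rowValue (w a) (rowOf (off a) y.1 y.2) else 0)
        fun s => s.elim
          (fun y => bif decide (y.2 < d a) then rowValue (w a) (rowOf (off a) y.1 (p a + y.2))
            else 0) fun _ => 0) := by
    fun_prop
  refine h.of_eq fun a => ?_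
  rcases x a with _ | _ | _ | k <;> rfl

@[fun_prop] theorem primrec_letterBit {p d m n off k : α → ℕ} {l : α → List Bool}
    (hp : Primrec p) (hd : Primrec d) (hm : Primrec m) (hn : Primrec n) (hoff : Primrec off)
    (hl : Primrec l) (hk : Primrec k) :
    Primrec fun a => letterBit (p a) (d a) (m a) (n a) (off a) (l a) (k a) := by
  unfold letterBit; fun_prop

@[fun_prop] theorem primrec_wordBit {p d m n off k i : α → ℕ} {w : α → List (List Bool)}
    (hp : Primrec p) (hd : Primrec d) (hm : Primrec m) (hn : Primrec n) (hoff : Primrec off)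
    (hw : Primrec w) (hk : Primrec k) (hi : Primrec i) :
    Primrec fun a => wordBit (p a) (d a) (m a) (n a) (off a) (w a) (k a) (i a) := by
  unfold wordBit; fun_prop

@[fun_prop] theorem primrec_listEnv {l : α → List ℕ} {k : α → ℕ} (hl : Primrec l)
    (hk : Primrec k) : Primrec fun a => listEnv (l a) (k a) := by
  unfold listEnv; fun_prop

@[fun_prop] theorem primrec_mixVal {ν : α → Option IVar → ℕ} {e : α → ℕ → ℕ} {x : α → IVar}
    (hν : Primrec fun p : α × Option IVar => ν p.1 p.2) (he : Primrec fun p : α × ℕ => e p.1 p.2)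
    (hx : Primrec x) : Primrec fun a => mixVal (ν a) (e a) (x a) := by
  have h : ∀ {β : Type} [Primcodable β] {u : β → α} {v : β → Option IVar}, Primrec u →
      Primrec v → Primrec fun b => ν (u b) (v b) := fun hu hv => hν.comp (hu.pair hv)
  have h' : ∀ {β : Type} [Primcodable β] {u : β → α} {v : β → ℕ}, Primrec u →
      Primrec v → Primrec fun b => e (u b) (v b) := fun hu hv => he.comp (hu.pair hv)
  have h1 : Primrec fun a => ((IVar.equivSum (x a)).elim (fun y => ν a (some (.par y.1 y.2)))
      fun s => s.elim (fun y => ν a (some (.idx y.1 y.2))) fun k => e a k) := by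
    fun_prop (disch := assumption)
  refine h1.of_eq fun a => ?_
  rcases x a with _ | _ | k <;> rfl

@[fun_prop] theorem primrec_wordMatrixBool {p d m off : α → ℕ} {P : α → List NAtom}
    {M : α → List (List NAtom)} {w : α → List (List Bool)} {e : α → List ℕ} (hp : Primrec p)
    (hd : Primrec d) (hm : Primrec m) (hoff : Primrec off) (hP : Primrec P) (hM : Primrec M)
    (hw : Primrec w) (he : Primrec e) :
    Primrec fun a => wordMatrixBool (p a) (d a) (m a) (off a) (P a) (M a) (w a) (e a) := by
  unfold wordMatrixBool; fun_prop

-- The list of chosen values changes from call to call and the number of calls is not fixed, so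
-- plain recursion on `q` does not apply. The recursion is presented by a list of recursive calls, a
-- rule combining their results, and a decreasing measure, the length of `q`.
@[fun_prop] theorem primrec_quantBounded {L N : α → ℕ} {p : α → List ℕ → Bool}
    {q : α → List Bool} {e : α → List ℕ} (hL : Primrec L) (hN : Primrec N)
    (hp : Primrec fun x : α × List ℕ => p x.1 x.2) (hq : Primrec q) (he : Primrec e) :
    Primrec fun a => quantBounded (L a) (N a) (p a) (q a) (e a) := by
  have hp' : ∀ {β : Type} [Primcodable β] {u : β → α} {v : β → List ℕ}, Primrec u →
      Primrec v → Primrec fun b => p (u b) (v b) := fun hu hv => hp.comp (hu.pair hv)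
  have h : Primrec₂ fun a (b : List Bool × List ℕ) => quantBounded (L a) (N a) (p a) b.1 b.2 := by
    refine Primrec.nat_omega_rec
      (m := fun _ b => b.1.length)
      (l := fun a b => (b.1[0]?).elim [] fun _ =>
        (List.range (L a + (b.2.length + 1) * N a)).map fun n => (b.1.tail, n :: b.2))
      (g := fun a c => some ((c.1.1[0]?).elim (p a c.1.2) fun b =>
        bif b then c.2.all fun x => x else c.2.any fun x => x)) _ ?_ ?_ ?_ ?_ ?_
    · change Primrec fun x : α × List Bool × List ℕ => x.2.1.length
      fun_prop
    · change Primrec fun x : α × List Bool × List ℕ => (x.2.1[0]?).elim [] fun _ =>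
        (List.range (L x.1 + (x.2.2.length + 1) * N x.1)).map fun n => (x.2.1.tail, n :: x.2.2)
      fun_prop
    · change Primrec fun x : α × (List Bool × List ℕ) × List Bool =>
        some ((x.2.1.1[0]?).elim (p x.1 x.2.1.2) fun b =>
          bif b then x.2.2.all fun x => x else x.2.2.any fun x => x)
      fun_prop (disch := assumption)
    · rintro a ⟨_ | ⟨b, q⟩, e⟩ b' hb'
      · simp at hb'
      · simp only [List.getElem?_cons_zero, Option.elim_some, List.mem_map] at hb'
        obtain ⟨n, -, rfl⟩ := hb'
        simp
    · rintro a ⟨_ | ⟨b, q⟩, e⟩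
      · simp [quantBounded]
      · cases b <;> simp [quantBounded, List.any_map, List.all_map, Function.comp_def]
  exact h.comp Primrec.id (hq.pair he)

@[fun_prop] theorem primrec_formulaStates {P : α → List NAtom} {φ : α → NPrenex}
    (hP : Primrec P) (hφ : Primrec φ) : Primrec fun a => formulaStates (P a) (φ a) := by
  unfold formulaStates matrixStates atomStates; fun_prop

@[fun_prop] theorem primrec_wordBool {p d m off : α → ℕ} {P : α → List NAtom}
    {φ : α → NPrenex} {w : α → List (List Bool)} (hp : Primrec p)
    (hd : Primrec d) (hm : Primrec m) (hoff : Primrec off) (hP : Primrec P) (hφ : Primrec φ)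
    (hw : Primrec w) :
    Primrec fun a => wordBool (p a) (d a) (m a) (off a) (P a) (φ a) (w a) := by
  unfold wordBool; fun_prop

@[fun_prop] theorem primrec_formulaAutomaton {p d m off : α → ℕ} {P : α → List NAtom}
    {φ : α → NPrenex} (hp : Primrec p)
    (hd : Primrec d) (hm : Primrec m) (hoff : Primrec off) (hP : Primrec P) (hφ : Primrec φ) :
    Primrec fun a => formulaAutomaton (p a) (d a) (m a) (off a) (P a) (φ a) := by
  unfold formulaAutomaton; fun_prop

end Program

end ArrayAbs

namespace ArrayAbs

open Encodable

/-! ## Normal forms from codes -/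

/-- Constructors with recursive arguments carry positive tags, so codes of subexpressions are
strictly smaller and course-of-values recursion applies. -/
theorem lt_pair_right {a : ℕ} (ha : 0 < a) (b : ℕ) : b < Nat.pair a b := by
  rw [Nat.pair]
  split_ifs with h
  · nlinarith
  · nlinarith

def codeBool (n : ℕ) : Bool := decide (n = 1)

def codeInt (n : ℕ) : ℤ := Denumerable.ofNat ℤ n

def codeCmp (n : ℕ) : Cmp :=
  bif decide (n = 0) then .eq else bif decide (n = 1) then .ne else bif decide (n = 2) then .le
    else bif decide (n = 3) then .lt else bif decide (n = 4) then .ge else .gt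

def codeVar (n : ℕ) : IVar :=
  bif decide (n.unpair.1 = 0) then .par (codeBool n.unpair.2.unpair.1) n.unpair.2.unpair.2
  else bif decide (n.unpair.1 = 1) then .idx (codeBool n.unpair.2.unpair.1) n.unpair.2.unpair.2
  else .bnd n.unpair.2

def codeIdxStep (sizes : List ℕ) (n : ℕ) (l : List NIdx) : NIdx :=
  bif decide (n.unpair.1 = 0) then (some (codeVar n.unpair.2), 0)
  else bif decide (n.unpair.1 = 1) then (none, codeInt n.unpair.2)
  else bif decide (n.unpair.1 = 2) then
    (some (.par (codeBool n.unpair.2.unpair.1) (sizes.getD n.unpair.2.unpair.2 0)), 0)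
  else ((l.getD n.unpair.2.unpair.1 (none, 0)).1,
    (l.getD n.unpair.2.unpair.1 (none, 0)).2 + codeInt n.unpair.2.unpair.2)

def codeIdx (sizes : List ℕ) (n : ℕ) : NIdx := courseRec (codeIdxStep sizes) n

def codeDatStep (sizes : List ℕ) (n : ℕ) (l : List NDat) : NDat :=
  bif decide (n.unpair.1 = 0) then
    (some (.inl (codeBool n.unpair.2.unpair.1, n.unpair.2.unpair.2)), 0)
  else bif decide (n.unpair.1 = 1) then (none, codeInt n.unpair.2)
  else bif decide (n.unpair.1 = 2) then
    (some (.inr (codeBool n.unpair.2.unpair.1, n.unpair.2.unpair.2.unpair.1,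
      codeIdx sizes n.unpair.2.unpair.2.unpair.2)), 0)
  else ((l.getD n.unpair.2.unpair.1 (none, 0)).1,
    (l.getD n.unpair.2.unpair.1 (none, 0)).2 + codeInt n.unpair.2.unpair.2)

def codeDat (sizes : List ℕ) (n : ℕ) : NDat := courseRec (codeDatStep sizes) n

def codeAtom (sizes : List ℕ) (n : ℕ) : NAtom :=
  bif decide (n.unpair.1 = 0) then
    .inl (codeCmp n.unpair.2.unpair.1, codeIdx sizes n.unpair.2.unpair.2.unpair.1,
      codeIdx sizes n.unpair.2.unpair.2.unpair.2)
  else .inr (codeCmp n.unpair.2.unpair.1, codeDat sizes n.unpair.2.unpair.2.unpair.1,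
      codeDat sizes n.unpair.2.unpair.2.unpair.2)

def signedAtom (A : NAtom) : NPrenex × NPrenex := (([], [[A]]), ([], [[negAtom A]]))

def signedOr (φ ψ : NPrenex × NPrenex) : NPrenex × NPrenex :=
  (prenexOr φ.1 ψ.1, prenexAnd φ.2 ψ.2)

def signedAnd (φ ψ : NPrenex × NPrenex) : NPrenex × NPrenex :=
  (prenexAnd φ.1 ψ.1, prenexOr φ.2 ψ.2)

def signedQuant (b : Bool) (φ : NPrenex × NPrenex) : NPrenex × NPrenex :=
  ((b :: φ.1.1, φ.1.2), ((!b) :: φ.2.1, φ.2.2))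

/-- Normal forms of a formula and of its negation are computed together, which turns negation into a
swap. Tag `5` belongs to `∀`; the default pairs are never reached on codes of formulae. -/
def codeFormulaStep (sizes : List ℕ) (n : ℕ) (l : List (NPrenex × NPrenex)) :
    NPrenex × NPrenex :=
  bif decide (n.unpair.1 = 0) then signedAtom (codeAtom sizes n.unpair.2)
  else bif decide (n.unpair.1 = 1) then
    ((l.getD n.unpair.2 (([], []), ([], []))).2, (l.getD n.unpair.2 (([], []), ([], []))).1)
  else bif decide (n.unpair.1 = 2) then
    signedOr (l.getD n.unpair.2.unpair.1 (([], []), ([], [])))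
      (l.getD n.unpair.2.unpair.2 (([], []), ([], [])))
  else bif decide (n.unpair.1 = 3) then
    signedAnd (l.getD n.unpair.2.unpair.1 (([], []), ([], [])))
      (l.getD n.unpair.2.unpair.2 (([], []), ([], [])))
  else signedQuant (decide (n.unpair.1 = 5)) (l.getD n.unpair.2 (([], []), ([], [])))

/-- The normal forms of the formula with code `n` and of its negation. -/
def codeFormula (sizes : List ℕ) (n : ℕ) : NPrenex × NPrenex :=
  courseRec (codeFormulaStep sizes) n

/-! ### Correctness of the extraction of normal forms from codes. -/

section Correct

theorem codeBool_encode (b : Bool) : codeBool (encode b) = b := by cases b <;> rfl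

theorem codeInt_encode (n : ℤ) : codeInt (encode n) = n := Denumerable.ofNat_encode n

theorem codeCmp_code (c : Cmp) : codeCmp c.code = c := by cases c <;> rfl

theorem codeVar_code (x : IVar) : codeVar x.code = x := by
  cases x <;> simp [codeVar, IVar.code, codeBool_encode]

theorem codeIdx_code (sizes : List ℕ) (I : ITerm) : codeIdx sizes I.code = I.nf sizes := by
  induction I with
  | var x => simp [codeIdx, courseRec, codeIdxStep, ITerm.code, ITerm.nf, codeVar_code]
  | const n => simp [codeIdx, courseRec, codeIdxStep, ITerm.code, ITerm.nf, codeInt_encode]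
  | size b a => simp [codeIdx, courseRec, codeIdxStep, ITerm.code, ITerm.nf, codeBool_encode]
  | plus I n ih =>
    have h : I.code < (ITerm.plus I n).code :=
      (Nat.left_le_pair _ _).trans_lt (lt_pair_right (by simp) _)
    rw [ITerm.nf, ← ih, codeIdx, courseRec, codeIdxStep]
    simp only [ITerm.code, Nat.unpair_pair] at h ⊢
    rw [courseTable_getD _ h]
    simp [codeIdx, codeInt_encode]

theorem codeDat_code (sizes : List ℕ) (E : DTerm) : codeDat sizes E.code = E.nf sizes := by
  induction E with
  | var b v => simp [codeDat, courseRec, codeDatStep, DTerm.code, DTerm.nf, codeBool_encode]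
  | const n => simp [codeDat, courseRec, codeDatStep, DTerm.code, DTerm.nf, codeInt_encode]
  | get b a I =>
    simp [codeDat, courseRec, codeDatStep, DTerm.code, DTerm.nf, codeBool_encode, codeIdx_code]
  | plus E n ih =>
    have h : E.code < (DTerm.plus E n).code :=
      (Nat.left_le_pair _ _).trans_lt (lt_pair_right (by simp) _)
    rw [DTerm.nf, ← ih, codeDat, courseRec, codeDatStep]
    simp only [DTerm.code, Nat.unpair_pair] at h ⊢
    rw [courseTable_getD _ h]
    simp [codeDat, codeInt_encode]

theorem codeAtom_code (sizes : List ℕ) (A : Atom) : codeAtom sizes A.code = A.nf sizes := by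
  cases A <;> simp [codeAtom, Atom.code, Atom.nf, codeCmp_code, codeIdx_code, codeDat_code]

theorem codeFormula_code (sizes : List ℕ) (φ : Formula) :
    codeFormula sizes φ.code = (φ.nprenex sizes false, φ.nprenex sizes true) := by
  have hstep : ∀ n, codeFormula sizes n =
      codeFormulaStep sizes n (courseTable (codeFormulaStep sizes) n) := fun _ => rfl
  have hget : ∀ {k n : ℕ}, k < n →
      (courseTable (codeFormulaStep sizes) n).getD k (([], []), ([], [])) = codeFormula sizes k :=
    fun h => courseTable_getD _ h _
  induction φ with
  | atom A =>
    rw [hstep, codeFormulaStep]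
    simp [Formula.code, codeAtom_code, signedAtom, Formula.nprenex]
  | not φ ih =>
    have h : φ.code < Nat.pair 1 φ.code := lt_pair_right (by simp) _
    rw [hstep, codeFormulaStep]
    simp only [Formula.code, Nat.unpair_pair]
    rw [hget h, ih]
    simp [Formula.nprenex]
  | or φ ψ ih1 ih2 =>
    have h : Nat.pair φ.code ψ.code < Nat.pair 2 (Nat.pair φ.code ψ.code) :=
      lt_pair_right (by simp) _
    rw [hstep, codeFormulaStep]
    simp only [Formula.code, Nat.unpair_pair]
    rw [hget ((Nat.left_le_pair _ _).trans_lt h), hget ((Nat.right_le_pair _ _).trans_lt h), ih1,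
      ih2]
    simp [Formula.nprenex, signedOr]
  | and φ ψ ih1 ih2 =>
    have h : Nat.pair φ.code ψ.code < Nat.pair 3 (Nat.pair φ.code ψ.code) :=
      lt_pair_right (by simp) _
    rw [hstep, codeFormulaStep]
    simp only [Formula.code, Nat.unpair_pair]
    rw [hget ((Nat.left_le_pair _ _).trans_lt h), hget ((Nat.right_le_pair _ _).trans_lt h), ih1,
      ih2]
    simp [Formula.nprenex, signedAnd]
  | ex φ ih =>
    have h : φ.code < Nat.pair 4 φ.code := lt_pair_right (by simp) _
    rw [hstep, codeFormulaStep]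
    simp only [Formula.code, Nat.unpair_pair]
    rw [hget h, ih]
    simp [Formula.nprenex, signedQuant]
  | all φ ih =>
    have h : φ.code < Nat.pair 5 φ.code := lt_pair_right (by simp) _
    rw [hstep, codeFormulaStep]
    simp only [Formula.code, Nat.unpair_pair]
    rw [hget h, ih]
    simp [Formula.nprenex, signedQuant]

end Correct

/-! ### Primed atoms -/

def primeVar (x : IVar) : IVar :=
  (IVar.equivSum x).elim (fun y => .par true y.2) fun s => s.elim (fun y => .idx true y.2) .bnd

def primeIdx (t : NIdx) : NIdx := t.1.elim t fun x => (some (primeVar x), t.2)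

def primeRead (r : Read) : Read :=
  r.elim (fun p => .inl (true, p.2)) fun p => .inr (true, p.2.1, primeIdx p.2.2)

def primeDat (t : NDat) : NDat := t.1.elim t fun r => (some (primeRead r), t.2)

def primeAtom (A : NAtom) : NAtom :=
  A.elim (fun p => .inl (p.1, primeIdx p.2.1, primeIdx p.2.2))
    fun p => .inr (p.1, primeDat p.2.1, primeDat p.2.2)

theorem ITerm.nf_prime (sizes : List ℕ) (I : ITerm) : I.prime.nf sizes = primeIdx (I.nf sizes) := by
  induction I with
  | var x => cases x <;> rfl
  | const n => rfl
  | size b a => rfl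
  | plus I n ih =>
    simp only [ITerm.prime, ITerm.nf, ih]
    rcases h : I.nf sizes with ⟨_ | x, k⟩ <;> simp [primeIdx]

theorem DTerm.nf_prime (sizes : List ℕ) (E : DTerm) : E.prime.nf sizes = primeDat (E.nf sizes) := by
  induction E with
  | var b v => rfl
  | const n => rfl
  | get b a I => simp [DTerm.prime, DTerm.nf, ITerm.nf_prime, primeDat, primeRead]
  | plus E n ih =>
    simp only [DTerm.prime, DTerm.nf, ih]
    rcases h : E.nf sizes with ⟨_ | x, k⟩ <;> simp [primeDat]

theorem Atom.nf_prime (sizes : List ℕ) (A : Atom) : A.prime.nf sizes = primeAtom (A.nf sizes) := by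
  cases A <;> simp [Atom.prime, Atom.nf, primeAtom, ITerm.nf_prime, DTerm.nf_prime]

/-! ### The program -/

def parCount (c : InputCode) : ℕ := c.1.1.1 + c.2.1.1

def sizes (c : InputCode) : List ℕ := c.1.1.2.2.2

def predicates (c : InputCode) : List NAtom := c.2.2.map (codeAtom (sizes c))

def initForm (c : InputCode) : NPrenex :=
  prenexAnd (codeFormula (sizes c) c.1.2.1).1
    (prenexStar c.1.1.1 0 (codeFormula (sizes c) c.2.1.2.1).1)

def transForm (c : InputCode) : NPrenex := (codeFormula (sizes c) c.1.2.2).1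

/-- The second component of `codeFormula` is the normal form of the negation, as `badStar` requires.
-/
def badForm (c : InputCode) : NPrenex :=
  prenexStar c.1.1.1 0 (codeFormula (sizes c) c.2.1.2.2).2

def initAutomaton (c : InputCode) : Automaton :=
  formulaAutomaton (parCount c) c.1.1.2.1 (predicates c).length 0 (predicates c) (initForm c)

def transAutomaton (c : InputCode) : Automaton :=
  formulaAutomaton (parCount c) c.1.1.2.1 (predicates c).length
    (parCount c + c.1.1.2.1 + (predicates c).length)
    (predicates c ++ (predicates c).map primeAtom) (transForm c)

def badAutomaton (c : InputCode) : Automaton :=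
  formulaAutomaton (parCount c) c.1.1.2.1 (predicates c).length 0 (predicates c) (badForm c)

/-! ### Primitive recursiveness of the three automaton constructions. -/

section Primitive

variable {α : Type} [Primcodable α]

@[fun_prop] theorem primrec_codeBool {n : α → ℕ} (hn : Primrec n) :
    Primrec fun a => codeBool (n a) := by
  unfold codeBool; fun_prop

@[fun_prop] theorem primrec_codeInt {n : α → ℕ} (hn : Primrec n) :
    Primrec fun a => codeInt (n a) := by
  unfold codeInt; fun_prop

@[fun_prop] theorem primrec_codeCmp {n : α → ℕ} (hn : Primrec n) :
    Primrec fun a => codeCmp (n a) := by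
  unfold codeCmp; fun_prop

@[fun_prop] theorem primrec_codeVar {n : α → ℕ} (hn : Primrec n) :
    Primrec fun a => codeVar (n a) := by
  unfold codeVar; fun_prop

@[fun_prop] theorem primrec_codeIdx {s : α → List ℕ} {n : α → ℕ} (hs : Primrec s)
    (hn : Primrec n) : Primrec fun a => codeIdx (s a) (n a) := by
  unfold codeIdx codeIdxStep; fun_prop

@[fun_prop] theorem primrec_codeDat {s : α → List ℕ} {n : α → ℕ} (hs : Primrec s)
    (hn : Primrec n) : Primrec fun a => codeDat (s a) (n a) := by
  unfold codeDat codeDatStep; fun_prop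

@[fun_prop] theorem primrec_codeAtom {s : α → List ℕ} {n : α → ℕ} (hs : Primrec s)
    (hn : Primrec n) : Primrec fun a => codeAtom (s a) (n a) := by
  unfold codeAtom; fun_prop

@[fun_prop] theorem primrec_codeFormulaStep {s : α → List ℕ} {n : α → ℕ}
    {l : α → List (NPrenex × NPrenex)} (hs : Primrec s) (hn : Primrec n) (hl : Primrec l) :
    Primrec fun a => codeFormulaStep (s a) (n a) (l a) := by
  unfold codeFormulaStep signedAtom signedOr signedAnd signedQuant; fun_prop

@[fun_prop] theorem primrec_codeFormula {s : α → List ℕ} {n : α → ℕ} (hs : Primrec s)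
    (hn : Primrec n) : Primrec fun a => codeFormula (s a) (n a) := by
  unfold codeFormula; fun_prop

@[fun_prop] theorem primrec_primeVar {x : α → IVar} (hx : Primrec x) :
    Primrec fun a => primeVar (x a) := by
  unfold primeVar; fun_prop

@[fun_prop] theorem primrec_primeIdx {x : α → NIdx} (hx : Primrec x) :
    Primrec fun a => primeIdx (x a) := by
  unfold primeIdx; fun_prop

@[fun_prop] theorem primrec_primeAtom {A : α → NAtom} (hA : Primrec A) :
    Primrec fun a => primeAtom (A a) := by
  unfold primeAtom primeDat primeRead; fun_prop

theorem primrec_parCount : Primrec parCount :=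
  primrec_add (primrec_fst (primrec_fst .fst)) (primrec_fst (primrec_fst .snd))

theorem primrec_idxCount : Primrec fun c : InputCode => c.1.1.2.1 :=
  primrec_fst (primrec_snd (primrec_fst .fst))

theorem primrec_sizes : Primrec sizes :=
  primrec_snd (primrec_snd (primrec_snd (primrec_fst .fst)))

theorem primrec_predicates : Primrec predicates :=
  primrec_map (primrec_snd .snd) (primrec_codeAtom (primrec_sizes.comp .fst) .snd)

theorem primrec_initForm : Primrec initForm :=
  primrec_prenexAnd (primrec_fst (primrec_codeFormula primrec_sizes (primrec_fst (primrec_snd .fst))))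
    (primrec_prenexStar (primrec_fst (primrec_fst .fst)) (.const 0)
      (primrec_fst (primrec_codeFormula primrec_sizes
        (primrec_fst (primrec_snd (primrec_fst .snd))))))

theorem primrec_transForm : Primrec transForm :=
  primrec_fst (primrec_codeFormula primrec_sizes (primrec_snd (primrec_snd .fst)))

theorem primrec_badForm : Primrec badForm :=
  primrec_prenexStar (primrec_fst (primrec_fst .fst)) (.const 0)
    (primrec_snd (primrec_codeFormula primrec_sizes
      (primrec_snd (primrec_snd (primrec_fst .snd)))))

theorem primrec_initAutomaton : Primrec initAutomaton :=
  primrec_formulaAutomaton primrec_parCount primrec_idxCount (primrec_length primrec_predicates)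
    (.const 0) primrec_predicates primrec_initForm

theorem primrec_transAutomaton : Primrec transAutomaton :=
  primrec_formulaAutomaton primrec_parCount primrec_idxCount (primrec_length primrec_predicates)
    (primrec_add (primrec_add primrec_parCount primrec_idxCount)
      (primrec_length primrec_predicates))
    (primrec_append primrec_predicates
      (primrec_map primrec_predicates (primrec_primeAtom .snd))) primrec_transForm

theorem primrec_badAutomaton : Primrec badAutomaton :=
  primrec_formulaAutomaton primrec_parCount primrec_idxCount (primrec_length primrec_predicates)
    (.const 0) primrec_predicates primrec_badForm

end Primitive

/-! ### The automata computed from an input code recognize the three languages. -/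

section Main

variable (S : ArraySystem) (φ : SafetyProperty) {m : ℕ} (P : Fin m → Atom)

theorem predicates_inputCode :
    predicates (inputCode S φ P) = List.ofFn fun k => (P k).nf (S.V.star φ.k).size := by
  simp only [predicates, sizes, inputCode, List.map_ofFn, Function.comp_def, codeAtom_code]
  rfl

theorem initAutomaton_accepts : (initAutomaton (inputCode S φ P)).toNFA.accepts =
    lang (absStates (S.V.star φ.k) P (initStar S φ)) := by
  rw [lang_absStates, initAutomaton, initForm, formulaAutomaton_accepts, predicates_inputCode]
  simp only [parCount, sizes, inputCode, List.length_ofFn, codeFormula_code]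
  rw [← Formula.nprenex_star]
  rfl

theorem badAutomaton_accepts : (badAutomaton (inputCode S φ P)).toNFA.accepts =
    lang (absStates (S.V.star φ.k) P (badStar S φ)) := by
  rw [lang_absStates, badAutomaton, badForm, formulaAutomaton_accepts, predicates_inputCode]
  simp only [parCount, sizes, inputCode, List.length_ofFn, codeFormula_code]
  rw [← Formula.nprenex_star]
  rfl

/-- Matches the predicates `P * P'` with the list assembled in `transAutomaton`, where priming acts
on normal forms. -/
theorem ofFn_starPred (sizes : List ℕ) : (List.ofFn fun k => (starPred P k).nf sizes) =
    (List.ofFn fun k => (P k).nf sizes) ++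
      (List.ofFn fun k => (P k).nf sizes).map primeAtom := by
  rw [List.map_ofFn, ← List.ofFn_fin_append]
  congr 1
  funext k
  refine Fin.addCases (fun k => ?_) (fun k => ?_) k
  · rw [starPred, Fin.append_left, Fin.append_left]
  · rw [starPred, Fin.append_right, Fin.append_right, Atom.nf_prime]
    rfl

theorem transAutomaton_accepts : (transAutomaton (inputCode S φ P)).toNFA.accepts =
    langTrans (absTrans (S.V.star φ.k) P S.trans) := by
  rw [langTrans_absTrans, transAutomaton, transForm, formulaAutomaton_accepts, predicates_inputCode,
    ofFn_starPred]
  simp only [parCount, sizes, inputCode, List.length_ofFn, codeFormula_code]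
  rfl

end Main

end ArrayAbs

open ArrayAbs
theorem mainTheorem2 :
    ∃ F : InputCode → Automaton × Automaton × Automaton, Computable F ∧
      ∀ (S : ArraySystem) (φ : SafetyProperty) (m : ℕ) (P : Fin m → Atom),
        S.WF → φ.WF S.V → S.Abstractable →
        ((TFormula.not φ.toTemporal).nnf false).Abstractable →
        (∀ k, IsIndexedPredicate (S.V.star φ.k) (P k)) →
        ∃ (AI AT AB : Automaton) (I B : Set (AbsState (S.V.star φ.k) m))
          (T : Set (AbsState (S.V.star φ.k) m × AbsState (S.V.star φ.k) m)),
          F (inputCode S φ P) = (AI, AT, AB) ∧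
          I = absStates (S.V.star φ.k) P (initStar S φ) ∧
          T = absTrans (S.V.star φ.k) P S.trans ∧
          B = absStates (S.V.star φ.k) P (badStar S φ) ∧
          AI.toNFA.accepts = lang I ∧
          AT.toNFA.accepts = langTrans T ∧
          AB.toNFA.accepts = lang B ∧
          alpha (S.V.star φ.k) P {s | (initStar S φ).Sat (S.V.star φ.k) s} ⊆ I ∧
          alphaTrans (S.V.star φ.k) P {p | Step (S.V.star φ.k) S.trans p.1 p.2} ⊆ tau '' T ∧
          alpha (S.V.star φ.k) P {s | (badStar S φ).Sat (S.V.star φ.k) s} ⊆ B ∧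
          (SafetyHolds I T B → S.Holds φ.toTemporal) := by
  refine ⟨fun c => (initAutomaton c, transAutomaton c, badAutomaton c),
    (primrec_initAutomaton.pair (primrec_transAutomaton.pair primrec_badAutomaton)).to_comp,
    fun S φ m P hS hφ _ _ hP => ?_⟩
  have hV := hS.1.star φ.k
  have hP' : ∀ k, (P k).Over (S.V.star φ.k) false 1 := fun k => (hP k).1
  have hinit : (initStar S φ).Over (S.V.star φ.k) false 0 :=
    ⟨Formula.Over.mono (S.V.le_star φ.k) id le_rfl hS.2.1, Formula.Over.star hφ.1⟩
  have hbad : (badStar S φ).Over (S.V.star φ.k) false 0 := Formula.Over.star (k := φ.k) hφ.2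
  exact ⟨_, _, _, _, _, _, rfl, rfl, rfl, rfl, initAutomaton_accepts S φ P,
    transAutomaton_accepts S φ P, badAutomaton_accepts S φ P,
    alpha_subset_absStates hV hP' hinit,
    alphaTrans_subset hV hP' (Formula.Over.mono (S.V.le_star φ.k) id le_rfl hS.2.2),
    alpha_subset_absStates hV hP' hbad, holds_of_safetyHolds hS hφ hP'⟩
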